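/- We work over $\mathbb{C}$. A cubic plane Cremona map is a birational map $\varphi=[f_0:f_1:f_2]$ of $\mathbb{P}^2$ to itself, where $f_0,f_1,f_2$ are cubic forms without common factor. Its base points are the (proper or infinitely near) points of $\mathbb{P}^2$ at which the linear system spanned by $f_0,f_1,f_2$ has positive multiplicity. The enriched weighted proximity graph of $\varphi$ consists of the digraph whose vertices are the base points of $\varphi$ and which has an arrow $p\to q$ if and only if $p$ is proximate to $q$ (that is, $p$ is infinitely near $q$ and lies on the strict transform of the exceptional curve of the blow-up of $q$); of the weight of each vertex, which is the multiplicity of $\varphi$ at that base point; and of the list of the lines of $\mathbb{P}^2$ passing through three base points, where a line passes through an infinitely near point if its strict transform does, each line being recorded by the set of base points through which it passes. An isomorphism of such graphs is a bijection of the vertices preserving arrows, weights and lines. **Theorem.** Up to isomorphism, there are exactly 31 enriched weighted proximity graphs of cubic plane Cremona maps, namely the following pairwise non-isomorphic graphs with vertices $0,1,2,3,4$, where vertex $0$ has weight $2$, vertices $1,2,3,4$ have weight $1$, $ij$ denotes an arrow $i\to j$, and there is no line unless one is indicated: 1. $43,32,21,10,20$; 2. $43,32,21,10$; 3. $43,32,10,20$;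 4. $43,30,21,10$; 5. $32,21,10,20$; 6. $32,10,20$; 7. $32,21,10$; 8. $43,32,21$, with a line $\{1,2,3\}$; 9. $43,32,21$; 10. $43,32,10$, with a line $\{2,3,4\}$; 11. $43,32,10$; 12. $43,21,10,20$; 13. $43,21,10$; 14. $43,10,20$; 15. $21,10,20$; 16. $21,10$; 17. $43,32$, with a line $\{1,2,3\}$; 18. $43,32$, with a line $\{2,3,4\}$; 19. $43,32$; 20. $43,21$, with a line $\{1,2,3\}$; 21. $43,21$; 22. $43,10$, with a line $\{2,3,4\}$; 23. $43,10$; 24. $43$, with a line $\{1,2,3\}$; 25. $43$, with a line $\{2,3,4\}$; 26. $43$; 27. $10,20$; 28. $10$, with a line $\{2,3,4\}$; 29. $10$; 30. no arrow, with a line $\{2,3,4\}$; 31. no arrow. That is, the enriched weighted proximity graph of every cubic plane Cremona map is isomorphic to exactly one graph of this list, and every graph of this list is isomorphic to the enriched weighted proximity graph of some cubic plane Cremona map. -/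

import Mathlib

open MvPolynomial

noncomputable section

/-! ## The bubble space of the complex projective plane -/

/-- A point of the bubble space of the complex projective plane `ℙ²`, in standard coordinates.
`⟨p, []⟩` is the proper point `p`.  If `q = ⟨p, ts⟩` is a point, then `⟨p, ts ++ [t]⟩`, for
`t ∈ ℙ¹ = ℂ ∪ {∞}`, are the points of the exceptional curve of the blow-up at `q`, that is, the
points in the first neighbourhood of `q`.  The coordinate charts behind this are given by
`localMap` (around a proper point) and `blowupMap` (around a point of an exceptional curve). -/
@[ext]
structure BubblePoint where
  /-- the proper point below (or equal to) the given point -/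
  proper : Projectivization ℂ (Fin 3 → ℂ)
  /-- the successive points on the exceptional curves -/
  tail : List (OnePoint ℂ)

/-- Local affine coordinates at a proper point `p = [a : b : c]`: the homomorphism
`ℂ[x, y, z] → ℂ[x₀, x₁]` writing a form in affine coordinates `x₀, x₁` on a standard affine chart,
translated so that `p` is the origin.  (The values do not depend on the representative.) -/
def localMap (p : Projectivization ℂ (Fin 3 → ℂ)) :
    MvPolynomial (Fin 3) ℂ →ₐ[ℂ] MvPolynomial (Fin 2) ℂ :=
  open Classical in
  aeval
    (if p.rep 2 ≠ 0 then ![X 0 + C (p.rep 0 / p.rep 2), X 1 + C (p.rep 1 / p.rep 2), 1]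
     else if p.rep 1 ≠ 0 then ![X 0 + C (p.rep 0 / p.rep 1), 1, X 1]
     else ![1, X 0, X 1])

/-- The blow-up of the origin of the affine plane, in an affine chart centred at the point `t` of
the exceptional curve.  For `t ∈ ℂ` this is the first chart `(x₀, x₁) ↦ (x₀, x₀ x₁)` translated by
`x₁ ↦ x₁ + t`; for `t = ∞` it is the second chart, with its coordinates interchanged.
In all cases the exceptional curve is `x₀ = 0` and the point `t` is the origin. -/
def blowupMap (t : OnePoint ℂ) : MvPolynomial (Fin 2) ℂ →ₐ[ℂ] MvPolynomial (Fin 2) ℂ :=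
  match t with
  | OnePoint.infty => aeval ![X 0 * X 1, X 0]
  | OnePoint.some a => aeval ![X 0, X 0 * (X 1 + C a)]

/-- The multiplicity at the origin of a system `L` of plane curves: the least degree of a monomial
occurring in some member of `L`.  For a linear system it is the multiplicity of a general member. -/
def systemMult (L : Set (MvPolynomial (Fin 2) ℂ)) : ℕ :=
  sInf {n | ∃ f ∈ L, ∃ s ∈ f.support, s.degree = n}

/-- The transform of a system of plane curves at the point `t` of the exceptional curve of the
blow-up of the origin: pull back and divide by `x₀ ^ m`, where `m` is the multiplicity of the
system at the origin.  For a one-element system `{f}` this is the strict transform of the curve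
`f = 0`. -/
def transform (t : OnePoint ℂ) (L : Set (MvPolynomial (Fin 2) ℂ)) :
    Set (MvPolynomial (Fin 2) ℂ) :=
  (fun f => (blowupMap t f).divMonomial (Finsupp.single 0 (systemMult L))) '' L

/-- Iterated transform along a sequence of points, each on the last exceptional curve. -/
def transformAlong (ts : List (OnePoint ℂ)) (L : Set (MvPolynomial (Fin 2) ℂ)) :
    Set (MvPolynomial (Fin 2) ℂ) :=
  ts.foldl (fun M t => transform t M) L

namespace BubblePoint

/-- The multiplicity of a system `L` of plane projective curves (given by forms) at a point `p` of
the bubble space: the multiplicity of its transform at `p`. -/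
def mult (L : Set (MvPolynomial (Fin 3) ℂ)) (p : BubblePoint) : ℕ :=
  systemMult (transformAlong p.tail (localMap p.proper '' L))

/-- The plane curve `F = 0` passes through `p`: its strict transform does. -/
def LiesOn (p : BubblePoint) (F : MvPolynomial (Fin 3) ℂ) : Prop :=
  0 < mult {F} p

/-- `p` is proximate to `q`: `p` is infinitely near `q` and lies on the (strict transform of the)
exceptional curve of the blow-up at `q`.  At the point `⟨q.proper, q.tail ++ [t]⟩` in the first
neighbourhood of `q` the exceptional curve has local equation `x₀ = 0`. -/
def Proximate (p q : BubblePoint) : Prop :=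
  p.proper = q.proper ∧
    ∃ (t : OnePoint ℂ) (us : List (OnePoint ℂ)), p.tail = q.tail ++ t :: us ∧
      0 < systemMult (transformAlong us {X 0})

end BubblePoint

/-! ## Plane Cremona maps -/

/-- A plane Cremona map, that is, a birational map
`[x : y : z] ↦ [f₀(x, y, z) : f₁(x, y, z) : f₂(x, y, z)]` of `ℙ²` to itself, where `f₀, f₁, f₂` are
forms of the same degree (the degree of the map) without common factor. -/
structure PlaneCremonaMap where
  degree : ℕ
  form : Fin 3 → MvPolynomial (Fin 3) ℂ
  isHomogeneous : ∀ i, (form i).IsHomogeneous degree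
  noCommonFactor : ∀ h : MvPolynomial (Fin 3) ℂ, (∀ i, h ∣ form i) → IsUnit h
  birational : ∃ (e : ℕ) (g : Fin 3 → MvPolynomial (Fin 3) ℂ) (h h' : MvPolynomial (Fin 3) ℂ),
    (∀ i, (g i).IsHomogeneous e) ∧ h ≠ 0 ∧ h' ≠ 0 ∧
      (∀ i, aeval g (form i) = h * X i) ∧ (∀ i, aeval form (g i) = h' * X i)

namespace PlaneCremonaMap

/-- The homaloidal net: the linear system spanned by the forms defining the map. -/
def net (φ : PlaneCremonaMap) : Set (MvPolynomial (Fin 3) ℂ) :=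
  (Submodule.span ℂ (Set.range φ.form) : Set (MvPolynomial (Fin 3) ℂ))

/-- The (proper or infinitely near) base points of a plane Cremona map: the points of positive
multiplicity. -/
def BasePoint (φ : PlaneCremonaMap) : Type :=
  {p : BubblePoint // 0 < p.mult φ.net}

end PlaneCremonaMap

/-! ## Enriched weighted graphs -/

/-- A weighted digraph on the vertex set `V`, together with a list of lines, where a line is given
by the set of vertices that it contains. -/
structure EnrichedGraph (V : Type) where
  arrow : V → V → Prop
  weight : V → ℕ
  lines : Set (Set V)

/-- Isomorphism of enriched weighted graphs: a bijection of the vertices preserving arrows,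
weights and lines. -/
def EnrichedGraph.Isomorphic {V W : Type} (G : EnrichedGraph V) (H : EnrichedGraph W) : Prop :=
  ∃ e : V ≃ W, (∀ u v, G.arrow u v ↔ H.arrow (e u) (e v)) ∧
    (∀ v, G.weight v = H.weight (e v)) ∧
    (∀ S : Set V, S ∈ G.lines ↔ e '' S ∈ H.lines)

/-- The enriched weighted proximity graph of a plane Cremona map: the vertices are the base points,
weighted with their multiplicities, the arrows are the proximity relations, and the lines are
those passing through (at least) three base points. -/
def PlaneCremonaMap.enrichedGraph (φ : PlaneCremonaMap) : EnrichedGraph φ.BasePoint where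
  arrow p q := p.1.Proximate q.1
  weight p := p.1.mult φ.net
  lines := {S | ∃ l : MvPolynomial (Fin 3) ℂ, l.IsHomogeneous 1 ∧ l ≠ 0 ∧
    S = {p | p.1.LiesOn l} ∧ 3 ≤ S.encard}

/-! ## The table of the 31 enriched weighted graphs -/

/-- The arrows of the graphs of the table, on the vertices `0, 1, 2, 3, 4`; the entry with index
`n : Fin 31` is the graph with number `n + 1`.  The pair `(i, j)` stands for an arrow `i → j`. -/
def tableArrows : Fin 31 → List (Fin 5 × Fin 5) :=
  ![[(4, 3), (3, 2), (2, 1), (1, 0), (2, 0)],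
    [(4, 3), (3, 2), (2, 1), (1, 0)],
    [(4, 3), (3, 2), (1, 0), (2, 0)],
    [(4, 3), (3, 0), (2, 1), (1, 0)],
    [(3, 2), (2, 1), (1, 0), (2, 0)],
    [(3, 2), (1, 0), (2, 0)],
    [(3, 2), (2, 1), (1, 0)],
    [(4, 3), (3, 2), (2, 1)],
    [(4, 3), (3, 2), (2, 1)],
    [(4, 3), (3, 2), (1, 0)],
    [(4, 3), (3, 2), (1, 0)],
    [(4, 3), (2, 1), (1, 0), (2, 0)],
    [(4, 3), (2, 1), (1, 0)],
    [(4, 3), (1, 0), (2, 0)],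
    [(2, 1), (1, 0), (2, 0)],
    [(2, 1), (1, 0)],
    [(4, 3), (3, 2)],
    [(4, 3), (3, 2)],
    [(4, 3), (3, 2)],
    [(4, 3), (2, 1)],
    [(4, 3), (2, 1)],
    [(4, 3), (1, 0)],
    [(4, 3), (1, 0)],
    [(4, 3)],
    [(4, 3)],
    [(4, 3)],
    [(1, 0), (2, 0)],
    [(1, 0)],
    [(1, 0)],
    [],
    []]

/-- The lines of the graphs of the table, each given by the vertices that it contains. -/
def tableLines : Fin 31 → List (Finset (Fin 5)) :=
  ![[], [], [], [], [], [], [],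
    [{1, 2, 3}],
    [],
    [{2, 3, 4}],
    [], [], [], [], [], [],
    [{1, 2, 3}],
    [{2, 3, 4}],
    [],
    [{1, 2, 3}],
    [],
    [{2, 3, 4}],
    [],
    [{1, 2, 3}],
    [{2, 3, 4}],
    [], [],
    [{2, 3, 4}],
    [],
    [{2, 3, 4}],
    []]

/-- The enriched weighted graphs of the table: in all of them the vertex `0` has weight `2` and the
vertices `1, 2, 3, 4` have weight `1`. -/
def tableGraph (n : Fin 31) : EnrichedGraph (Fin 5) where
  arrow i j := (i, j) ∈ tableArrows n
  weight := ![2, 1, 1, 1, 1]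
  lines := {S | ∃ T ∈ tableLines n, S = (T : Set (Fin 5))}

end

/-!
The enriched weighted proximity graphs of cubic plane Cremona maps are those of explicit nets of
cubics, attached to `2 × 2` matrices of binary forms.

*The nets.*  The cubic of the homaloidal net that corresponds to a general line is rational, being
parametrized by the line through the inverse map.  Its tangent lines then show that it is singular,
and its singular point is a base point that does not depend on the line: a cubic Cremona map has a
double point (`exists_double_point`).  In linear coordinates `x, y, z` at the double point the forms
of the map are `Aᵢ z + Bᵢ` with binary forms `Aᵢ, Bᵢ` in `x, y`, and they have the syzygy `A × B`
with coefficients in `ℂ[x, y]`.  Divided by its content, this syzygy is linear: it is an irreducible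
polynomial in `x, y` and the target coordinates, and the inverse map gives a rational zero of it
(`degree_eq_one_of_rational_zero`).  It follows that the net is spanned by `F, x G, y G` with
`F = a z + b` and `G = c z + d`, where `a, b, c, d` are binary forms of degrees `2, 3, 1, 2`
(`PlaneCremonaMap.exists_net_eq`).  Conversely, such a matrix with nonzero determinant, whose
entries have no common zero, defines a Cremona map (`JonqMatrix.cremona`).

*The base points.*  The base points other than the double point lie over the zeros of the binary
form `a d - b c` of degree four.  Over a zero `s` of order `k` the equations `F = G = 0` have, modulo
order `k`, one common solution `z` as a function of the direction, or `1 / z` if `a` and `c` vanish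
at `s`.  It parametrizes a smooth arc transversal to the fibre, and the base points over `s` are the
first `k` points on that arc (`JonqMatrix.exists_isChain`).  The multiplicities of a system
generated by the equation of the arc and a function of contact `k` with it follow the arc, since a
blow-up lowers the contact with an arc by one.  The points proximate to the double point and the
points on a line `z = m(x, y)` are the first ones of the chain, in numbers that are given by the
orders of `a` and `c`, and of `a m + b` and `c m + d`, at `s`.  No line through the double point
contains three base points, and at most one other line does.

*The table.*  Hence the graph is determined by the triples `(k, e, l)` of the chains: their
lengths, the numbers of points proximate to the double point, and the numbers of points on the line
through three simple base points.  The lengths add up to four.  The numbers `e` add up to at most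
two, because one of `a` and `c`, which have degrees two and one, is not zero; the numbers `l` add
up to three, or are zero; and `e` or `l` is zero for each chain.  A finite check shows that the
triples that are left are those of the table (`PlaneCremonaMap.exists_isomorphic_tableGraph`), for
each of which a matrix is written down
(`exists_cremona_isomorphic_tableGraph`).  Numerical invariants of the vertices distinguish the
graphs of the table (`eq_of_tableGraph_isomorphic`).
-/

/-! ### Blowing up the origin of the plane -/

/-- The chart of the blow-up of the origin used by `blowupMap t`, divided by the equation `x₀` of
the exceptional curve. -/
noncomputable def blowupDir (t : OnePoint ℂ) : Fin 2 → MvPolynomial (Fin 2) ℂ :=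
  match t with
  | OnePoint.infty => ![X 1, 1]
  | OnePoint.some a => ![1, X 1 + C a]

theorem blowupMap_eq (t : OnePoint ℂ) :
    blowupMap t = aeval (fun i => X 0 * blowupDir t i) := by
  apply MvPolynomial.algHom_ext
  intro i
  induction t using OnePoint.rec <;> fin_cases i <;> simp [blowupMap, blowupDir]

/-- Every monomial of `f` has degree at least `m`. -/
def VanishesToOrder (m : ℕ) (f : MvPolynomial (Fin 2) ℂ) : Prop :=
  ∀ d ∈ f.support, m ≤ d.degree

theorem VanishesToOrder.zero_le (f : MvPolynomial (Fin 2) ℂ) : VanishesToOrder 0 f :=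
  fun _ _ => Nat.zero_le _

theorem X_pow_dvd_blowupMap {m : ℕ} {f : MvPolynomial (Fin 2) ℂ} (hf : VanishesToOrder m f)
    (t : OnePoint ℂ) : X 0 ^ m ∣ blowupMap t f := by
  rw [blowupMap_eq, aeval_eq_eval₂Hom, coe_eval₂Hom, eval₂_eq']
  refine Finset.dvd_sum fun d hd => Dvd.dvd.mul_left ?_ _
  simp only [Fin.prod_univ_two, mul_pow]
  have h : m ≤ d 0 + d 1 := by
    have := hf d hd
    rwa [Finsupp.degree_eq_sum, Fin.sum_univ_two] at this
  refine (pow_dvd_pow (X 0) h).trans ⟨blowupDir t 0 ^ d 0 * blowupDir t 1 ^ d 1, by ring⟩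

theorem divMonomial_X_pow_mul (m : ℕ) (h : MvPolynomial (Fin 2) ℂ) :
    (X 0 ^ m * h).divMonomial (Finsupp.single 0 m) = h := by
  rw [X_pow_eq_monomial, divMonomial_monomial_mul]

/-- The coefficients of the linear part. -/
noncomputable def linCoeff (i : Fin 2) (f : MvPolynomial (Fin 2) ℂ) : ℂ :=
  coeff (Finsupp.single i 1) f

/-- The linear part of `f` is not zero. -/
def HasLinearPart (f : MvPolynomial (Fin 2) ℂ) : Prop := ∃ i, linCoeff i f ≠ 0

theorem degree_eq_zero_or_one {d : Fin 2 →₀ ℕ} (h : d.degree < 2) :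
    d = 0 ∨ ∃ i, d = Finsupp.single i 1 := by
  rw [Finsupp.degree_eq_sum, Fin.sum_univ_two] at h
  have : (d 0 = 0 ∧ d 1 = 0) ∨ (d 0 = 1 ∧ d 1 = 0) ∨ (d 0 = 0 ∧ d 1 = 1) := by omega
  rcases this with h | h | h
  · left; ext i; fin_cases i <;> simp [h]
  · right; refine ⟨0, ?_⟩; ext i; fin_cases i <;> simp [h]
  · right; refine ⟨1, ?_⟩; ext i; fin_cases i <;> simp [h]

theorem vanishesToOrder_one_iff {f : MvPolynomial (Fin 2) ℂ} :
    VanishesToOrder 1 f ↔ constantCoeff f = 0 := by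
  constructor
  · intro h
    by_contra h0
    have := h 0 (by simpa [mem_support_iff, constantCoeff_eq] using h0)
    simp at this
  · intro h d hd
    by_contra hlt
    have h0 : d = 0 := by
      exact (Finsupp.degree_eq_zero_iff d).1 (by omega)
    rw [mem_support_iff, h0] at hd
    exact hd (by simpa [constantCoeff_eq] using h)

theorem vanishesToOrder_two {f : MvPolynomial (Fin 2) ℂ} (h0 : constantCoeff f = 0)
    (h1 : ∀ i, linCoeff i f = 0) : VanishesToOrder 2 f := by
  intro d hd
  by_contra hlt
  rw [mem_support_iff] at hd
  rcases degree_eq_zero_or_one (not_le.1 hlt) with rfl | ⟨i, rfl⟩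
  · exact hd (by simpa [constantCoeff_eq] using h0)
  · exact hd (h1 i)

theorem linCoeff_X (i j : Fin 2) : linCoeff i (X j) = if i = j then 1 else 0 := by
  simp only [linCoeff, coeff_X, Finsupp.single_left_inj (one_ne_zero)]
  exact if_congr eq_comm rfl rfl

theorem linCoeff_C_mul (i : Fin 2) (a : ℂ) (f) : linCoeff i (C a * f) = a * linCoeff i f := by
  simp [linCoeff, coeff_C_mul]

/-- The linear part of `f` determines the restriction of the strict transform to the exceptional
curve. -/
theorem exists_blowupMap_eq {f : MvPolynomial (Fin 2) ℂ} (h0 : constantCoeff f = 0)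
    (t : OnePoint ℂ) : ∃ h, blowupMap t f = X 0 * (C (linCoeff 0 f) * blowupDir t 0 +
      C (linCoeff 1 f) * blowupDir t 1 + X 0 * h) := by
  have h2 : VanishesToOrder 2 (f - C (linCoeff 0 f) * X 0 - C (linCoeff 1 f) * X 1) := by
    apply vanishesToOrder_two
    · simp [h0]
    · intro i
      have : linCoeff i (f - C (linCoeff 0 f) * X 0 - C (linCoeff 1 f) * X 1) =
        linCoeff i f - linCoeff i (C (linCoeff 0 f) * X 0) - linCoeff i (C (linCoeff 1 f) * X 1) := by
        simp [linCoeff]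
      rw [this, linCoeff_C_mul, linCoeff_C_mul, linCoeff_X, linCoeff_X]
      fin_cases i <;> simp
  obtain ⟨h, hh⟩ := X_pow_dvd_blowupMap h2 t
  refine ⟨h, ?_⟩
  have e : blowupMap t f = blowupMap t (f - C (linCoeff 0 f) * X 0 - C (linCoeff 1 f) * X 1) +
    blowupMap t (C (linCoeff 0 f) * X 0) + blowupMap t (C (linCoeff 1 f) * X 1) := by
    rw [← map_add, ← map_add]; congr 1; ring
  rw [e, hh, blowupMap_eq]
  simp only [map_mul, aeval_X, aeval_C, algebraMap_eq]
  ring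

/-! ### Multiplicities of systems -/

theorem systemMult_le {L : Set (MvPolynomial (Fin 2) ℂ)} {f} (hf : f ∈ L) {d : Fin 2 →₀ ℕ}
    (hd : coeff d f ≠ 0) : systemMult L ≤ d.degree :=
  Nat.sInf_le (show d.degree ∈ {n | ∃ f ∈ L, ∃ s ∈ f.support, s.degree = n} from
    ⟨f, hf, d, mem_support_iff.2 hd, rfl⟩)

theorem systemMult_eq {L : Set (MvPolynomial (Fin 2) ℂ)} {m : ℕ}
    (hL : ∀ f ∈ L, VanishesToOrder m f) {f} (hf : f ∈ L) {d : Fin 2 →₀ ℕ}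
    (hd : coeff d f ≠ 0) (hm : d.degree = m) : systemMult L = m := by
  apply le_antisymm (hm ▸ systemMult_le hf hd)
  have hmem : m ∈ {n | ∃ f ∈ L, ∃ s ∈ f.support, s.degree = n} :=
    ⟨f, hf, d, mem_support_iff.2 hd, hm⟩
  apply le_csInf ⟨m, hmem⟩
  rintro n ⟨g, hg, s, hs, rfl⟩
  exact hL g hg s hs

theorem systemMult_eq_zero {L : Set (MvPolynomial (Fin 2) ℂ)} {f} (hf : f ∈ L)
    (h0 : constantCoeff f ≠ 0) : systemMult L = 0 :=
  systemMult_eq (fun g _ => VanishesToOrder.zero_le g) hf (d := 0)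
    (by simpa [constantCoeff_eq] using h0) (by simp)

theorem systemMult_eq_one {L : Set (MvPolynomial (Fin 2) ℂ)}
    (hL : ∀ f ∈ L, constantCoeff f = 0) {f} (hf : f ∈ L) (h1 : HasLinearPart f) :
    systemMult L = 1 := by
  obtain ⟨i, hi⟩ := h1
  exact systemMult_eq (fun g hg => vanishesToOrder_one_iff.2 (hL g hg)) hf hi (by simp)

theorem mem_transform_of_eq {L : Set (MvPolynomial (Fin 2) ℂ)} {m : ℕ} (hm : systemMult L = m)
    {t : OnePoint ℂ} {f h} (hf : f ∈ L) (e : blowupMap t f = X 0 ^ m * h) :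
    h ∈ transform t L :=
  ⟨f, hf, by simp only [hm, e, divMonomial_X_pow_mul]⟩

theorem exists_of_mem_transform {L : Set (MvPolynomial (Fin 2) ℂ)} {m : ℕ} (hm : systemMult L = m)
    (hL : ∀ f ∈ L, VanishesToOrder m f) {t : OnePoint ℂ} {h} (hh : h ∈ transform t L) :
    ∃ f ∈ L, blowupMap t f = X 0 ^ m * h := by
  obtain ⟨f, hf, rfl⟩ := hh
  obtain ⟨g, hg⟩ := X_pow_dvd_blowupMap (hL f hf) t
  refine ⟨f, hf, ?_⟩
  simp only [hm, hg, divMonomial_X_pow_mul]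

theorem constantCoeff_blowupMap (t : OnePoint ℂ) (f : MvPolynomial (Fin 2) ℂ) :
    constantCoeff (blowupMap t f) = constantCoeff f := by
  rw [blowupMap_eq]
  induction f using MvPolynomial.induction_on with
  | C a => simp
  | add p q hp hq => rw [map_add, map_add, hp, hq, map_add]
  | mul_X p i hp => simp

/-- A system with a member not vanishing at the origin has multiplicity zero at all points
infinitely near the origin. -/
theorem systemMult_transformAlong_eq_zero (ts : List (OnePoint ℂ)) :
    ∀ {L : Set (MvPolynomial (Fin 2) ℂ)} {f}, f ∈ L → constantCoeff f ≠ 0 →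
    systemMult (transformAlong ts L) = 0 := by
  induction ts with
  | nil => intro L f hf h0; exact systemMult_eq_zero hf h0
  | cons t ts ih =>
    intro L f hf h0
    have := mem_transform_of_eq (systemMult_eq_zero hf h0) (t := t) hf (h := blowupMap t f)
      (by simp)
    exact ih this (by rwa [constantCoeff_blowupMap])

/-! ### Smooth arcs and their infinitely near points -/

/-- The pull-back of functions on the plane along a formal arc. -/
noncomputable def pull (γ : Fin 2 → PowerSeries ℂ) :
    MvPolynomial (Fin 2) ℂ →ₐ[ℂ] PowerSeries ℂ := aeval γ

@[simp] theorem pull_X (γ : Fin 2 → PowerSeries ℂ) (i) : pull γ (X i) = γ i := by simp [pull]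

@[simp] theorem pull_C (γ : Fin 2 → PowerSeries ℂ) (a : ℂ) :
    pull γ (C a) = PowerSeries.C a := by simp [pull]

/-- A smooth formal arc through the origin of the plane. -/
structure IsSmoothArc (γ : Fin 2 → PowerSeries ℂ) : Prop where
  const : ∀ i, PowerSeries.constantCoeff (γ i) = 0
  lin : PowerSeries.coeff 1 (γ 0) ≠ 0 ∨ PowerSeries.coeff 1 (γ 1) ≠ 0

/-- The quotient of a power series without constant term by the variable. -/
noncomputable def psShift (a : PowerSeries ℂ) : PowerSeries ℂ :=
  PowerSeries.mk fun n => PowerSeries.coeff (n + 1) a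

theorem X_mul_psShift {a : PowerSeries ℂ} (h : PowerSeries.constantCoeff a = 0) :
    PowerSeries.X * psShift a = a := by
  rw [PowerSeries.eq_X_mul_shift_add_const a, h]; simp [psShift]

theorem constantCoeff_psShift (a : PowerSeries ℂ) :
    PowerSeries.constantCoeff (psShift a) = PowerSeries.coeff 1 a := by
  rw [psShift, ← PowerSeries.coeff_zero_eq_constantCoeff_apply, PowerSeries.coeff_mk]

open Classical in
/-- The direction of the tangent line of an arc, as a point of the exceptional curve. -/
noncomputable def tangentDir (γ : Fin 2 → PowerSeries ℂ) : OnePoint ℂ :=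
  if PowerSeries.coeff 1 (γ 0) = 0 then OnePoint.infty
  else OnePoint.some (PowerSeries.coeff 1 (γ 1) / PowerSeries.coeff 1 (γ 0))

open Classical in
/-- The strict transform of an arc, in the chart of the blow-up centred at its tangent
direction. -/
noncomputable def arcTransform (γ : Fin 2 → PowerSeries ℂ) : Fin 2 → PowerSeries ℂ :=
  if PowerSeries.coeff 1 (γ 0) = 0 then ![γ 1, psShift (γ 0) * (psShift (γ 1))⁻¹]
  else ![γ 0, psShift (γ 1) * (psShift (γ 0))⁻¹ -
    PowerSeries.C (PowerSeries.coeff 1 (γ 1) / PowerSeries.coeff 1 (γ 0))]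

theorem pull_arcTransform {γ : Fin 2 → PowerSeries ℂ} (hγ : IsSmoothArc γ)
    (f : MvPolynomial (Fin 2) ℂ) :
    pull (arcTransform γ) (blowupMap (tangentDir γ) f) = pull γ f := by
  have key : (pull (arcTransform γ)).comp (blowupMap (tangentDir γ)) = pull γ := by
    apply MvPolynomial.algHom_ext
    have e0 := X_mul_psShift (hγ.const 0)
    have e1 := X_mul_psShift (hγ.const 1)
    have cc : ∀ a : ℂ, (algebraMap ℂ (PowerSeries ℂ)) a = PowerSeries.C a := fun a => rfl
    by_cases h : PowerSeries.coeff 1 (γ 0) = 0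
    · have h1 : PowerSeries.coeff 1 (γ 1) ≠ 0 := by simpa [h] using hγ.lin
      have hu : (psShift (γ 1)) * (psShift (γ 1))⁻¹ = 1 :=
        PowerSeries.mul_inv_cancel _ (by rwa [constantCoeff_psShift])
      intro i
      fin_cases i
      · simp only [tangentDir, arcTransform, h, if_true, AlgHom.comp_apply, blowupMap]
        simp [pull]
        linear_combination (-(psShift (γ 0) * (psShift (γ 1))⁻¹)) * e1 + e0 +
          PowerSeries.X * psShift (γ 0) * hu
      · simp [tangentDir, arcTransform, h, blowupMap, pull]
    · have hu : (psShift (γ 0)) * (psShift (γ 0))⁻¹ = 1 :=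
        PowerSeries.mul_inv_cancel _ (by rwa [constantCoeff_psShift])
      intro i
      fin_cases i
      · simp [tangentDir, arcTransform, h, blowupMap, pull]
      · simp only [tangentDir, arcTransform, h, if_false, AlgHom.comp_apply, blowupMap]
        simp only [pull, aeval_X, Fin.isValue, Fin.mk_one, Matrix.cons_val_zero,
          Matrix.cons_val_one, map_mul, map_add, aeval_C, cc]
        linear_combination (-(psShift (γ 1) * (psShift (γ 0))⁻¹)) * e0 + e1 +
          PowerSeries.X * psShift (γ 1) * hu
  exact DFunLike.congr_fun key f

theorem arcTransform_isSmoothArc {γ : Fin 2 → PowerSeries ℂ} (hγ : IsSmoothArc γ) :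
    IsSmoothArc (arcTransform γ) ∧ PowerSeries.coeff 1 (arcTransform γ 0) ≠ 0 := by
  have hc : ∀ {a b : PowerSeries ℂ}, PowerSeries.coeff 1 b ≠ 0 →
      PowerSeries.constantCoeff (psShift a * (psShift b)⁻¹) =
        PowerSeries.coeff 1 a / PowerSeries.coeff 1 b := by
    intro a b _
    rw [map_mul, PowerSeries.constantCoeff_inv, constantCoeff_psShift, constantCoeff_psShift,
      div_eq_mul_inv]
  by_cases h : PowerSeries.coeff 1 (γ 0) = 0
  · have h1 : PowerSeries.coeff 1 (γ 1) ≠ 0 := by simpa [h] using hγ.lin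
    refine ⟨⟨?_, ?_⟩, ?_⟩
    · intro i
      fin_cases i
      · simpa [arcTransform, h] using hγ.const 1
      · simp only [arcTransform, h, if_true]
        simpa [h] using hc (a := γ 0) h1
    · left; simpa [arcTransform, h] using h1
    · simpa [arcTransform, h] using h1
  · refine ⟨⟨?_, ?_⟩, ?_⟩
    · intro i
      fin_cases i
      · simpa [arcTransform, h] using hγ.const 0
      · simp only [arcTransform, h, if_false]
        have := hc (a := γ 1) h
        simp only [Fin.mk_one, Fin.isValue, Matrix.cons_val_one, Matrix.cons_val_fin_one, map_sub,
          this, PowerSeries.constantCoeff_C, sub_self]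
    · left; simp [arcTransform, h]
    · simp [arcTransform, h]

theorem X_pow_succ_dvd_mul_iff {a : PowerSeries ℂ} (h0 : PowerSeries.constantCoeff a = 0)
    (h1 : PowerSeries.coeff 1 a ≠ 0) (b : PowerSeries ℂ) (n : ℕ) :
    PowerSeries.X ^ (n + 1) ∣ a * b ↔ PowerSeries.X ^ n ∣ b := by
  have hu : IsUnit (psShift a) := by
    rw [PowerSeries.isUnit_iff_constantCoeff, constantCoeff_psShift]; exact h1.isUnit
  rw [← X_mul_psShift h0, pow_succ', mul_assoc,
    mul_dvd_mul_iff_left (PowerSeries.X_ne_zero), hu.dvd_mul_left]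

theorem constantCoeff_pull {γ : Fin 2 → PowerSeries ℂ} (hγ : ∀ i, PowerSeries.constantCoeff (γ i) = 0)
    (f : MvPolynomial (Fin 2) ℂ) :
    PowerSeries.constantCoeff (pull γ f) = constantCoeff f := by
  induction f using MvPolynomial.induction_on with
  | C a => simp
  | add p q hp hq => simp [hp, hq]
  | mul_X p i hp => simp [hγ]

theorem coeff_one_pull {γ : Fin 2 → PowerSeries ℂ} (hγ : ∀ i, PowerSeries.constantCoeff (γ i) = 0)
    (f : MvPolynomial (Fin 2) ℂ) :
    PowerSeries.coeff 1 (pull γ f) = linCoeff 0 f * PowerSeries.coeff 1 (γ 0) +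
      linCoeff 1 f * PowerSeries.coeff 1 (γ 1) := by
  have hC : ∀ (i : Fin 2) (a : ℂ), linCoeff i (C a) = 0 := by
    intro i a
    rw [linCoeff, coeff_C, if_neg]
    exact fun h => by simpa using (DFunLike.congr_fun h i).symm
  have hX : ∀ (i j : Fin 2) (p : MvPolynomial (Fin 2) ℂ),
      linCoeff i (p * X j) = if i = j then constantCoeff p else 0 := by
    intro i j p
    by_cases h : i = j
    · subst h
      simp [linCoeff, coeff_mul_X', constantCoeff_eq]
    · rw [if_neg h, linCoeff, coeff_mul_X', if_neg]
      simpa using Ne.symm h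
  induction f using MvPolynomial.induction_on with
  | C a =>
    rw [hC, hC, pull_C, PowerSeries.coeff_C]; simp
  | add p q hp hq =>
    simp only [map_add, hp, hq, linCoeff, coeff_add]; ring
  | mul_X p i hp =>
    rw [map_mul, pull_X, PowerSeries.coeff_mul, Finset.Nat.antidiagonal_succ]
    simp only [Finset.Nat.antidiagonal_zero, Finset.map_singleton, Finset.sum_cons,
      Finset.sum_singleton, PowerSeries.coeff_zero_eq_constantCoeff_apply, constantCoeff_pull hγ, hX]
    fin_cases i <;> simp [hγ]

theorem hasLinearPart_of_pull {γ : Fin 2 → PowerSeries ℂ}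
    (hγ : ∀ i, PowerSeries.constantCoeff (γ i) = 0) {f : MvPolynomial (Fin 2) ℂ}
    (h : PowerSeries.coeff 1 (pull γ f) ≠ 0) : HasLinearPart f := by
  by_contra hf
  simp only [HasLinearPart, not_exists, not_not] at hf
  rw [coeff_one_pull hγ, hf, hf] at h
  simp at h

/-- The directions of the successive infinitely near points on an arc. -/
noncomputable def arcDir (γ : Fin 2 → PowerSeries ℂ) (n : ℕ) : OnePoint ℂ :=
  tangentDir (arcTransform^[n] γ)

/-- The tail of the `n`-th infinitely near point on an arc through the origin. -/
noncomputable def arcTail (γ : Fin 2 → PowerSeries ℂ) (n : ℕ) : List (OnePoint ℂ) :=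
  (List.range n).map (arcDir γ)

@[simp] theorem arcTail_zero (γ : Fin 2 → PowerSeries ℂ) : arcTail γ 0 = [] := rfl

theorem arcTail_succ (γ : Fin 2 → PowerSeries ℂ) (n : ℕ) :
    arcTail γ (n + 1) = tangentDir γ :: arcTail (arcTransform γ) n := by
  simp only [arcTail, List.range_succ_eq_map, List.map_cons, List.map_map]
  rfl

@[simp] theorem length_arcTail (γ : Fin 2 → PowerSeries ℂ) (n : ℕ) :
    (arcTail γ n).length = n := by simp [arcTail]

/-- After the first blow-up an arc is transversal to the exceptional curve, so that its directions
are finite. -/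
theorem arcDir_succ_ne_infty {γ : Fin 2 → PowerSeries ℂ} (hγ : IsSmoothArc γ) (n : ℕ) :
    arcDir γ (n + 1) ≠ OnePoint.infty := by
  have h : ∀ n, IsSmoothArc (arcTransform^[n] γ) := by
    intro n
    induction n with
    | zero => exact hγ
    | succ n ih =>
      rw [Function.iterate_succ_apply']; exact (arcTransform_isSmoothArc ih).1
  have h1 := (arcTransform_isSmoothArc (h n)).2
  rw [arcDir, Function.iterate_succ_apply', tangentDir, if_neg h1]
  exact OnePoint.coe_ne_infty _

/-- A blow-up lowers the contact of a curve with an arc by one. -/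
theorem X_pow_dvd_pull_strictTransform {γ : Fin 2 → PowerSeries ℂ} (hγ : IsSmoothArc γ)
    {f h : MvPolynomial (Fin 2) ℂ} (e : blowupMap (tangentDir γ) f = X 0 * h) (n : ℕ) :
    (PowerSeries.X ^ (n + 1) ∣ pull γ f ↔ PowerSeries.X ^ n ∣ pull (arcTransform γ) h) := by
  have hs := arcTransform_isSmoothArc hγ
  rw [← pull_arcTransform hγ, e, map_mul, pull_X,
    X_pow_succ_dvd_mul_iff (hs.1.const 0) hs.2]

theorem X_dvd_pull_iff {γ : Fin 2 → PowerSeries ℂ} (hγ : IsSmoothArc γ)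
    (f : MvPolynomial (Fin 2) ℂ) : PowerSeries.X ∣ pull γ f ↔ constantCoeff f = 0 := by
  rw [PowerSeries.X_dvd_iff, constantCoeff_pull hγ.const]

theorem strictTransform_smooth {f : MvPolynomial (Fin 2) ℂ}
    (h0 : constantCoeff f = 0) (h1 : HasLinearPart f) (t : OnePoint ℂ) :
    ∃ h, blowupMap t f = X 0 * h ∧ (constantCoeff h = 0 → HasLinearPart h) := by
  obtain ⟨g, hg⟩ := exists_blowupMap_eq h0 t
  refine ⟨_, hg, fun hc => ⟨1, ?_⟩⟩
  have hX : linCoeff 1 (X 0 * g) = 0 := by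
    rw [linCoeff, coeff_X_mul', if_neg]; simp
  obtain ⟨i, hi⟩ := h1
  induction t using OnePoint.rec with
  | infty =>
    simp only [blowupDir, Matrix.cons_val_zero, Matrix.cons_val_one] at hc ⊢
    have e1 : linCoeff 1 f = 0 := by simpa using hc
    have e0 : linCoeff 0 f ≠ 0 := by fin_cases i <;> simp_all
    rw [linCoeff, coeff_add, coeff_add, ← linCoeff, ← linCoeff, ← linCoeff, hX, linCoeff_C_mul,
      linCoeff_X, e1]
    simpa [linCoeff] using e0
  | coe a =>
    simp only [blowupDir, Matrix.cons_val_zero, Matrix.cons_val_one] at hc ⊢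
    have e1 : linCoeff 1 f ≠ 0 := by
      intro h
      have : linCoeff 0 f = 0 := by simpa [h] using hc
      fin_cases i <;> simp_all
    rw [linCoeff, coeff_add, coeff_add, ← linCoeff, ← linCoeff, ← linCoeff, hX, linCoeff_C_mul,
      linCoeff_C_mul]
    have h3 : linCoeff 1 (1 : MvPolynomial (Fin 2) ℂ) = 0 := by
      rw [linCoeff, coeff_one, if_neg]
      exact fun h => by simpa using (DFunLike.congr_fun h 1).symm
    have h4 : linCoeff 1 (X 1 + C a : MvPolynomial (Fin 2) ℂ) = 1 := by
      rw [linCoeff, coeff_add, ← linCoeff, linCoeff_X, if_pos rfl, coeff_C, if_neg]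
      · simp
      · exact fun h => by simpa using (DFunLike.congr_fun h 1).symm
    rw [h3, h4]; simpa using e1

/-- A reduced curve germ passes through the `n`-th point of a smooth arc if and only if its contact
with the arc exceeds `n`. -/
theorem systemMult_transformAlong_singleton (n : ℕ) :
    ∀ {γ : Fin 2 → PowerSeries ℂ} (_ : IsSmoothArc γ) {f : MvPolynomial (Fin 2) ℂ}
      (_ : constantCoeff f = 0 → HasLinearPart f),
      0 < systemMult (transformAlong (arcTail γ n) {f}) ↔
        PowerSeries.X ^ (n + 1) ∣ pull γ f := by
  induction n with
  | zero =>
    intro γ hγ f hf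
    rw [zero_add, pow_one, X_dvd_pull_iff hγ]
    by_cases h0 : constantCoeff f = 0
    · have : systemMult {f} = 1 := systemMult_eq_one (by simp [h0]) rfl (hf h0)
      simp [transformAlong, this, h0]
    · have : systemMult {f} = 0 := systemMult_eq_zero rfl h0
      simp [transformAlong, this, h0]
  | succ n ih =>
    intro γ hγ f hf
    rw [arcTail_succ]
    by_cases h0 : constantCoeff f = 0
    · have hm : systemMult {f} = 1 := systemMult_eq_one (by simp [h0]) rfl (hf h0)
      obtain ⟨h, e, hh⟩ := strictTransform_smooth h0 (hf h0) (tangentDir γ)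
      have ht : transform (tangentDir γ) {f} = {h} := by
        rw [transform, Set.image_singleton, hm, e, ← pow_one (X 0), divMonomial_X_pow_mul]
      rw [transformAlong, List.foldl_cons, ht, X_pow_dvd_pull_strictTransform hγ e]
      exact ih (arcTransform_isSmoothArc hγ).1 hh
    · rw [systemMult_transformAlong_eq_zero _ (Set.mem_singleton f) h0]
      refine iff_of_false (lt_irrefl 0) fun h => h0 ?_
      rw [← X_dvd_pull_iff hγ]
      exact (dvd_pow_self _ (by omega)).trans h

/-- The system `L` is generated, near the origin, by the equation of the arc `γ` and a function
with contact `k` with the arc. -/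
structure IsCurvilinear (γ : Fin 2 → PowerSeries ℂ) (k : ℕ) (L : Set (MvPolynomial (Fin 2) ℂ)) :
    Prop where
  all : ∀ g ∈ L, PowerSeries.X ^ k ∣ pull γ g
  exact : ∃ g ∈ L, ¬ PowerSeries.X ^ (k + 1) ∣ pull γ g
  smooth : ∃ f ∈ L, PowerSeries.X ^ (k + 1) ∣ pull γ f ∧ HasLinearPart f

/-- A curvilinear system has multiplicity one at the first `k` points of its arc, and zero at all
other points infinitely near the origin. -/
theorem IsCurvilinear.systemMult_eq (ts : List (OnePoint ℂ)) :
    ∀ {γ : Fin 2 → PowerSeries ℂ} (_ : IsSmoothArc γ) {k : ℕ} {L : Set (MvPolynomial (Fin 2) ℂ)}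
      (_ : IsCurvilinear γ k L),
      (∃ j < k, ts = arcTail γ j) ∧ systemMult (transformAlong ts L) = 1 ∨
      (¬ ∃ j < k, ts = arcTail γ j) ∧ systemMult (transformAlong ts L) = 0 := by
  induction ts with
  | nil =>
    intro γ hγ k L hL
    obtain ⟨g, hg, hgk⟩ := hL.exact
    obtain ⟨f, hf, -, hfl⟩ := hL.smooth
    rcases k with _ | k
    · right
      rw [zero_add, pow_one, X_dvd_pull_iff hγ] at hgk
      exact ⟨by simp, systemMult_eq_zero hg hgk⟩
    · left
      refine ⟨⟨0, by omega, rfl⟩, systemMult_eq_one (fun f hf => ?_) hf hfl⟩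
      rw [← X_dvd_pull_iff hγ]
      exact (dvd_pow_self _ (by omega)).trans (hL.all f hf)
  | cons t ts ih =>
    intro γ hγ k L hL
    obtain ⟨g, hg, hgk⟩ := hL.exact
    obtain ⟨f, hf, hfk, hfl⟩ := hL.smooth
    rcases k with _ | k
    · right
      rw [zero_add, pow_one, X_dvd_pull_iff hγ] at hgk
      exact ⟨by simp, systemMult_transformAlong_eq_zero _ hg hgk⟩
    · have h0 : ∀ f ∈ L, constantCoeff f = 0 := fun f hf => by
        rw [← X_dvd_pull_iff hγ]
        exact (dvd_pow_self _ (by omega)).trans (hL.all f hf)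
      have hm : systemMult L = 1 := systemMult_eq_one h0 hf hfl
      have hs := arcTransform_isSmoothArc hγ
      by_cases ht : t = tangentDir γ
      · subst ht
        have hL' : IsCurvilinear (arcTransform γ) k (transform (tangentDir γ) L) := by
          refine ⟨fun g' hg' => ?_, ?_, ?_⟩
          · obtain ⟨u, hu, e⟩ := exists_of_mem_transform hm
              (fun f hf => vanishesToOrder_one_iff.2 (h0 f hf)) hg'
            rw [pow_one] at e
            exact (X_pow_dvd_pull_strictTransform hγ e k).1 (hL.all u hu)
          · obtain ⟨h, e⟩ := exists_blowupMap_eq (h0 g hg) (tangentDir γ)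
            refine ⟨_, mem_transform_of_eq hm hg (by rw [e, pow_one]), ?_⟩
            rwa [← X_pow_dvd_pull_strictTransform hγ e]
          · obtain ⟨h, e, hh⟩ := strictTransform_smooth (h0 f hf) hfl (tangentDir γ)
            have hd := (X_pow_dvd_pull_strictTransform hγ e _).1 hfk
            refine ⟨h, mem_transform_of_eq hm hf (by rw [e, pow_one]), hd, hh ?_⟩
            rw [← X_dvd_pull_iff hs.1]
            exact (dvd_pow_self _ (by omega)).trans hd
        have hiff : (∃ j < k + 1, tangentDir γ :: ts = arcTail γ j) ↔
            ∃ j < k, ts = arcTail (arcTransform γ) j := by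
          constructor
          · rintro ⟨j, hj, e⟩
            rcases j with _ | j
            · simp at e
            · rw [arcTail_succ, List.cons.injEq] at e
              exact ⟨j, by omega, e.2⟩
          · rintro ⟨j, hj, e⟩
            exact ⟨j + 1, by omega, by rw [arcTail_succ, e]⟩
        rw [hiff]
        exact ih hs.1 hL'
      · right
        refine ⟨?_, ?_⟩
        · rintro ⟨j, hj, e⟩
          rcases j with _ | j
          · simp at e
          · rw [arcTail_succ, List.cons.injEq] at e
            exact ht e.1
        · -- The smooth member `f` is tangent to the arc, so its transform does not pass through
          -- the other points of the exceptional curve.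
          obtain ⟨h, e⟩ := exists_blowupMap_eq (h0 f hf) t
          refine systemMult_transformAlong_eq_zero ts
            (mem_transform_of_eq hm hf (by rw [e, pow_one])) ?_
          have h1 : PowerSeries.coeff 1 (pull γ f) = 0 :=
            (PowerSeries.X_pow_dvd_iff.1 hfk) 1 (by omega)
          rw [coeff_one_pull hγ.const] at h1
          obtain ⟨i, hi⟩ := hfl
          have hi' : linCoeff 0 f ≠ 0 ∨ linCoeff 1 f ≠ 0 := by
            fin_cases i
            · exact Or.inl hi
            · exact Or.inr hi
          by_cases hc : PowerSeries.coeff 1 (γ 0) = 0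
          · have hlin := hγ.lin
            rw [tangentDir, if_pos hc] at ht
            induction t using OnePoint.rec with
            | infty => exact absurd rfl ht
            | coe a =>
              simp only [hc, ne_eq, not_true_eq_false, false_or] at hlin
              have e1 : linCoeff 1 f = 0 := by simpa [hc, hlin] using h1
              simp only [e1, ne_eq, not_true_eq_false, or_false] at hi'
              simpa [blowupDir, e1] using hi'
          · rw [tangentDir, if_neg hc] at ht
            induction t using OnePoint.rec with
            | infty =>
              simp only [blowupDir]
              intro h2
              have e1 : linCoeff 1 f = 0 := by simpa using h2
              rw [e1] at h1
              simp_all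
            | coe a =>
              intro h2
              have e2 : linCoeff 0 f + linCoeff 1 f * a = 0 := by simpa [blowupDir] using h2
              apply ht
              have e1 : linCoeff 1 f ≠ 0 := by
                intro e1
                rw [e1] at e2
                simp_all
              congr 1
              rw [eq_div_iff hc]
              apply mul_left_cancel₀ e1
              linear_combination PowerSeries.coeff 1 (γ 0) * e2 - h1

/-! ### Binary forms -/

theorem aeval_mul_left_of_isHomogeneous {σ R : Type*} [CommRing R] [Algebra ℂ R]
    {H : MvPolynomial σ ℂ} {d : ℕ} (hH : H.IsHomogeneous d) (c : R) (v : σ → R) :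
    aeval (fun i => c * v i) H = c ^ d * aeval v H := by
  rw [aeval_def, aeval_def, eval₂_eq, eval₂_eq, Finset.mul_sum]
  refine Finset.sum_congr rfl fun m hm => ?_
  have hd : m.degree = d := by
    by_contra h
    exact (mem_support_iff.1 hm) (hH.coeff_eq_zero h)
  simp only [mul_pow, Finset.prod_mul_distrib, Finset.prod_pow_eq_pow_sum]
  rw [show ∑ i ∈ m.support, m i = d from hd]
  ring

/-- Homogeneous coordinates, as polynomial functions of a local parameter, around the direction `s`
(the direction `[1 : s]`, or `[0 : 1]` for `s = ∞`). -/
noncomputable def dirCoord (s : OnePoint ℂ) : Fin 2 → PowerSeries ℂ :=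
  match s with
  | OnePoint.infty => ![PowerSeries.X, 1]
  | OnePoint.some c => ![1, PowerSeries.X + PowerSeries.C c]

/-- The expansion of a binary form around a direction. -/
noncomputable def loc (s : OnePoint ℂ) : MvPolynomial (Fin 2) ℂ →ₐ[ℂ] PowerSeries ℂ :=
  aeval (dirCoord s)

/-- The order of vanishing of a binary form at a direction. -/
noncomputable def ordAt (s : OnePoint ℂ) (H : MvPolynomial (Fin 2) ℂ) : ℕ∞ := (loc s H).order

theorem natCast_le_order_iff {n : ℕ} {f : PowerSeries ℂ} :
    (n : ℕ∞) ≤ f.order ↔ PowerSeries.X ^ n ∣ f := by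
  rw [PowerSeries.X_pow_dvd_iff]
  constructor
  · intro h m hm
    exact PowerSeries.coeff_of_lt_order m (lt_of_lt_of_le (by exact_mod_cast hm) h)
  · intro h
    exact PowerSeries.nat_le_order f n h

theorem natCast_le_ordAt_iff {n : ℕ} {s : OnePoint ℂ} {H : MvPolynomial (Fin 2) ℂ} :
    (n : ℕ∞) ≤ ordAt s H ↔ PowerSeries.X ^ n ∣ loc s H := natCast_le_order_iff

theorem ordAt_mul (s : OnePoint ℂ) (H K : MvPolynomial (Fin 2) ℂ) :
    ordAt s (H * K) = ordAt s H + ordAt s K := by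
  rw [ordAt, map_mul, PowerSeries.order_mul]; rfl

theorem ordAt_zero (s : OnePoint ℂ) : ordAt s 0 = ⊤ := by simp [ordAt]

theorem ordAt_one (s : OnePoint ℂ) : ordAt s 1 = 0 := by simp [ordAt, PowerSeries.order_one]

theorem ordAt_neg (s : OnePoint ℂ) (H : MvPolynomial (Fin 2) ℂ) : ordAt s (-H) = ordAt s H := by
  rw [ordAt, map_neg, PowerSeries.order_neg]; rfl

theorem ordAt_C (s : OnePoint ℂ) {a : ℂ} (ha : a ≠ 0) : ordAt s (C a) = 0 := by
  rw [ordAt, PowerSeries.order_zero_of_unit]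
  exact (ha.isUnit.map (C : ℂ →+* MvPolynomial (Fin 2) ℂ)).map (loc s)

theorem min_ordAt_le_add (s : OnePoint ℂ) (H K : MvPolynomial (Fin 2) ℂ) :
    min (ordAt s H) (ordAt s K) ≤ ordAt s (H + K) := by
  rw [ordAt, ordAt, ordAt, map_add]; exact PowerSeries.min_order_le_order_add _ _

theorem min_ordAt_le_sub (s : OnePoint ℂ) (H K : MvPolynomial (Fin 2) ℂ) :
    min (ordAt s H) (ordAt s K) ≤ ordAt s (H - K) := by
  rw [sub_eq_add_neg, ← ordAt_neg s K]; exact min_ordAt_le_add s H (-K)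

/-- The linear form vanishing at a direction. -/
noncomputable def dirForm (s : OnePoint ℂ) : MvPolynomial (Fin 2) ℂ :=
  match s with
  | OnePoint.infty => X 0
  | OnePoint.some c => X 1 - C c * X 0

theorem isHomogeneous_dirForm (s : OnePoint ℂ) : (dirForm s).IsHomogeneous 1 := by
  induction s using OnePoint.rec with
  | infty => exact isHomogeneous_X _ _
  | coe c => exact (isHomogeneous_X _ _).sub (isHomogeneous_C_mul_X _ _)

theorem dirForm_ne_zero (s : OnePoint ℂ) : dirForm s ≠ 0 := by
  induction s using OnePoint.rec with
  | infty => exact X_ne_zero _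
  | coe c =>
    intro h
    have := congrArg (eval ![0, 1]) h
    simp [dirForm] at this

open Classical in
theorem ordAt_dirForm (s t : OnePoint ℂ) : ordAt s (dirForm t) = if s = t then 1 else 0 := by
  have hunit : ∀ f : PowerSeries ℂ, PowerSeries.constantCoeff f ≠ 0 → f.order = 0 := fun f hf =>
    PowerSeries.order_zero_of_unit (PowerSeries.isUnit_iff_constantCoeff.2 hf.isUnit)
  induction s using OnePoint.rec with
  | infty =>
    induction t using OnePoint.rec with
    | infty => simp [ordAt, loc, dirCoord, dirForm, PowerSeries.order_X]
    | coe c =>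
      rw [if_neg (OnePoint.infty_ne_coe c)]
      apply hunit
      simp [loc, dirCoord, dirForm]
  | coe b =>
    induction t using OnePoint.rec with
    | infty =>
      rw [if_neg (OnePoint.coe_ne_infty b)]
      apply hunit
      simp [loc, dirCoord, dirForm]
    | coe c =>
      by_cases h : b = c
      · subst h
        simp [ordAt, loc, dirCoord, dirForm, PowerSeries.order_X]
      · rw [if_neg (fun h' => h (OnePoint.coe_injective h'))]
        apply hunit
        simp [loc, dirCoord, dirForm, sub_eq_zero, h]

theorem eq_zero_of_dehomogenize_eq_zero {H : MvPolynomial (Fin 2) ℂ} {d : ℕ}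
    (hH : H.IsHomogeneous d) (h : aeval ![1, (Polynomial.X : Polynomial ℂ)] H = 0) : H = 0 := by
  have h0 : X 0 * H = 0 := by
    apply MvPolynomial.funext
    intro v
    rw [map_mul, eval_X, map_zero]
    by_cases hv : v 0 = 0
    · rw [hv, zero_mul]
    · have e : aeval (fun i => v 0 * ![1, v 1 / v 0] i) H = v 0 ^ d * aeval ![1, v 1 / v 0] H :=
        aeval_mul_left_of_isHomogeneous hH _ _
      have e1 : (fun i => v 0 * ![1, v 1 / v 0] i) = v := by
        ext i; fin_cases i
        · simp
        · simp only [Fin.mk_one, Matrix.cons_val_one, Matrix.cons_val_fin_one]; field_simp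
      have e2 : aeval ![1, v 1 / v 0] H =
          Polynomial.eval (v 1 / v 0) (aeval ![1, (Polynomial.X : Polynomial ℂ)] H) := by
        rw [← Polynomial.coe_aeval_eq_eval, ← AlgHom.comp_apply]
        congr 1
        apply MvPolynomial.algHom_ext
        intro i; fin_cases i <;> simp
      rw [e1, e2, h, Polynomial.eval_zero, mul_zero] at e
      rw [show eval v H = 0 by rw [← coe_aeval_eq_eval]; exact e, mul_zero]
  exact (mul_eq_zero.1 h0).resolve_left (X_ne_zero _)

/-- A binary form over `ℂ` is a product of linear forms. -/
theorem exists_eq_prod_dirForm {H : MvPolynomial (Fin 2) ℂ} {d : ℕ} (hH : H.IsHomogeneous d)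
    (h0 : H ≠ 0) : ∃ (M : Multiset (OnePoint ℂ)) (a : ℂ), a ≠ 0 ∧ M.card = d ∧
      H = C a * (M.map dirForm).prod := by
  set P : Polynomial ℂ := aeval ![1, (Polynomial.X : Polynomial ℂ)] H with hP
  have hP0 : P ≠ 0 := fun h => h0 (eq_zero_of_dehomogenize_eq_zero hH h)
  have hdeg : P.natDegree ≤ d := by
    rw [hP, aeval_def, eval₂_eq']
    refine Polynomial.natDegree_sum_le_of_forall_le _ _ fun m hm => ?_
    have hd : m 0 + m 1 = d := by
      by_contra h
      refine (mem_support_iff.1 hm) (hH.coeff_eq_zero ?_)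
      rwa [Finsupp.degree_eq_sum, Fin.sum_univ_two]
    rw [Fin.prod_univ_two]
    simp only [Matrix.cons_val_zero, one_pow, one_mul, Matrix.cons_val_one,
      Polynomial.algebraMap_apply, Algebra.algebraMap_self, RingHom.id_apply]
    exact (Polynomial.natDegree_C_mul_X_pow_le _ _).trans (by omega)
  have hs : P.roots.card = P.natDegree :=
    (IsAlgClosed.splits P).natDegree_eq_card_roots.symm
  refine ⟨Multiset.replicate (d - P.natDegree) OnePoint.infty + P.roots.map OnePoint.some,
    P.leadingCoeff, by simpa using hP0, by simp [hs, hdeg], ?_⟩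
  rw [← sub_eq_zero]
  have hprod : ∀ M : Multiset (OnePoint ℂ), (M.map dirForm).prod.IsHomogeneous M.card := by
    intro M
    induction M using Multiset.induction_on with
    | empty => simpa using isHomogeneous_one (Fin 2) ℂ
    | cons s M ih =>
      rw [Multiset.map_cons, Multiset.prod_cons, Multiset.card_cons, add_comm]
      exact (isHomogeneous_dirForm s).mul ih
  apply eq_zero_of_dehomogenize_eq_zero (d := d)
  · apply hH.sub
    have := (hprod (Multiset.replicate (d - P.natDegree) OnePoint.infty +
      P.roots.map OnePoint.some)).C_mul P.leadingCoeff
    simpa [hs, hdeg] using this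
  · rw [map_sub, ← hP, sub_eq_zero, map_mul]
    have e : ∀ M : Multiset ℂ, aeval ![1, (Polynomial.X : Polynomial ℂ)]
        ((M.map OnePoint.some).map dirForm).prod =
        (M.map fun c => Polynomial.X - Polynomial.C c).prod := by
      intro M
      induction M using Multiset.induction_on with
      | empty => simp
      | cons s M ih =>
        simp only [Multiset.map_cons, Multiset.prod_cons, map_mul, ih]
        simp [dirForm]
    rw [Multiset.map_add, Multiset.prod_add, map_mul, e, Multiset.map_replicate,
      Multiset.prod_replicate]
    have e2 : aeval ![1, (Polynomial.X : Polynomial ℂ)] (dirForm OnePoint.infty) = 1 := by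
      simp [dirForm]
    rw [map_pow, e2, one_pow, one_mul, aeval_C]
    exact (IsAlgClosed.splits P).eq_prod_roots

open Classical in
theorem ordAt_prod_dirForm (s : OnePoint ℂ) (M : Multiset (OnePoint ℂ)) :
    ordAt s (M.map dirForm).prod = M.count s := by
  induction M using Multiset.induction_on with
  | empty => simp [ordAt_one]
  | cons t M ih =>
    rw [Multiset.map_cons, Multiset.prod_cons, ordAt_mul, ih, ordAt_dirForm, Multiset.count_cons,
      add_comm]
    push_cast
    rfl

theorem exists_sum_ordAt_eq {H : MvPolynomial (Fin 2) ℂ} {d : ℕ} (hH : H.IsHomogeneous d)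
    (h0 : H ≠ 0) : ∃ R : Finset (OnePoint ℂ), ∑ s ∈ R, ordAt s H = d ∧
      ∀ s, s ∈ R ↔ 0 < ordAt s H := by
  classical
  obtain ⟨M, a, ha, hM, rfl⟩ := exists_eq_prod_dirForm hH h0
  refine ⟨M.toFinset, ?_, ?_⟩
  · simp only [ordAt_mul, ordAt_C _ ha, zero_add, ordAt_prod_dirForm]
    rw [← hM, ← Multiset.toFinset_sum_count_eq]
    push_cast
    rfl
  · intro s
    rw [ordAt_mul, ordAt_C _ ha, zero_add, ordAt_prod_dirForm, Multiset.mem_toFinset]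
    simp [Multiset.count_pos]

theorem sum_ordAt_le {H : MvPolynomial (Fin 2) ℂ} {d : ℕ} (hH : H.IsHomogeneous d)
    (h0 : H ≠ 0) (S : Finset (OnePoint ℂ)) : ∑ s ∈ S, ordAt s H ≤ d := by
  classical
  obtain ⟨R, hR, hRmem⟩ := exists_sum_ordAt_eq hH h0
  rw [← hR, ← Finset.sum_filter_add_sum_filter_not S (fun s => s ∈ R)]
  have : ∑ s ∈ S with s ∉ R, ordAt s H = 0 := by
    apply Finset.sum_eq_zero
    intro s hs
    rw [Finset.mem_filter, hRmem] at hs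
    simpa using hs.2
  rw [this, add_zero]
  apply Finset.sum_le_sum_of_subset
  intro s hs
  exact (Finset.mem_filter.1 hs).2

theorem ordAt_ne_top {H : MvPolynomial (Fin 2) ℂ} {d : ℕ} (hH : H.IsHomogeneous d)
    (h0 : H ≠ 0) (s : OnePoint ℂ) : ordAt s H ≠ ⊤ := by
  intro h
  have := sum_ordAt_le hH h0 {s}
  rw [Finset.sum_singleton, h] at this
  simp at this

/-! ### Affine charts and arcs in the projective plane -/

theorem localMap_X_zero (q : Projectivization ℂ (Fin 3 → ℂ)) (h2 : q.rep 2 ≠ 0) (i : Fin 3) :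
    localMap q (X i) = ![X 0 + C (q.rep 0 / q.rep 2), X 1 + C (q.rep 1 / q.rep 2), 1] i := by
  rw [localMap, aeval_X, if_pos h2]

theorem localMap_X_one (q : Projectivization ℂ (Fin 3 → ℂ)) (h2 : q.rep 2 = 0)
    (h1 : q.rep 1 ≠ 0) (i : Fin 3) :
    localMap q (X i) = ![X 0 + C (q.rep 0 / q.rep 1), 1, X 1] i := by
  rw [localMap, aeval_X, if_neg (by simpa using h2), if_pos h1]

theorem localMap_X_two (q : Projectivization ℂ (Fin 3 → ℂ)) (h2 : q.rep 2 = 0)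
    (h1 : q.rep 1 = 0) (i : Fin 3) :
    localMap q (X i) = ![1, X 0, X 1] i := by
  rw [localMap, aeval_X, if_neg (by simpa using h2), if_neg (by simpa using h1)]

theorem rep_zero_ne_zero (q : Projectivization ℂ (Fin 3 → ℂ)) (h2 : q.rep 2 = 0)
    (h1 : q.rep 1 = 0) : q.rep 0 ≠ 0 := by
  intro h0
  apply q.rep_nonzero
  ext i; fin_cases i <;> simp [h0, h1, h2]

theorem exists_constantCoeff_localMap (q : Projectivization ℂ (Fin 3 → ℂ)) :
    ∃ c : ℂ, c ≠ 0 ∧ ∀ i, constantCoeff (localMap q (X i)) = c * q.rep i := by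
  by_cases h2 : q.rep 2 = 0
  · by_cases h1 : q.rep 1 = 0
    · have h0 := rep_zero_ne_zero q h2 h1
      refine ⟨(q.rep 0)⁻¹, inv_ne_zero h0, fun i => ?_⟩
      rw [localMap_X_two q h2 h1]
      fin_cases i <;> simp [h0, h1, h2]
    · refine ⟨(q.rep 1)⁻¹, inv_ne_zero h1, fun i => ?_⟩
      rw [localMap_X_one q h2 h1]
      fin_cases i <;> simp [h1, h2]
      rw [div_eq_inv_mul]
  · refine ⟨(q.rep 2)⁻¹, inv_ne_zero h2, fun i => ?_⟩
    rw [localMap_X_zero q h2]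
    fin_cases i <;> simp [h2, div_eq_inv_mul]

theorem localMap_eq_aeval (q : Projectivization ℂ (Fin 3 → ℂ)) (H : MvPolynomial (Fin 3) ℂ) :
    localMap q H = aeval (fun i => localMap q (X i)) H := by
  have : localMap q = aeval (fun i => localMap q (X i)) := by
    apply MvPolynomial.algHom_ext; intro i; rw [aeval_X]
  exact DFunLike.congr_fun this H

theorem constantCoeff_localMap {q : Projectivization ℂ (Fin 3 → ℂ)} {c : ℂ}
    (hc : ∀ i, constantCoeff (localMap q (X i)) = c * q.rep i)
    {H : MvPolynomial (Fin 3) ℂ} {d : ℕ} (hH : H.IsHomogeneous d) :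
    constantCoeff (localMap q H) = c ^ d * aeval q.rep H := by
  rw [← aeval_mul_left_of_isHomogeneous hH, localMap_eq_aeval]
  have : ((aeval (0 : Fin 2 → ℂ)).comp (aeval (fun i => localMap q (X i)))) =
      aeval (fun i => c * q.rep i) := by
    apply MvPolynomial.algHom_ext
    intro i
    rw [AlgHom.comp_apply, aeval_X, aeval_X, ← hc, aeval_zero, Algebra.algebraMap_self,
      RingHom.id_apply]
  rw [← this, AlgHom.comp_apply, aeval_zero, Algebra.algebraMap_self, RingHom.id_apply]

theorem constantCoeff_localMap_eq_zero_iff {q : Projectivization ℂ (Fin 3 → ℂ)}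
    {H : MvPolynomial (Fin 3) ℂ} {d : ℕ} (hH : H.IsHomogeneous d) :
    constantCoeff (localMap q H) = 0 ↔ aeval q.rep H = 0 := by
  obtain ⟨c, hc, h⟩ := exists_constantCoeff_localMap q
  rw [constantCoeff_localMap h hH]
  simp [hc]

/-- An arc in the projective plane, given by homogeneous coordinates and passing through `q`, can be
written in the affine chart around `q`. -/
theorem exists_localArc (q : Projectivization ℂ (Fin 3 → ℂ)) (Γ : Fin 3 → PowerSeries ℂ)
    {c : ℂ} (hc : c ≠ 0) (hΓ : ∀ i, PowerSeries.constantCoeff (Γ i) = c * q.rep i) :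
    ∃ (γ : Fin 2 → PowerSeries ℂ) (u : PowerSeries ℂ),
      (∀ i, PowerSeries.constantCoeff (γ i) = 0) ∧ IsUnit u ∧
      ∀ {H : MvPolynomial (Fin 3) ℂ} {d : ℕ}, H.IsHomogeneous d →
        pull γ (localMap q H) = u ^ d * aeval Γ H := by
  suffices hmain : ∃ (γ : Fin 2 → PowerSeries ℂ) (u : PowerSeries ℂ),
      (∀ i, PowerSeries.constantCoeff (γ i) = 0) ∧ IsUnit u ∧
      ∀ i, pull γ (localMap q (X i)) = u * Γ i by
    obtain ⟨γ, u, h0, hu, h⟩ := hmain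
    refine ⟨γ, u, h0, hu, fun {H d} hH => ?_⟩
    rw [← aeval_mul_left_of_isHomogeneous hH, localMap_eq_aeval]
    have : ((pull γ).comp (aeval (fun i => localMap q (X i)))) =
        aeval (fun i => u * Γ i) := by
      apply MvPolynomial.algHom_ext
      intro i
      rw [AlgHom.comp_apply, aeval_X, aeval_X, h]
    rw [← this, AlgHom.comp_apply]
  have key : ∀ j, q.rep j ≠ 0 → Γ j * (Γ j)⁻¹ = 1 ∧ IsUnit (Γ j)⁻¹ ∧
      ∀ i, PowerSeries.constantCoeff (Γ i * (Γ j)⁻¹ - PowerSeries.C (q.rep i / q.rep j)) = 0 := by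
    intro j hj
    have hu : PowerSeries.constantCoeff (Γ j) ≠ 0 := by rw [hΓ]; exact mul_ne_zero hc hj
    have h1 := PowerSeries.mul_inv_cancel _ hu
    refine ⟨h1, IsUnit.of_mul_eq_one _ (mul_comm (Γ j) _ ▸ h1), fun i => ?_⟩
    rw [map_sub, map_mul, PowerSeries.constantCoeff_inv, hΓ, hΓ, PowerSeries.constantCoeff_C]
    field_simp
    ring
  by_cases h2 : q.rep 2 = 0
  · by_cases h1 : q.rep 1 = 0
    · obtain ⟨e, hu, hz⟩ := key 0 (rep_zero_ne_zero q h2 h1)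
      refine ⟨![Γ 1 * (Γ 0)⁻¹, Γ 2 * (Γ 0)⁻¹], (Γ 0)⁻¹, fun i => ?_, hu, fun i => ?_⟩
      · fin_cases i
        · simpa [h1] using hz 1
        · simpa [h2] using hz 2
      · rw [localMap_X_two q h2 h1]
        fin_cases i
        · simp [mul_comm _ (Γ 0), e]
        · simp only [Fin.mk_one, Matrix.cons_val_one, Matrix.cons_val_zero, pull_X]
          exact mul_comm _ _
        · simp [mul_comm]
    · obtain ⟨e, hu, hz⟩ := key 1 h1
      refine ⟨![Γ 0 * (Γ 1)⁻¹ - PowerSeries.C (q.rep 0 / q.rep 1), Γ 2 * (Γ 1)⁻¹], (Γ 1)⁻¹,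
        fun i => ?_, hu, fun i => ?_⟩
      · fin_cases i
        · exact hz 0
        · simpa [h2] using hz 2
      · rw [localMap_X_one q h2 h1]
        fin_cases i
        · simp [mul_comm]
        · simp [mul_comm _ (Γ 1), e]
        · simp [mul_comm]
  · obtain ⟨e, hu, hz⟩ := key 2 h2
    refine ⟨![Γ 0 * (Γ 2)⁻¹ - PowerSeries.C (q.rep 0 / q.rep 2),
      Γ 1 * (Γ 2)⁻¹ - PowerSeries.C (q.rep 1 / q.rep 2)], (Γ 2)⁻¹,
      fun i => ?_, hu, fun i => ?_⟩
    · fin_cases i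
      · exact hz 0
      · exact hz 1
    · rw [localMap_X_zero q h2]
      fin_cases i
      · simp [mul_comm]
      · simp [mul_comm]
      · simp [mul_comm _ (Γ 2), e]

/-- Linear coordinates `ℓ` of the projective plane in which the affine chart around `p` is the
standard one, `p` being the point `[0 : 0 : 1]`. -/
structure IsFrame (p : Projectivization ℂ (Fin 3 → ℂ)) (ℓ : Fin 3 → MvPolynomial (Fin 3) ℂ) :
    Prop where
  homog : ∀ j, (ℓ j).IsHomogeneous 1
  localMap_eq : ∀ j, localMap p (ℓ j) = ![X 0, X 1, 1] j
  exists_inverse : ∃ E : Fin 3 → Fin 3 → ℂ, (∀ i, ∑ j, C (E i j) * ℓ j = X i) ∧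
    ∀ j, aeval (fun i => ∑ k, C (E i k) * X k) (ℓ j) = (X j : MvPolynomial (Fin 3) ℂ)

theorem exists_isFrame (p : Projectivization ℂ (Fin 3 → ℂ)) : ∃ ℓ, IsFrame p ℓ := by
  by_cases h2 : p.rep 2 = 0
  · by_cases h1 : p.rep 1 = 0
    · refine ⟨![X 1, X 2, X 0], ?_, ?_, ![![0, 0, 1], ![1, 0, 0], ![0, 1, 0]], ?_, ?_⟩
      · intro j; fin_cases j <;> exact isHomogeneous_X _ _
      · intro j; fin_cases j <;> simp [localMap_X_two p h2 h1]
      · intro i; fin_cases i <;> simp [Fin.sum_univ_three]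
      · intro i; fin_cases i <;> simp [Fin.sum_univ_three]
    · refine ⟨![X 0 - C (p.rep 0 / p.rep 1) * X 1, X 2, X 1], ?_, ?_,
        ![![1, 0, p.rep 0 / p.rep 1], ![0, 0, 1], ![0, 1, 0]], ?_, ?_⟩
      · intro j
        fin_cases j
        · exact (isHomogeneous_X _ _).sub (isHomogeneous_C_mul_X _ _)
        · exact isHomogeneous_X _ _
        · exact isHomogeneous_X _ _
      · intro j
        have hC : ∀ a, localMap p (C a) = C a := fun a => (localMap p).commutes a
        fin_cases j <;> simp [localMap_X_one p h2 h1, -map_div₀, hC]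
      · intro i; fin_cases i <;> simp [Fin.sum_univ_three]
      · intro i; fin_cases i <;> simp [Fin.sum_univ_three]
  · refine ⟨![X 0 - C (p.rep 0 / p.rep 2) * X 2, X 1 - C (p.rep 1 / p.rep 2) * X 2, X 2], ?_, ?_,
      ![![1, 0, p.rep 0 / p.rep 2], ![0, 1, p.rep 1 / p.rep 2], ![0, 0, 1]], ?_, ?_⟩
    · intro j
      fin_cases j
      · exact (isHomogeneous_X _ _).sub (isHomogeneous_C_mul_X _ _)
      · exact (isHomogeneous_X _ _).sub (isHomogeneous_C_mul_X _ _)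
      · exact isHomogeneous_X _ _
    · intro j
      have hC : ∀ a, localMap p (C a) = C a := fun a => (localMap p).commutes a
      fin_cases j <;> simp [localMap_X_zero p h2, -map_div₀, hC]
    · intro i; fin_cases i <;> simp [Fin.sum_univ_three]
    · intro i; fin_cases i <;> simp [Fin.sum_univ_three]

namespace IsFrame

variable {p : Projectivization ℂ (Fin 3 → ℂ)} {ℓ : Fin 3 → MvPolynomial (Fin 3) ℂ}

theorem exists_lift (hℓ : IsFrame p ℓ) {R : Type} [CommRing R] [Algebra ℂ R] (x : Fin 3 → R) :
    ∃ y : Fin 3 → R, ∀ j, aeval y (ℓ j) = x j := by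
  obtain ⟨E, -, h⟩ := hℓ.exists_inverse
  refine ⟨fun i => ∑ k, E i k • x k, fun j => ?_⟩
  have : aeval (fun i => ∑ k, E i k • x k) =
      (aeval x).comp (aeval (fun i => ∑ k, C (E i k) * (X k : MvPolynomial (Fin 3) ℂ))) := by
    apply MvPolynomial.algHom_ext
    intro i
    simp [Algebra.smul_def]
  rw [this, AlgHom.comp_apply, h, aeval_X]

theorem eq_of_aeval_eq (hℓ : IsFrame p ℓ) {R : Type} [CommRing R] [Algebra ℂ R] {y z : Fin 3 → R}
    (h : ∀ j, aeval y (ℓ j) = aeval z (ℓ j)) : y = z := by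
  obtain ⟨E, h', -⟩ := hℓ.exists_inverse
  ext i
  rw [← aeval_X (R := ℂ) y i, ← aeval_X (R := ℂ) z i, ← h', map_sum, map_sum]
  exact Finset.sum_congr rfl fun j _ => by rw [map_mul, map_mul, h, aeval_C, aeval_C]

theorem aeval_rep (hℓ : IsFrame p ℓ) :
    aeval p.rep (ℓ 0) = 0 ∧ aeval p.rep (ℓ 1) = 0 ∧ aeval p.rep (ℓ 2) ≠ 0 := by
  refine ⟨?_, ?_, ?_⟩
  · rw [← constantCoeff_localMap_eq_zero_iff (hℓ.homog 0), hℓ.localMap_eq]; simp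
  · rw [← constantCoeff_localMap_eq_zero_iff (hℓ.homog 1), hℓ.localMap_eq]; simp
  · rw [ne_eq, ← constantCoeff_localMap_eq_zero_iff (hℓ.homog 2), hℓ.localMap_eq]; simp

theorem aeval_smul_form (hℓ : IsFrame p ℓ) {R : Type} [CommRing R] [Algebra ℂ R] (c : R)
    (y : Fin 3 → R) (j : Fin 3) : aeval (fun i => c * y i) (ℓ j) = c * aeval y (ℓ j) := by
  rw [aeval_mul_left_of_isHomogeneous (hℓ.homog j), pow_one]

theorem eq_of_proportional (hℓ : IsFrame p ℓ) {q q' : Projectivization ℂ (Fin 3 → ℂ)} {c : ℂ}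
    (h : ∀ j, aeval q.rep (ℓ j) = c * aeval q'.rep (ℓ j)) : q = q' := by
  have h1 : q.rep = fun i => c * q'.rep i :=
    hℓ.eq_of_aeval_eq fun j => by rw [h, hℓ.aeval_smul_form]
  rw [← q.mk_rep, ← q'.mk_rep, Projectivization.mk_eq_mk_iff']
  exact ⟨c, h1.symm⟩

theorem eq_base_iff (hℓ : IsFrame p ℓ) {q : Projectivization ℂ (Fin 3 → ℂ)} :
    q = p ↔ aeval q.rep (ℓ 0) = 0 ∧ aeval q.rep (ℓ 1) = 0 := by
  constructor
  · rintro rfl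
    exact ⟨hℓ.aeval_rep.1, hℓ.aeval_rep.2.1⟩
  · rintro ⟨h0, h1⟩
    obtain ⟨e0, e1, e2⟩ := hℓ.aeval_rep
    apply hℓ.eq_of_proportional (c := aeval q.rep (ℓ 2) / aeval p.rep (ℓ 2))
    intro j
    fin_cases j
    · simp [h0, e0]
    · simp [h1, e1]
    · simp only [Fin.reduceFinMk]; field_simp

theorem exists_point (hℓ : IsFrame p ℓ) {x : Fin 3 → ℂ} (hx : x ≠ 0) :
    ∃ (q : Projectivization ℂ (Fin 3 → ℂ)) (c : ℂ), c ≠ 0 ∧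
      ∀ j, aeval q.rep (ℓ j) = c * x j := by
  obtain ⟨y, hy⟩ := hℓ.exists_lift x
  have hy0 : y ≠ 0 := by
    rintro rfl
    apply hx
    ext j
    have := hℓ.aeval_smul_form (0 : ℂ) (0 : Fin 3 → ℂ) j
    rw [← hy, Pi.zero_apply, zero_mul] at *
    simpa using this
  obtain ⟨a, ha⟩ := Projectivization.exists_smul_eq_mk_rep ℂ y hy0
  refine ⟨Projectivization.mk ℂ y hy0, a, a.ne_zero, fun j => ?_⟩
  rw [← hy, ← hℓ.aeval_smul_form, ← ha]
  rfl

end IsFrame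

/-! ### Nets of cubics with a double point -/

/-- The form `u(x₀, x₁) x₂ + v(x₀, x₁)`, evaluated at `x`. -/
noncomputable def rowForm {R : Type} [CommRing R] [Algebra ℂ R] (u v : MvPolynomial (Fin 2) ℂ)
    (x : Fin 3 → R) : R := aeval ![x 0, x 1] u * x 2 + aeval ![x 0, x 1] v

theorem map_aeval_pair {R S : Type} [CommRing R] [Algebra ℂ R] [CommRing S] [Algebra ℂ S]
    (f : R →ₐ[ℂ] S) (y z : R) (u : MvPolynomial (Fin 2) ℂ) :
    f (aeval ![y, z] u) = aeval ![f y, f z] u := by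
  rw [← AlgHom.comp_apply]
  congr 1
  apply MvPolynomial.algHom_ext
  intro i; fin_cases i <;> simp

theorem map_rowForm {R S : Type} [CommRing R] [Algebra ℂ R] [CommRing S] [Algebra ℂ S]
    (f : R →ₐ[ℂ] S) (u v : MvPolynomial (Fin 2) ℂ) (x : Fin 3 → R) :
    f (rowForm u v x) = rowForm u v (fun j => f (x j)) := by
  simp only [rowForm, map_add, map_mul, map_aeval_pair]

/-- A matrix of binary forms of degrees `2, 3; 1, 2`, whose determinant is not zero and which does
not vanish at any direction.  It stands for the cubic form `F = a z + b` and the quadratic form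
`G = c z + d` in the variables `x, y, z`, and for the net of cubics spanned by `F, x G, y G`. -/
structure JonqMatrix where
  a : MvPolynomial (Fin 2) ℂ
  b : MvPolynomial (Fin 2) ℂ
  c : MvPolynomial (Fin 2) ℂ
  d : MvPolynomial (Fin 2) ℂ
  ha : a.IsHomogeneous 2
  hb : b.IsHomogeneous 3
  hc : c.IsHomogeneous 1
  hd : d.IsHomogeneous 2
  det_ne_zero : a * d - b * c ≠ 0
  ne_zero_at : ∀ s, ¬ (0 < ordAt s a ∧ 0 < ordAt s b ∧ 0 < ordAt s c ∧ 0 < ordAt s d)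

namespace JonqMatrix

variable (M : JonqMatrix)

/-- The determinant, a binary form of degree four.  Its zeros are the directions of the lines
through the double point that contain another base point. -/
noncomputable def det : MvPolynomial (Fin 2) ℂ := M.a * M.d - M.b * M.c

theorem isHomogeneous_det : M.det.IsHomogeneous 4 := (M.ha.mul M.hd).sub (M.hb.mul M.hc)

/-- The order of the determinant at a direction. -/
noncomputable def chainLength (s : OnePoint ℂ) : ℕ := (ordAt s M.det).toNat

theorem coe_chainLength (s : OnePoint ℂ) : (M.chainLength s : ℕ∞) = ordAt s M.det :=
  ENat.natCast_toNat (ordAt_ne_top M.isHomogeneous_det M.det_ne_zero s)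

/-- The contact of the net, at a direction, with the exceptional curve of the double point. -/
noncomputable def excContact (s : OnePoint ℂ) : ℕ∞ := min (ordAt s M.a) (ordAt s M.c)

/-- The contact of the net, at a direction, with the line `z = m(x, y)`. -/
noncomputable def lineContact (m : MvPolynomial (Fin 2) ℂ) (s : OnePoint ℂ) : ℕ∞ :=
  min (ordAt s (M.a * m + M.b)) (ordAt s (M.c * m + M.d))

/-- The member of the net with coefficients `α, β, δ`, evaluated at `x`. -/
noncomputable def member {R : Type} [CommRing R] [Algebra ℂ R] (α β δ : ℂ) (x : Fin 3 → R) : R :=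
  α • rowForm M.a M.b x + (β • x 0 + δ • x 1) * rowForm M.c M.d x

theorem map_member {R S : Type} [CommRing R] [Algebra ℂ R] [CommRing S] [Algebra ℂ S]
    (f : R →ₐ[ℂ] S) (α β δ : ℂ) (x : Fin 3 → R) :
    f (M.member α β δ x) = M.member α β δ (fun j => f (x j)) := by
  simp only [member, map_add, map_mul, map_smul, map_rowForm]

/-- The net of cubics, in the linear coordinates `ℓ`. -/
def netIn (ℓ : Fin 3 → MvPolynomial (Fin 3) ℂ) : Set (MvPolynomial (Fin 3) ℂ) :=
  {g | ∃ α β δ : ℂ, g = M.member α β δ ℓ}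

theorem isHomogeneous_rowForm {u v : MvPolynomial (Fin 2) ℂ} {n : ℕ} (hu : u.IsHomogeneous n)
    (hv : v.IsHomogeneous (n + 1)) {ℓ : Fin 3 → MvPolynomial (Fin 3) ℂ}
    (hℓ : ∀ j, (ℓ j).IsHomogeneous 1) : (rowForm u v ℓ).IsHomogeneous (n + 1) := by
  have h : ∀ i, (![ℓ 0, ℓ 1] i).IsHomogeneous 1 := by
    intro i; fin_cases i
    · exact hℓ 0
    · exact hℓ 1
  have h1 := hu.aeval (n := 1) ![ℓ 0, ℓ 1] h
  have h2 := hv.aeval (n := 1) ![ℓ 0, ℓ 1] h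
  rw [one_mul] at h1 h2
  exact (h1.mul (hℓ 2)).add h2

theorem isHomogeneous_member {ℓ : Fin 3 → MvPolynomial (Fin 3) ℂ}
    (hℓ : ∀ j, (ℓ j).IsHomogeneous 1) (α β δ : ℂ) : (M.member α β δ ℓ).IsHomogeneous 3 := by
  have h1 := isHomogeneous_rowForm M.ha M.hb hℓ
  have h2 := isHomogeneous_rowForm M.hc M.hd hℓ
  simp only [member, smul_eq_C_mul]
  exact (h1.C_mul α).add ((((hℓ 0).C_mul β).add ((hℓ 1).C_mul δ)).mul h2)

end JonqMatrix

/-- Given a matrix of power series whose first column does not vanish at the origin, and with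
determinant of order `k`, the two equations `a ζ + b = 0` and `c ζ + d = 0` have a common
solution modulo order `k`, which solves one of them exactly. -/
theorem exists_common_solution {a b c d : PowerSeries ℂ} {k : ℕ} (hk : (a * d - b * c).order = k)
    (h : PowerSeries.constantCoeff a ≠ 0 ∨ PowerSeries.constantCoeff c ≠ 0) :
    ∃ ζ, ((PowerSeries.constantCoeff c ≠ 0 ∧ c * ζ + d = 0 ∧ (a * ζ + b).order = k) ∨
        (PowerSeries.constantCoeff a ≠ 0 ∧ a * ζ + b = 0 ∧ (c * ζ + d).order = k)) ∧
      ∀ m, ∀ n ≤ k, PowerSeries.X ^ n ∣ ζ - m ↔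
        PowerSeries.X ^ n ∣ a * m + b ∧ PowerSeries.X ^ n ∣ c * m + d := by
  have hdvd : ∀ n ≤ k, (PowerSeries.X ^ n : PowerSeries ℂ) ∣ a * d - b * c := fun n hn =>
    natCast_le_order_iff.1 (hk ▸ (by exact_mod_cast hn))
  have hunit : ∀ {f : PowerSeries ℂ}, PowerSeries.constantCoeff f ≠ 0 →
      IsUnit f := fun hf => PowerSeries.isUnit_iff_constantCoeff.2 hf.isUnit
  by_cases hc : PowerSeries.constantCoeff c = 0
  · have ha : PowerSeries.constantCoeff a ≠ 0 := by simpa [hc] using h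
    have e := PowerSeries.mul_inv_cancel a ha
    have hu := hunit ha
    refine ⟨-b * a⁻¹, Or.inr ⟨ha, by linear_combination (-b) * e, ?_⟩, fun m n hn => ?_⟩
    · have : a * (c * (-b * a⁻¹) + d) = a * d - b * c := by linear_combination (-b * c) * e
      rw [← hk, ← this, PowerSeries.order_mul, PowerSeries.order_zero_of_unit hu, zero_add]
    · have e1 : a * m + b = -a * (-b * a⁻¹ - m) := by linear_combination (-b) * e
      have e2 : a * (c * m + d) = (a * d - b * c) + c * (a * m + b) := by ring
      have hd1 : PowerSeries.X ^ n ∣ a * m + b ↔ PowerSeries.X ^ n ∣ -b * a⁻¹ - m := by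
        rw [e1, hu.neg.dvd_mul_left]
      rw [← hd1]
      refine ⟨fun h1 => ⟨h1, ?_⟩, fun h1 => h1.1⟩
      rw [← hu.dvd_mul_left, e2]
      exact dvd_add (hdvd n hn) (h1.mul_left c)
  · have e := PowerSeries.mul_inv_cancel c hc
    have hu := hunit hc
    refine ⟨-d * c⁻¹, Or.inl ⟨hc, by linear_combination (-d) * e, ?_⟩, fun m n hn => ?_⟩
    · have : (-c) * (a * (-d * c⁻¹) + b) = a * d - b * c := by linear_combination (a * d) * e
      rw [← hk, ← this, PowerSeries.order_mul, PowerSeries.order_zero_of_unit hu.neg, zero_add]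
    · have e1 : c * m + d = -c * (-d * c⁻¹ - m) := by linear_combination (-d) * e
      have e2 : c * (a * m + b) = a * (c * m + d) - (a * d - b * c) := by ring
      have hd1 : PowerSeries.X ^ n ∣ c * m + d ↔ PowerSeries.X ^ n ∣ -d * c⁻¹ - m := by
        rw [e1, hu.neg.dvd_mul_left]
      rw [← hd1]
      refine ⟨fun h1 => ⟨?_, h1⟩, fun h1 => h1.2⟩
      rw [← hu.dvd_mul_left, e2]
      exact dvd_sub (h1.mul_left a) (hdvd n hn)

/-- The value of a binary form at (the standard coordinates of) a direction. -/
noncomputable def valAt (s : OnePoint ℂ) (H : MvPolynomial (Fin 2) ℂ) : ℂ :=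
  PowerSeries.constantCoeff (loc s H)

/-- The standard coordinates of a direction. -/
noncomputable def dirVec (s : OnePoint ℂ) (i : Fin 2) : ℂ :=
  PowerSeries.constantCoeff (dirCoord s i)

theorem ordAt_pos_iff {s : OnePoint ℂ} {H : MvPolynomial (Fin 2) ℂ} :
    0 < ordAt s H ↔ valAt s H = 0 := by
  rw [pos_iff_ne_zero, ordAt, PowerSeries.order_ne_zero_iff_constCoeff_eq_zero]; rfl

theorem valAt_eq (s : OnePoint ℂ) (H : MvPolynomial (Fin 2) ℂ) :
    valAt s H = aeval ![dirVec s 0, dirVec s 1] H := by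
  rw [valAt]
  induction H using MvPolynomial.induction_on with
  | C a =>
    rw [aeval_C, ← algebraMap_eq, (loc s).commutes]
    exact PowerSeries.constantCoeff_C a
  | add p q hp hq => rw [map_add, map_add, map_add, hp, hq]
  | mul_X p i hp =>
    rw [map_mul, map_mul, map_mul, hp, aeval_X]
    congr 1
    rw [loc, aeval_X]
    fin_cases i <;> rfl

theorem loc_eq (s : OnePoint ℂ) (H : MvPolynomial (Fin 2) ℂ) :
    loc s H = aeval ![dirCoord s 0, dirCoord s 1] H := by
  rw [loc]
  congr 2
  ext i; fin_cases i <;> rfl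

/-- One of the standard coordinates of a direction is constant. -/
theorem exists_dirCoord_eq_one (s : OnePoint ℂ) :
    ∃ β δ : ℂ, β • dirCoord s 0 + δ • dirCoord s 1 = 1 ∧ β * dirVec s 0 + δ * dirVec s 1 = 1 := by
  induction s using OnePoint.rec with
  | infty => exact ⟨0, 1, by simp [dirCoord], by simp [dirVec, dirCoord]⟩
  | coe c => exact ⟨1, 0, by simp [dirCoord], by simp [dirVec, dirCoord]⟩

theorem dirVec_ne_zero (s : OnePoint ℂ) : ¬ (dirVec s 0 = 0 ∧ dirVec s 1 = 0) := by
  rintro ⟨h0, h1⟩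
  obtain ⟨β, δ, -, h⟩ := exists_dirCoord_eq_one s
  simp [h0, h1] at h

theorem exists_dir {x y : ℂ} (h : ¬ (x = 0 ∧ y = 0)) :
    ∃ (s : OnePoint ℂ) (μ : ℂ), μ ≠ 0 ∧ x = μ * dirVec s 0 ∧ y = μ * dirVec s 1 := by
  by_cases hx : x = 0
  · exact ⟨OnePoint.infty, y, fun hy => h ⟨hx, hy⟩, by simp [dirVec, dirCoord, hx],
      by simp [dirVec, dirCoord]⟩
  · refine ⟨OnePoint.some (y / x), x, hx, by simp [dirVec, dirCoord], ?_⟩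
    simp only [dirVec, dirCoord, Matrix.cons_val_one, Matrix.cons_val_fin_one, map_add,
      PowerSeries.constantCoeff_X, PowerSeries.constantCoeff_C, zero_add]
    field_simp

theorem dir_eq_of_proportional {s t : OnePoint ℂ} {μ ν : ℂ} (hμ : μ ≠ 0) (hν : ν ≠ 0)
    (h : ∀ i, μ * dirVec s i = ν * dirVec t i) : s = t := by
  have h0 := h 0
  have h1 := h 1
  induction s using OnePoint.rec with
  | infty =>
    induction t using OnePoint.rec with
    | infty => rfl
    | coe c => simp [dirVec, dirCoord, hν.symm] at h0
  | coe b =>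
    induction t using OnePoint.rec with
    | infty => simp [dirVec, dirCoord, hμ] at h0
    | coe c =>
      simp only [dirVec, dirCoord, Matrix.cons_val_zero, Matrix.cons_val_one,
        Matrix.cons_val_fin_one, map_add, PowerSeries.constantCoeff_X, PowerSeries.constantCoeff_C,
        map_one, mul_one, zero_add] at h0 h1
      subst h0
      rw [mul_left_cancel₀ hμ h1]

/-- The expansion of a linear form at a direction where it vanishes has order one. -/
theorem dirForm_expansion {s : OnePoint ℂ} {β δ : ℂ} (hβδ : ¬ (β = 0 ∧ δ = 0)) :
    ¬ PowerSeries.X ^ 2 ∣ β • dirCoord s 0 + δ • dirCoord s 1 := by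
  rw [PowerSeries.X_pow_dvd_iff]
  intro h
  have h0 := h 0 (by norm_num)
  have h1 := h 1 (by norm_num)
  apply hβδ
  induction s using OnePoint.rec with
  | infty =>
    simp [dirCoord, PowerSeries.coeff_one] at h0 h1
    exact ⟨h1, h0⟩
  | coe c =>
    simp [dirCoord, PowerSeries.coeff_one] at h0 h1
    simp only [h1, zero_mul, add_zero] at h0
    exact ⟨h0, h1⟩

/-! ### The base points over a direction -/

theorem IsFrame.exists_arc {p : Projectivization ℂ (Fin 3 → ℂ)}
    {ℓ : Fin 3 → MvPolynomial (Fin 3) ℂ} (hℓ : IsFrame p ℓ)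
    (q : Projectivization ℂ (Fin 3 → ℂ)) (x : Fin 3 → PowerSeries ℂ) {c : ℂ} (hc : c ≠ 0)
    (hq : ∀ j, aeval q.rep (ℓ j) = c * PowerSeries.constantCoeff (x j)) :
    ∃ (γ : Fin 2 → PowerSeries ℂ) (u : PowerSeries ℂ) (Γ : Fin 3 → PowerSeries ℂ),
      (∀ i, PowerSeries.constantCoeff (γ i) = 0) ∧ IsUnit u ∧ (∀ j, aeval Γ (ℓ j) = x j) ∧
      ∀ {H : MvPolynomial (Fin 3) ℂ} {d : ℕ}, H.IsHomogeneous d →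
        pull γ (localMap q H) = u ^ d * aeval Γ H := by
  obtain ⟨Γ, hΓ⟩ := hℓ.exists_lift x
  have h0 : (fun i => PowerSeries.constantCoeff (Γ i)) = fun i => c⁻¹ * q.rep i := by
    apply hℓ.eq_of_aeval_eq
    intro j
    rw [hℓ.aeval_smul_form, hq, inv_mul_cancel_left₀ hc, ← hΓ]
    have : ∀ H : MvPolynomial (Fin 3) ℂ, aeval (fun i => PowerSeries.constantCoeff (Γ i)) H =
        PowerSeries.constantCoeff (aeval Γ H) := by
      intro H
      induction H using MvPolynomial.induction_on with
      | C a => rw [aeval_C, aeval_C]; exact (PowerSeries.constantCoeff_C a).symm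
      | add p q hp hq => rw [map_add, map_add, map_add, hp, hq]
      | mul_X p i hp => rw [map_mul, map_mul, map_mul, hp, aeval_X, aeval_X]
    exact this _
  obtain ⟨γ, u, h1, hu, h2⟩ := exists_localArc q Γ (inv_ne_zero hc) (fun i => congrFun h0 i)
  exact ⟨γ, u, Γ, h1, hu, hΓ, h2⟩

theorem rowForm_mul {R : Type} [CommRing R] [Algebra ℂ R] {u v : MvPolynomial (Fin 2) ℂ} {n : ℕ}
    (hu : u.IsHomogeneous n) (hv : v.IsHomogeneous (n + 1)) (c y z t : R) :
    rowForm u v ![c * y, c * z, t] = c ^ n * (aeval ![y, z] u * t + c * aeval ![y, z] v) := by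
  have e : (![c * y, c * z] : Fin 2 → R) = fun i => c * ![y, z] i := by
    ext i; fin_cases i <;> rfl
  simp only [rowForm, Matrix.cons_val_zero, Matrix.cons_val_one, Matrix.cons_val, e]
  rw [aeval_mul_left_of_isHomogeneous hu, aeval_mul_left_of_isHomogeneous hv]
  ring

/-- The proper point `q` lies on the line through the base point of the frame with direction
`s`. -/
def HasDirection (ℓ : Fin 3 → MvPolynomial (Fin 3) ℂ) (q : Projectivization ℂ (Fin 3 → ℂ))
    (s : OnePoint ℂ) : Prop :=
  ∃ μ : ℂ, μ ≠ 0 ∧ aeval q.rep (ℓ 0) = μ * dirVec s 0 ∧ aeval q.rep (ℓ 1) = μ * dirVec s 1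

theorem not_X_pow_dvd_of_order_eq {f : PowerSeries ℂ} {k : ℕ} (h : f.order = k) :
    ¬ PowerSeries.X ^ (k + 1) ∣ f := by
  rw [← natCast_le_order_iff, h]
  exact_mod_cast Nat.not_succ_le_self k

theorem X_pow_dvd_of_order_eq {f : PowerSeries ℂ} {k : ℕ} (h : f.order = k) :
    PowerSeries.X ^ k ∣ f := by
  rw [← natCast_le_order_iff, h]

namespace JonqMatrix

variable (M : JonqMatrix) {p : Projectivization ℂ (Fin 3 → ℂ)}
  {ℓ : Fin 3 → MvPolynomial (Fin 3) ℂ}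

theorem order_loc_det (s : OnePoint ℂ) :
    (loc s M.a * loc s M.d - loc s M.b * loc s M.c).order = M.chainLength s := by
  rw [coe_chainLength, ordAt, det, map_sub, map_mul, map_mul]

/-- If the net does not meet the exceptional curve of the double point in the direction `s`, then
its base points over `s` start at a proper point of the line with direction `s` and lie on a smooth
arc transversal to that line. -/
theorem exists_proper_chain (hℓ : IsFrame p ℓ) (s : OnePoint ℂ)
    (hac : valAt s M.a ≠ 0 ∨ valAt s M.c ≠ 0) :
    ∃ (q : Projectivization ℂ (Fin 3 → ℂ)) (γ : Fin 2 → PowerSeries ℂ),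
      HasDirection ℓ q s ∧ IsSmoothArc γ ∧
      IsCurvilinear γ (M.chainLength s) (localMap q '' M.netIn ℓ) ∧
      (∀ m : MvPolynomial (Fin 2) ℂ, m.IsHomogeneous 1 → ∀ n ≤ M.chainLength s,
        PowerSeries.X ^ n ∣ pull γ (localMap q (ℓ 2 - aeval ![ℓ 0, ℓ 1] m)) ↔
          (n : ℕ∞) ≤ M.lineContact m s) ∧
      (∀ β δ : ℂ, ¬ (β = 0 ∧ δ = 0) →
        ¬ PowerSeries.X ^ 2 ∣ pull γ (localMap q (β • ℓ 0 + δ • ℓ 1))) ∧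
      ∀ q', HasDirection ℓ q' s →
        rowForm M.a M.b (fun j => aeval q'.rep (ℓ j)) = 0 →
        rowForm M.c M.d (fun j => aeval q'.rep (ℓ j)) = 0 → q' = q := by
  obtain ⟨ζ, hζ, hcontact⟩ := exists_common_solution (M.order_loc_det s) hac
  obtain ⟨β₀, δ₀, hβδ, hβδ'⟩ := exists_dirCoord_eq_one s
  obtain ⟨q, κ, hκ, hq⟩ := hℓ.exists_point
    (x := ![dirVec s 0, dirVec s 1, PowerSeries.constantCoeff ζ]) (fun h =>
      dirVec_ne_zero s ⟨by simpa using congrFun h 0, by simpa using congrFun h 1⟩)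
  obtain ⟨γ, u, Γ, hγ, hu, hΓ, hpull⟩ := hℓ.exists_arc q ![dirCoord s 0, dirCoord s 1, ζ] hκ
    (fun j => by rw [hq]; fin_cases j <;> rfl)
  have hF : rowForm M.a M.b (fun j => aeval Γ (ℓ j)) = loc s M.a * ζ + loc s M.b := by
    simp only [rowForm, hΓ, loc_eq]; rfl
  have hG : rowForm M.c M.d (fun j => aeval Γ (ℓ j)) = loc s M.c * ζ + loc s M.d := by
    simp only [rowForm, hΓ, loc_eq]; rfl
  have hmem : ∀ α β δ : ℂ, pull γ (localMap q (M.member α β δ ℓ)) =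
      u ^ 3 * (α • (loc s M.a * ζ + loc s M.b) +
        (β • dirCoord s 0 + δ • dirCoord s 1) * (loc s M.c * ζ + loc s M.d)) := by
    intro α β δ
    rw [hpull (M.isHomogeneous_member hℓ.homog α β δ), map_member, member, hF, hG, hΓ, hΓ]
    rfl
  have hu3 : IsUnit (u ^ 3) := hu.pow 3
  -- The line with direction `s`, parametrized by the last coordinate.
  obtain ⟨γ', u', Γ', hγ', hu', hΓ', hpull'⟩ := hℓ.exists_arc q
    ![PowerSeries.C (dirVec s 0), PowerSeries.C (dirVec s 1),
      PowerSeries.C (PowerSeries.constantCoeff ζ) + PowerSeries.X] hκ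
    (fun j => by rw [hq]; fin_cases j <;> simp)
  have hconst : ∀ H : MvPolynomial (Fin 2) ℂ,
      aeval ![PowerSeries.C (dirVec s 0), PowerSeries.C (dirVec s 1)] H =
        PowerSeries.C (valAt s H) := by
    intro H
    rw [valAt_eq]
    exact (map_aeval_pair (Algebra.ofId ℂ (PowerSeries ℂ)) (dirVec s 0) (dirVec s 1) H).symm
  have hmem' : ∀ α β δ : ℂ, pull γ' (localMap q (M.member α β δ ℓ)) =
      u' ^ 3 * (α • (PowerSeries.C (valAt s M.a) *
          (PowerSeries.C (PowerSeries.constantCoeff ζ) + PowerSeries.X) +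
          PowerSeries.C (valAt s M.b)) +
        (β • PowerSeries.C (dirVec s 0) + δ • PowerSeries.C (dirVec s 1)) *
        (PowerSeries.C (valAt s M.c) *
          (PowerSeries.C (PowerSeries.constantCoeff ζ) + PowerSeries.X) +
          PowerSeries.C (valAt s M.d))) := by
    intro α β δ
    rw [hpull' (M.isHomogeneous_member hℓ.homog α β δ), map_member]
    simp only [member, rowForm, hΓ', Matrix.cons_val_zero, Matrix.cons_val_one, Matrix.cons_val,
      hconst]
  have hlin : ∀ (α β δ w : ℂ), w ≠ 0 →
      pull γ' (localMap q (M.member α β δ ℓ)) = u' ^ 3 * (PowerSeries.C w * PowerSeries.X) →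
      HasLinearPart (localMap q (M.member α β δ ℓ)) := by
    intro α β δ w hw e
    apply hasLinearPart_of_pull hγ'
    rw [e, ← mul_assoc, PowerSeries.coeff_succ_mul_X, PowerSeries.coeff_zero_eq_constantCoeff_apply,
      map_mul, PowerSeries.constantCoeff_C]
    exact mul_ne_zero ((PowerSeries.isUnit_iff_constantCoeff.1 (hu'.pow 3)).ne_zero) hw
  have hval : ∀ {f g : MvPolynomial (Fin 2) ℂ}, loc s f * ζ + loc s g = 0 →
      valAt s f * PowerSeries.constantCoeff ζ + valAt s g = 0 := by
    intro f g e
    have := congrArg PowerSeries.constantCoeff e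
    simpa [valAt] using this
  have hvalC : ∀ {f g : MvPolynomial (Fin 2) ℂ}, loc s f * ζ + loc s g = 0 →
      PowerSeries.C (valAt s f) * (PowerSeries.C (PowerSeries.constantCoeff ζ) + PowerSeries.X) +
          PowerSeries.C (valAt s g) = PowerSeries.C (valAt s f) * PowerSeries.X := by
    intro f g e
    have h1 := congrArg (PowerSeries.C (R := ℂ)) (hval e)
    rw [map_add, map_mul, map_zero] at h1
    linear_combination h1
  have hβδC : β₀ • PowerSeries.C (dirVec s 0) + δ₀ • PowerSeries.C (dirVec s 1) =
      (1 : PowerSeries ℂ) := by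
    rw [PowerSeries.smul_eq_C_mul, PowerSeries.smul_eq_C_mul, ← map_mul, ← map_mul, ← map_add,
      hβδ', map_one]
  have hm1 : M.member 1 0 0 ℓ ∈ M.netIn ℓ := ⟨_, _, _, rfl⟩
  have hm2 : M.member 0 β₀ δ₀ ℓ ∈ M.netIn ℓ := ⟨_, _, _, rfl⟩
  have hlines : ∀ β δ : ℂ, ¬ (β = 0 ∧ δ = 0) →
        ¬ PowerSeries.X ^ 2 ∣ pull γ (localMap q (β • ℓ 0 + δ • ℓ 1)) := by
    intro β δ h
    have hh : (β • ℓ 0 + δ • ℓ 1).IsHomogeneous 1 := by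
      rw [smul_eq_C_mul, smul_eq_C_mul]
      exact ((hℓ.homog 0).C_mul β).add ((hℓ.homog 1).C_mul δ)
    rw [hpull hh, pow_one, hu.dvd_mul_left, map_add, map_smul, map_smul, hΓ, hΓ]
    exact dirForm_expansion h
  refine ⟨q, γ, ⟨κ, hκ, hq 0, hq 1⟩, ⟨hγ, ?_⟩, ⟨?_, ?_, ?_⟩, ?_, hlines, ?_⟩
  · -- An arc with vanishing linear terms would have contact two with every line.
    by_contra h
    simp only [not_or, not_not] at h
    by_cases hd : dirVec s 0 = 0
    · refine hlines 1 0 (by simp) (PowerSeries.X_pow_dvd_iff.2 fun n hn => ?_)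
      interval_cases n
      · rw [PowerSeries.coeff_zero_eq_constantCoeff_apply, constantCoeff_pull hγ,
          constantCoeff_localMap_eq_zero_iff (d := 1)]
        · simp [hq, hd]
        · simpa using hℓ.homog 0
      · rw [coeff_one_pull hγ, h.1, h.2]; simp
    · refine hlines (-dirVec s 1) (dirVec s 0) (by simp [hd])
        (PowerSeries.X_pow_dvd_iff.2 fun n hn => ?_)
      interval_cases n
      · rw [PowerSeries.coeff_zero_eq_constantCoeff_apply, constantCoeff_pull hγ,
          constantCoeff_localMap_eq_zero_iff (d := 1)]
        · rw [map_add, map_smul, map_smul, hq, hq]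
          simp only [smul_eq_mul, Matrix.cons_val_zero, Matrix.cons_val_one]
          ring
        · rw [smul_eq_C_mul, smul_eq_C_mul]
          exact ((hℓ.homog 0).C_mul _).add ((hℓ.homog 1).C_mul _)
      · rw [coeff_one_pull hγ, h.1, h.2]; simp
  · rintro _ ⟨_, ⟨α, β, δ, rfl⟩, rfl⟩
    rw [hmem, hu3.dvd_mul_left]
    rcases hζ with ⟨-, e1, e2⟩ | ⟨-, e1, e2⟩
    · rw [e1, mul_zero, add_zero]
      exact (X_pow_dvd_of_order_eq e2).trans (dvd_smul_of_dvd α dvd_rfl)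
    · rw [e1, smul_zero, zero_add]
      exact (X_pow_dvd_of_order_eq e2).mul_left _
  · rcases hζ with ⟨-, e1, e2⟩ | ⟨-, e1, e2⟩
    · refine ⟨_, ⟨_, hm1, rfl⟩, ?_⟩
      rw [hmem, hu3.dvd_mul_left, e1, mul_zero, add_zero, one_smul]
      exact not_X_pow_dvd_of_order_eq e2
    · refine ⟨_, ⟨_, hm2, rfl⟩, ?_⟩
      rw [hmem, hu3.dvd_mul_left, e1, smul_zero, zero_add, hβδ, one_mul]
      exact not_X_pow_dvd_of_order_eq e2
  · rcases hζ with ⟨h0, e1, e2⟩ | ⟨h0, e1, e2⟩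
    · refine ⟨_, ⟨_, hm2, rfl⟩, ?_, hlin _ _ _ _ h0 ?_⟩
      · rw [hmem, e1]; simp
      · rw [hmem', hβδC, one_mul, zero_smul, zero_add, hvalC e1]; rfl
    · refine ⟨_, ⟨_, hm1, rfl⟩, ?_, hlin _ _ _ _ h0 ?_⟩
      · rw [hmem, e1]; simp
      · rw [hmem', zero_smul, zero_smul, zero_add, zero_mul, add_zero, one_smul, hvalC e1]; rfl
  · intro m hm n hn
    have hh : (ℓ 2 - aeval ![ℓ 0, ℓ 1] m).IsHomogeneous 1 := by
      refine (hℓ.homog 2).sub ?_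
      have := hm.aeval (n := 1) ![ℓ 0, ℓ 1] (fun i => by
        fin_cases i
        · exact hℓ.homog 0
        · exact hℓ.homog 1)
      simpa using this
    rw [hpull hh, pow_one, hu.dvd_mul_left, map_sub, map_aeval_pair, hΓ, hΓ, hΓ]
    have := hcontact (loc s m) n hn
    rw [loc_eq s m] at this
    refine this.trans ?_
    rw [lineContact, le_min_iff, natCast_le_ordAt_iff, natCast_le_ordAt_iff]
    simp only [map_add, map_mul, loc_eq s m]
  · rintro q' ⟨μ, hμ, h0, h1⟩ hF' hG'
    have ex : (fun j => aeval q'.rep (ℓ j)) =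
        ![μ * dirVec s 0, μ * dirVec s 1, aeval q'.rep (ℓ 2)] := by
      ext j; fin_cases j
      · exact h0
      · exact h1
      · rfl
    have hz : aeval q'.rep (ℓ 2) = μ * PowerSeries.constantCoeff ζ := by
      rcases hζ with ⟨h0, e1, e2⟩ | ⟨h0, e1, e2⟩
      · rw [ex, rowForm_mul M.hc M.hd, ← valAt_eq, ← valAt_eq] at hG'
        have h2 := (mul_eq_zero.1 hG').resolve_left (pow_ne_zero _ hμ)
        apply mul_left_cancel₀ (show valAt s M.c ≠ 0 from h0)
        linear_combination h2 - μ * hval e1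
      · rw [ex, rowForm_mul M.ha M.hb, ← valAt_eq, ← valAt_eq] at hF'
        have h2 := (mul_eq_zero.1 hF').resolve_left (pow_ne_zero _ hμ)
        apply mul_left_cancel₀ (show valAt s M.a ≠ 0 from h0)
        linear_combination h2 - μ * hval e1
    apply hℓ.eq_of_proportional (c := μ / κ)
    intro j
    rw [hq]
    fin_cases j
    · simp only [Fin.zero_eta, Fin.isValue, h0, Matrix.cons_val_zero]; field_simp
    · simp only [Fin.mk_one, Fin.isValue, h1, Matrix.cons_val_one]; field_simp; rfl
    · simp only [Fin.reduceFinMk, hz, Matrix.cons_val]; field_simp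

end JonqMatrix

theorem vanishesToOrder_of_isHomogeneous {f : MvPolynomial (Fin 2) ℂ} {n m : ℕ}
    (hf : f.IsHomogeneous n) (hm : m ≤ n) : VanishesToOrder m f := by
  intro d hd
  by_contra h
  exact mem_support_iff.1 hd (hf.coeff_eq_zero (by omega))

theorem VanishesToOrder.add {f g : MvPolynomial (Fin 2) ℂ} {m : ℕ} (hf : VanishesToOrder m f)
    (hg : VanishesToOrder m g) : VanishesToOrder m (f + g) := by
  intro d hd
  classical
  rcases Finset.mem_union.1 (support_add hd) with h | h
  · exact hf d h
  · exact hg d h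

theorem blowupMap_of_isHomogeneous {f : MvPolynomial (Fin 2) ℂ} {n : ℕ} (hf : f.IsHomogeneous n)
    (s : OnePoint ℂ) : blowupMap s f = X 0 ^ n * aeval (blowupDir s) f := by
  rw [blowupMap_eq, aeval_mul_left_of_isHomogeneous hf]

theorem constantCoeff_aeval_blowupDir (s : OnePoint ℂ) (f : MvPolynomial (Fin 2) ℂ) :
    constantCoeff (aeval (blowupDir s) f) = valAt s f := by
  rw [valAt_eq]
  have hi : ∀ i, constantCoeff (blowupDir s i) = ![dirVec s 0, dirVec s 1] i := by
    intro i
    induction s using OnePoint.rec <;> fin_cases i <;> simp [blowupDir, dirVec, dirCoord]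
  induction f using MvPolynomial.induction_on with
  | C a => simp
  | add p q hp hq => rw [map_add, map_add, map_add, hp, hq]
  | mul_X p i hp => rw [map_mul, map_mul, map_mul, hp, aeval_X, aeval_X, hi]

theorem pull_aeval_blowupDir (s : OnePoint ℂ) {γ : Fin 2 → PowerSeries ℂ}
    (hγ : γ 1 = PowerSeries.X) (f : MvPolynomial (Fin 2) ℂ) :
    pull γ (aeval (blowupDir s) f) = loc s f := by
  rw [← AlgHom.comp_apply]
  congr 1
  apply MvPolynomial.algHom_ext
  intro i
  induction s using OnePoint.rec <;> fin_cases i <;>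
    simp [blowupDir, loc, dirCoord, hγ]

theorem pull_zero_aeval_blowupDir (s : OnePoint ℂ) (a : PowerSeries ℂ)
    (f : MvPolynomial (Fin 2) ℂ) :
    pull ![a, 0] (aeval (blowupDir s) f) = PowerSeries.C (valAt s f) := by
  have e : (pull ![a, 0]).comp (aeval (blowupDir s)) =
      (Algebra.ofId ℂ (PowerSeries ℂ)).comp (aeval ![dirVec s 0, dirVec s 1]) := by
    apply MvPolynomial.algHom_ext
    intro i
    induction s using OnePoint.rec <;> fin_cases i <;>
      simp [blowupDir, dirVec, dirCoord, Algebra.ofId_apply]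
  rw [← AlgHom.comp_apply, e, AlgHom.comp_apply, valAt_eq]; rfl

namespace JonqMatrix

variable (M : JonqMatrix) {p : Projectivization ℂ (Fin 3 → ℂ)}
  {ℓ : Fin 3 → MvPolynomial (Fin 3) ℂ}

/-- The leading part, at the double point, of a member of the net. -/
noncomputable def leading (α β δ : ℂ) : MvPolynomial (Fin 2) ℂ :=
  α • M.a + (β • X 0 + δ • X 1) * M.c

/-- The cubic part, at the double point, of a member of the net. -/
noncomputable def trailing (α β δ : ℂ) : MvPolynomial (Fin 2) ℂ :=
  α • M.b + (β • X 0 + δ • X 1) * M.d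

theorem isHomogeneous_leading (α β δ : ℂ) : (M.leading α β δ).IsHomogeneous 2 := by
  simp only [leading, smul_eq_C_mul]
  exact (M.ha.C_mul α).add ((((isHomogeneous_X _ _).C_mul β).add
    ((isHomogeneous_X _ _).C_mul δ)).mul M.hc)

theorem isHomogeneous_trailing (α β δ : ℂ) : (M.trailing α β δ).IsHomogeneous 3 := by
  simp only [trailing, smul_eq_C_mul]
  exact (M.hb.C_mul α).add ((((isHomogeneous_X _ _).C_mul β).add
    ((isHomogeneous_X _ _).C_mul δ)).mul M.hd)

theorem localMap_member (hℓ : IsFrame p ℓ) (α β δ : ℂ) :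
    localMap p (M.member α β δ ℓ) = M.leading α β δ + M.trailing α β δ := by
  have hid : ∀ f : MvPolynomial (Fin 2) ℂ,
      aeval ![X 0, (X 1 : MvPolynomial (Fin 2) ℂ)] f = f := by
    intro f
    have : (aeval ![X 0, (X 1 : MvPolynomial (Fin 2) ℂ)] : _ →ₐ[ℂ] _) = AlgHom.id ℂ _ := by
      apply MvPolynomial.algHom_ext; intro i; fin_cases i <;> simp
    rw [this]; rfl
  rw [map_member]
  simp only [member, rowForm, hℓ.localMap_eq, Matrix.cons_val_zero, Matrix.cons_val_one,
    Matrix.cons_val, hid, leading, trailing, mul_one, smul_add]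
  ring

theorem vanishesToOrder_localMap_member (hℓ : IsFrame p ℓ) :
    ∀ f ∈ localMap p '' M.netIn ℓ, VanishesToOrder 2 f := by
  rintro _ ⟨_, ⟨α, β, δ, rfl⟩, rfl⟩
  rw [M.localMap_member hℓ]
  exact (vanishesToOrder_of_isHomogeneous (M.isHomogeneous_leading α β δ) le_rfl).add
    (vanishesToOrder_of_isHomogeneous (M.isHomogeneous_trailing α β δ) (by norm_num))

theorem systemMult_localMap_netIn (hℓ : IsFrame p ℓ) : systemMult (localMap p '' M.netIn ℓ) = 2 := by
  obtain ⟨α, β, δ, h⟩ : ∃ α β δ, M.leading α β δ ≠ 0 := by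
    by_contra h
    push Not at h
    have ha : M.a = 0 := by simpa [leading] using h 1 0 0
    have hc : M.c = 0 := by simpa [leading] using h 0 1 0
    exact M.det_ne_zero (by rw [ha, hc]; ring)
  obtain ⟨m, hm⟩ := ne_zero_iff.1 h
  have hd : m.degree = 2 := by
    by_contra hd
    exact hm ((M.isHomogeneous_leading α β δ).coeff_eq_zero hd)
  refine systemMult_eq (M.vanishesToOrder_localMap_member hℓ)
    ⟨_, ⟨α, β, δ, rfl⟩, M.localMap_member hℓ α β δ⟩ (d := m) ?_ hd
  rwa [coeff_add, (M.isHomogeneous_trailing α β δ).coeff_eq_zero (by omega), add_zero]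

/-- The transform of a member of the net at the direction `s` of the double point. -/
noncomputable def excMember (s : OnePoint ℂ) (α β δ : ℂ) : MvPolynomial (Fin 2) ℂ :=
  aeval (blowupDir s) (M.leading α β δ) + X 0 * aeval (blowupDir s) (M.trailing α β δ)

theorem blowupMap_localMap_member (hℓ : IsFrame p ℓ) (s : OnePoint ℂ) (α β δ : ℂ) :
    blowupMap s (localMap p (M.member α β δ ℓ)) = X 0 ^ 2 * M.excMember s α β δ := by
  rw [M.localMap_member hℓ, map_add, blowupMap_of_isHomogeneous (M.isHomogeneous_leading α β δ),
    blowupMap_of_isHomogeneous (M.isHomogeneous_trailing α β δ), excMember]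
  ring

theorem mem_transform_netIn_iff (hℓ : IsFrame p ℓ) (s : OnePoint ℂ)
    {f : MvPolynomial (Fin 2) ℂ} :
    f ∈ transform s (localMap p '' M.netIn ℓ) ↔ ∃ α β δ, f = M.excMember s α β δ := by
  constructor
  · intro h
    obtain ⟨_, ⟨_, ⟨α, β, δ, rfl⟩, rfl⟩, e⟩ := exists_of_mem_transform
      (M.systemMult_localMap_netIn hℓ) (M.vanishesToOrder_localMap_member hℓ) h
    refine ⟨α, β, δ, ?_⟩
    rw [M.blowupMap_localMap_member hℓ] at e
    exact (mul_left_cancel₀ (pow_ne_zero _ (X_ne_zero _)) e).symm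
  · rintro ⟨α, β, δ, rfl⟩
    exact mem_transform_of_eq (M.systemMult_localMap_netIn hℓ) ⟨_, ⟨α, β, δ, rfl⟩, rfl⟩
      (M.blowupMap_localMap_member hℓ s α β δ)

theorem constantCoeff_excMember (s : OnePoint ℂ) (α β δ : ℂ) :
    constantCoeff (M.excMember s α β δ) =
      α * valAt s M.a + (β * dirVec s 0 + δ * dirVec s 1) * valAt s M.c := by
  have hX : ∀ i, valAt s (X i) = dirVec s i := fun i => by rw [valAt, loc, aeval_X]; rfl
  rw [excMember, map_add, map_mul, constantCoeff_X, zero_mul, add_zero,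
    constantCoeff_aeval_blowupDir]
  have hsmul : ∀ (c : ℂ) (f : MvPolynomial (Fin 2) ℂ), valAt s (c • f) = c * valAt s f := by
    intro c f
    rw [valAt, map_smul, PowerSeries.smul_eq_C_mul, map_mul, PowerSeries.constantCoeff_C, valAt]
  have hadd : ∀ (f g : MvPolynomial (Fin 2) ℂ), valAt s (f + g) = valAt s f + valAt s g := by
    intro f g; simp only [valAt, map_add]
  have hmul : ∀ (f g : MvPolynomial (Fin 2) ℂ), valAt s (f * g) = valAt s f * valAt s g := by
    intro f g; simp only [valAt, map_mul]
  rw [leading, hadd, hmul, hadd, hsmul, hsmul, hsmul, hX, hX]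

theorem exists_transform_constantCoeff_ne_zero (hℓ : IsFrame p ℓ) (s : OnePoint ℂ)
    (hac : valAt s M.a ≠ 0 ∨ valAt s M.c ≠ 0) :
    ∃ f ∈ transform s (localMap p '' M.netIn ℓ), constantCoeff f ≠ 0 := by
  rcases hac with h | h
  · exact ⟨_, (M.mem_transform_netIn_iff hℓ s).2 ⟨1, 0, 0, rfl⟩,
      by rw [constantCoeff_excMember]; simpa using h⟩
  · obtain ⟨β₀, δ₀, -, hβδ⟩ := exists_dirCoord_eq_one s
    exact ⟨_, (M.mem_transform_netIn_iff hℓ s).2 ⟨0, β₀, δ₀, rfl⟩,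
      by rw [constantCoeff_excMember, hβδ]; simpa using h⟩

/-- If the net meets the exceptional curve of the double point in the direction `s`, then its base
points over `s` start at that point of the exceptional curve and lie on a smooth arc transversal to
the line with direction `s`. -/
theorem exists_exceptional_chain (hℓ : IsFrame p ℓ) (s : OnePoint ℂ)
    (ha : valAt s M.a = 0) (hc : valAt s M.c = 0) :
    ∃ γ : Fin 2 → PowerSeries ℂ, IsSmoothArc γ ∧ γ 1 = PowerSeries.X ∧
      IsCurvilinear γ (M.chainLength s) (transform s (localMap p '' M.netIn ℓ)) ∧
      ∀ n ≤ M.chainLength s, PowerSeries.X ^ n ∣ γ 0 ↔ (n : ℕ∞) ≤ M.excContact s := by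
  have hbd : valAt s M.b ≠ 0 ∨ valAt s M.d ≠ 0 := by
    by_contra h
    push Not at h
    apply M.ne_zero_at s
    simp only [ordAt_pos_iff]
    exact ⟨ha, h.1, hc, h.2⟩
  have hdet : (loc s M.b * loc s M.c - loc s M.a * loc s M.d).order = M.chainLength s := by
    rw [← order_loc_det, ← PowerSeries.order_neg, neg_sub]
  obtain ⟨w, hw, hcontact⟩ := exists_common_solution hdet hbd
  obtain ⟨β₀, δ₀, hβδ, hβδ'⟩ := exists_dirCoord_eq_one s
  have hw0 : PowerSeries.constantCoeff w = 0 := by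
    rcases hw with ⟨h, e, -⟩ | ⟨h, e, -⟩
    · have := congrArg PowerSeries.constantCoeff e
      rw [map_add, map_mul, show PowerSeries.constantCoeff (loc s M.c) = 0 from hc] at this
      simpa [h] using this
    · have := congrArg PowerSeries.constantCoeff e
      rw [map_add, map_mul, show PowerSeries.constantCoeff (loc s M.a) = 0 from ha] at this
      simpa [h] using this
  have hlocX : ∀ i, loc s (X i) = dirCoord s i := fun i => by rw [loc, aeval_X]
  have hvalX : ∀ i, valAt s (X i) = dirVec s i := fun i => by rw [valAt, hlocX]; rfl
  have hpull : ∀ α β δ, pull ![w, PowerSeries.X] (M.excMember s α β δ) =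
      α • (loc s M.b * w + loc s M.a) +
        (β • dirCoord s 0 + δ • dirCoord s 1) * (loc s M.d * w + loc s M.c) := by
    intro α β δ
    rw [excMember, map_add, map_mul, pull_X, pull_aeval_blowupDir s rfl,
      pull_aeval_blowupDir s rfl, leading, trailing]
    simp only [map_add, map_mul, map_smul, hlocX, Matrix.cons_val_zero, PowerSeries.smul_eq_C_mul]
    ring
  have hlin : ∀ α β δ w', w' ≠ 0 → valAt s (M.leading α β δ) = 0 →
      valAt s (M.trailing α β δ) = w' → HasLinearPart (M.excMember s α β δ) := by
    intro α β δ w' hw' h1 h2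
    apply hasLinearPart_of_pull (γ := ![PowerSeries.X, 0])
    · intro i; fin_cases i <;> simp
    · rw [excMember, map_add, map_mul, pull_X, pull_zero_aeval_blowupDir,
        pull_zero_aeval_blowupDir, h1, h2]
      simpa [PowerSeries.coeff_C_mul, mul_comm _ (PowerSeries.C w')] using hw'
  have hval : ∀ α β δ (f g : MvPolynomial (Fin 2) ℂ),
      valAt s (α • f + (β • X 0 + δ • X 1) * g) =
        α * valAt s f + (β * dirVec s 0 + δ * dirVec s 1) * valAt s g := by
    intro α β δ f g
    simp only [valAt, map_add, map_mul, map_smul, hlocX, PowerSeries.smul_eq_C_mul,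
      PowerSeries.constantCoeff_C, dirVec]
  have hm1 := (M.mem_transform_netIn_iff hℓ s).2 ⟨1, 0, 0, rfl⟩
  have hm2 := (M.mem_transform_netIn_iff hℓ s).2 ⟨0, β₀, δ₀, rfl⟩
  refine ⟨![w, PowerSeries.X], ⟨?_, Or.inr ?_⟩, rfl, ⟨?_, ?_, ?_⟩, ?_⟩
  · intro i; fin_cases i
    · exact hw0
    · simp
  · simp
  · intro g hg
    obtain ⟨α, β, δ, rfl⟩ := (M.mem_transform_netIn_iff hℓ s).1 hg
    rw [hpull]
    rcases hw with ⟨-, e1, e2⟩ | ⟨-, e1, e2⟩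
    · rw [e1, mul_zero, add_zero]
      exact (X_pow_dvd_of_order_eq e2).trans (dvd_smul_of_dvd α dvd_rfl)
    · rw [e1, smul_zero, zero_add]
      exact (X_pow_dvd_of_order_eq e2).mul_left _
  · rcases hw with ⟨-, e1, e2⟩ | ⟨-, e1, e2⟩
    · refine ⟨_, hm1, ?_⟩
      rw [hpull, e1, mul_zero, add_zero, one_smul]
      exact not_X_pow_dvd_of_order_eq e2
    · refine ⟨_, hm2, ?_⟩
      rw [hpull, e1, smul_zero, zero_add, hβδ, one_mul]
      exact not_X_pow_dvd_of_order_eq e2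
  · rcases hw with ⟨h0, e1, e2⟩ | ⟨h0, e1, e2⟩
    · refine ⟨_, hm2, ?_, hlin _ _ _ _ h0 ?_ ?_⟩
      · rw [hpull, e1]; simp
      · rw [leading, hval, hc]; simp
      · rw [trailing, hval, hβδ']; simp [valAt]
    · refine ⟨_, hm1, ?_, hlin _ _ _ _ h0 ?_ ?_⟩
      · rw [hpull, e1]; simp
      · rw [leading, hval, ha]; simp
      · rw [trailing, hval]; simp [valAt]
  · intro n hn
    have := hcontact 0 n hn
    rw [sub_zero, mul_zero, mul_zero, zero_add, zero_add] at this
    rw [Matrix.cons_val_zero, this, excContact, le_min_iff, natCast_le_ordAt_iff,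
      natCast_le_ordAt_iff]

end JonqMatrix

theorem aeval_line {H : MvPolynomial (Fin 3) ℂ} (hH : H.IsHomogeneous 1) (x v : Fin 3 → ℂ) :
    aeval (fun i => PowerSeries.C (x i) + PowerSeries.C (v i) * PowerSeries.X) H =
      PowerSeries.C (aeval x H) + PowerSeries.C (aeval v H) * PowerSeries.X := by
  rw [← mem_homogeneousSubmodule, homogeneousSubmodule_one_eq_span_X] at hH
  induction hH using Submodule.span_induction with
  | mem x hx => obtain ⟨i, rfl⟩ := hx; simp
  | zero => simp
  | add x y _ _ hx hy => simp only [map_add, hx, hy]; ring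
  | smul a x _ hx =>
    simp only [map_smul, hx, PowerSeries.smul_eq_C_mul, smul_eq_mul, map_mul]; ring

theorem hasLinearPart_localMap (q : Projectivization ℂ (Fin 3 → ℂ)) {H : MvPolynomial (Fin 3) ℂ}
    (hH : H.IsHomogeneous 1) (h0 : H ≠ 0) (hq : constantCoeff (localMap q H) = 0) :
    HasLinearPart (localMap q H) := by
  obtain ⟨v, hv⟩ : ∃ v : Fin 3 → ℂ, aeval v H ≠ 0 := by
    by_contra h
    push Not at h
    exact h0 (MvPolynomial.funext fun v => by
      rw [map_zero, ← coe_aeval_eq_eval]; exact h v)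
  obtain ⟨γ, u, hγ, hu, hpull⟩ := exists_localArc q
    (fun i => PowerSeries.C (q.rep i) + PowerSeries.C (v i) * PowerSeries.X) one_ne_zero
    (fun i => by simp)
  have hq0 : aeval q.rep H = 0 := (constantCoeff_localMap_eq_zero_iff hH).1 hq
  apply hasLinearPart_of_pull hγ
  rw [hpull hH, aeval_line hH, hq0, map_zero, zero_add, pow_one, ← mul_assoc, PowerSeries.coeff_succ_mul_X,
    PowerSeries.coeff_zero_eq_constantCoeff_apply, map_mul, PowerSeries.constantCoeff_C]
  exact mul_ne_zero (PowerSeries.isUnit_iff_constantCoeff.1 hu).ne_zero hv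

/-- A line passes through the `j`-th point of an arc starting at the proper point `q` if and only if
its contact with the arc exceeds `j`. -/
theorem liesOn_arcTail_iff {q : Projectivization ℂ (Fin 3 → ℂ)} {H : MvPolynomial (Fin 3) ℂ}
    (hH : H.IsHomogeneous 1) (h0 : H ≠ 0) {γ : Fin 2 → PowerSeries ℂ} (hγ : IsSmoothArc γ) (j : ℕ) :
    BubblePoint.LiesOn ⟨q, arcTail γ j⟩ H ↔ PowerSeries.X ^ (j + 1) ∣ pull γ (localMap q H) := by
  rw [BubblePoint.LiesOn, BubblePoint.mult, Set.image_singleton]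
  exact systemMult_transformAlong_singleton j hγ (hasLinearPart_localMap q hH h0)

/-- Beyond the immediate successors there is no proximity between the points of an arc. -/
theorem proximate_arcTail_iff {γ : Fin 2 → PowerSeries ℂ} (hγ : IsSmoothArc γ)
    (q : Projectivization ℂ (Fin 3 → ℂ)) (pre : List (OnePoint ℂ)) (i j : ℕ) :
    BubblePoint.Proximate ⟨q, pre ++ arcTail γ i⟩ ⟨q, pre ++ arcTail γ j⟩ ↔ i = j + 1 := by
  constructor
  · rintro ⟨-, t, us, e, h⟩
    simp only [List.append_assoc, List.append_cancel_left_eq] at e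
    have hlen := congrArg List.length e
    simp only [length_arcTail, List.length_append, List.length_cons] at hlen
    rcases us with _ | ⟨a, us⟩
    · simpa using hlen
    · exfalso
      have ha : (arcTail γ i)[j + 1]? = some a := by
        rw [e, List.getElem?_append_right (by simp)]
        simp
      have ha' : (arcTail γ i)[j + 1]? = some (arcDir γ (j + 1)) := by
        have : j + 1 < i := by simp at hlen; omega
        simp [arcTail, this]
      have haa : a = arcDir γ (j + 1) := Option.some_injective _ (ha.symm.trans ha')
      have hinf := arcDir_succ_ne_infty hγ j
      rw [← haa] at hinf
      induction a using OnePoint.rec with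
      | infty => exact hinf rfl
      | coe c =>
        have hm : systemMult {(X 0 : MvPolynomial (Fin 2) ℂ)} = 1 :=
          systemMult_eq_one (by simp) rfl ⟨0, by simp [linCoeff_X]⟩
        have h1 : (1 : MvPolynomial (Fin 2) ℂ) ∈ transform (OnePoint.some c) {X 0} :=
          mem_transform_of_eq hm rfl (by simp [blowupMap])
        have := systemMult_transformAlong_eq_zero us h1 (by simp)
        simp only [transformAlong, List.foldl_cons] at h this
        omega
  · rintro rfl
    refine ⟨rfl, arcDir γ j, [], ?_, ?_⟩
    · simp [arcTail, List.range_succ]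
    · have hm : systemMult {(X 0 : MvPolynomial (Fin 2) ℂ)} = 1 :=
        systemMult_eq_one (by simp) rfl ⟨0, by simp [linCoeff_X]⟩
      simp [transformAlong, hm]

/-- The point `P` of the bubble space, different from the double point `p`, lies over the
direction `s` at `p`, that is, over the corresponding line through `p`. -/
def IsOver (ℓ : Fin 3 → MvPolynomial (Fin 3) ℂ) (p : Projectivization ℂ (Fin 3 → ℂ))
    (s : OnePoint ℂ) (P : BubblePoint) : Prop :=
  (P.proper = p ∧ ∃ ts, P.tail = s :: ts) ∨ (P.proper ≠ p ∧ HasDirection ℓ P.proper s)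

section IsOver

variable {p : Projectivization ℂ (Fin 3 → ℂ)} {ℓ : Fin 3 → MvPolynomial (Fin 3) ℂ}

theorem exists_isOver (hℓ : IsFrame p ℓ) {P : BubblePoint} (hP : P ≠ ⟨p, []⟩) :
    ∃ s, IsOver ℓ p s P := by
  by_cases h : P.proper = p
  · rcases e : P.tail with _ | ⟨s, ts⟩
    · exact absurd (BubblePoint.ext h e) hP
    · exact ⟨s, Or.inl ⟨h, ts, e⟩⟩
  · rw [hℓ.eq_base_iff] at h
    obtain ⟨s, μ, hμ, h0, h1⟩ := exists_dir h
    refine ⟨s, Or.inr ⟨?_, μ, hμ, h0, h1⟩⟩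
    rw [ne_eq, hℓ.eq_base_iff]; exact h

theorem IsOver.unique {P : BubblePoint} {s t : OnePoint ℂ}
    (hs : IsOver ℓ p s P) (ht : IsOver ℓ p t P) : s = t := by
  rcases hs with ⟨h1, ts, e⟩ | ⟨h1, μ, hμ, e0, e1⟩
  · rcases ht with ⟨-, ts', e'⟩ | ⟨h2, -⟩
    · rw [e] at e'; exact (List.cons.inj e').1
    · exact absurd h1 h2
  · rcases ht with ⟨h2, -⟩ | ⟨-, ν, hν, e0', e1'⟩
    · exact absurd h2 h1
    · apply dir_eq_of_proportional hμ hν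
      intro i; fin_cases i
      · exact e0.symm.trans e0'
      · exact e1.symm.trans e1'

theorem IsOver.ne_base {P : BubblePoint} {s : OnePoint ℂ} (hs : IsOver ℓ p s P) :
    P ≠ ⟨p, []⟩ := by
  rintro rfl
  rcases hs with ⟨-, ts, e⟩ | ⟨h1, -⟩
  · simp at e
  · exact h1 rfl

theorem IsOver.of_proximate {P Q : BubblePoint} {s t : OnePoint ℂ} (hPQ : P.Proximate Q)
    (hP : IsOver ℓ p s P) (hQ : IsOver ℓ p t Q) : s = t := by
  obtain ⟨h, a, us, e, -⟩ := hPQ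
  refine hP.unique ?_
  rcases hQ with ⟨h1, ts, e'⟩ | ⟨h1, h2⟩
  · exact Or.inl ⟨h.trans h1, ts ++ a :: us, by rw [e, e']; rfl⟩
  · exact Or.inr ⟨h ▸ h1, h ▸ h2⟩

theorem HasDirection.ne_base (hℓ : IsFrame p ℓ) {q : Projectivization ℂ (Fin 3 → ℂ)}
    {s : OnePoint ℂ} (h : HasDirection ℓ q s) : q ≠ p := by
  obtain ⟨μ, hμ, h0, h1⟩ := h
  rw [ne_eq, hℓ.eq_base_iff, h0, h1]
  rintro ⟨e0, e1⟩
  exact dirVec_ne_zero s ⟨(mul_eq_zero.1 e0).resolve_left hμ, (mul_eq_zero.1 e1).resolve_left hμ⟩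

end IsOver

/-- The equation of a line that does not pass through the base point of the frame. -/
noncomputable def lineForm (ℓ : Fin 3 → MvPolynomial (Fin 3) ℂ) (m : MvPolynomial (Fin 2) ℂ) :
    MvPolynomial (Fin 3) ℂ := ℓ 2 - aeval ![ℓ 0, ℓ 1] m

theorem IsFrame.isHomogeneous_lineForm {p : Projectivization ℂ (Fin 3 → ℂ)}
    {ℓ : Fin 3 → MvPolynomial (Fin 3) ℂ} (hℓ : IsFrame p ℓ) {m : MvPolynomial (Fin 2) ℂ}
    (hm : m.IsHomogeneous 1) : (lineForm ℓ m).IsHomogeneous 1 := by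
  refine (hℓ.homog 2).sub ?_
  have := hm.aeval (n := 1) ![ℓ 0, ℓ 1] (fun i => by
    fin_cases i
    · exact hℓ.homog 0
    · exact hℓ.homog 1)
  simpa using this

theorem IsFrame.aeval_rep_lineForm {p : Projectivization ℂ (Fin 3 → ℂ)}
    {ℓ : Fin 3 → MvPolynomial (Fin 3) ℂ} (hℓ : IsFrame p ℓ) {m : MvPolynomial (Fin 2) ℂ}
    (hm : m.IsHomogeneous 1) : aeval p.rep (lineForm ℓ m) ≠ 0 := by
  rw [lineForm, map_sub, map_aeval_pair, hℓ.aeval_rep.1, hℓ.aeval_rep.2.1]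
  have : aeval (fun i => (0 : ℂ) * (![0, 0] : Fin 2 → ℂ) i) m = 0 := by
    rw [aeval_mul_left_of_isHomogeneous hm, pow_one, zero_mul]
  have e : (fun i => (0 : ℂ) * (![0, 0] : Fin 2 → ℂ) i) = ![0, 0] := by
    ext i; fin_cases i <;> simp
  rw [e] at this
  rw [this, sub_zero]
  exact hℓ.aeval_rep.2.2

/-- The points `b 0, b 1, …` over the direction `s` are infinitely near each other along an arc, and
the base points of the net over `s` are the first `M.chainLength s` of them.  The first
`M.excContact s` of these are proximate to the double point, the first `M.lineContact m s` of them
lie on the line `z = m(x, y)`, and a line through the double point contains at most the first. -/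
structure IsBaseChain (M : JonqMatrix) (ℓ : Fin 3 → MvPolynomial (Fin 3) ℂ)
    (p : Projectivization ℂ (Fin 3 → ℂ)) (s : OnePoint ℂ) (b : ℕ → BubblePoint) : Prop where
  isOver : ∀ j, IsOver ℓ p s (b j)
  mult_eq : ∀ j < M.chainLength s, (b j).mult (M.netIn ℓ) = 1
  complete : ∀ P, IsOver ℓ p s P → 0 < P.mult (M.netIn ℓ) → ∃ j < M.chainLength s, P = b j
  proximate_iff : ∀ i j, (b i).Proximate (b j) ↔ i = j + 1
  proximate_base_iff : ∀ j < M.chainLength s,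
    (b j).Proximate ⟨p, []⟩ ↔ ((j + 1 : ℕ) : ℕ∞) ≤ M.excContact s
  liesOn_lineForm_iff : ∀ m : MvPolynomial (Fin 2) ℂ, m.IsHomogeneous 1 →
    ∀ j < M.chainLength s, (b j).LiesOn (lineForm ℓ m) ↔ ((j + 1 : ℕ) : ℕ∞) ≤ M.lineContact m s
  liesOn_fibre : ∀ β δ : ℂ, ¬ (β = 0 ∧ δ = 0) → ∀ j < M.chainLength s,
    (b j).LiesOn (β • ℓ 0 + δ • ℓ 1) → j = 0 ∧ β * dirVec s 0 + δ * dirVec s 1 = 0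

theorem smul_add_smul_ne_zero {p : Projectivization ℂ (Fin 3 → ℂ)}
    {ℓ : Fin 3 → MvPolynomial (Fin 3) ℂ} (hℓ : IsFrame p ℓ) {β δ : ℂ}
    (h : ¬ (β = 0 ∧ δ = 0)) : β • ℓ 0 + δ • ℓ 1 ≠ 0 := by
  intro e
  have := congrArg (localMap p) e
  rw [map_add, map_smul, map_smul, hℓ.localMap_eq, hℓ.localMap_eq, map_zero] at this
  have e : ∀ i, linCoeff i (β • X 0 + δ • X 1) = β * linCoeff i (X 0) + δ * linCoeff i (X 1) := by
    intro i
    simp only [linCoeff, coeff_add, coeff_smul, smul_eq_mul]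
  have hz : ∀ i, linCoeff i 0 = 0 := fun i => by simp [linCoeff]
  have h0 := congrArg (linCoeff 0) this
  have h1 := congrArg (linCoeff 1) this
  simp only [Matrix.cons_val_zero, Matrix.cons_val_one, e, hz, linCoeff_X] at h0 h1
  exact h ⟨by simpa using h0, by simpa using h1⟩

theorem isHomogeneous_smul_add_smul {p : Projectivization ℂ (Fin 3 → ℂ)}
    {ℓ : Fin 3 → MvPolynomial (Fin 3) ℂ} (hℓ : IsFrame p ℓ) (β δ : ℂ) :
    (β • ℓ 0 + δ • ℓ 1).IsHomogeneous 1 := by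
  rw [smul_eq_C_mul, smul_eq_C_mul]
  exact ((hℓ.homog 0).C_mul β).add ((hℓ.homog 1).C_mul δ)

theorem mult_eq_zero_of_mem {L : Set (MvPolynomial (Fin 3) ℂ)} {P : BubblePoint} {g} {d : ℕ}
    (hg : g ∈ L) (hd : g.IsHomogeneous d) (h : aeval P.proper.rep g ≠ 0) : P.mult L = 0 :=
  systemMult_transformAlong_eq_zero _ ⟨g, hg, rfl⟩
    (fun h' => h ((constantCoeff_localMap_eq_zero_iff hd).1 h'))

namespace JonqMatrix

variable (M : JonqMatrix) {p : Projectivization ℂ (Fin 3 → ℂ)}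
  {ℓ : Fin 3 → MvPolynomial (Fin 3) ℂ}

/-- A proper base point other than the double point is a common zero of the two rows. -/
theorem rowForm_eq_zero_of_mult_pos (hℓ : IsFrame p ℓ) {s : OnePoint ℂ} {P : BubblePoint}
    (hP : 0 < P.mult (M.netIn ℓ)) (hs : HasDirection ℓ P.proper s) :
    rowForm M.a M.b (fun j => aeval P.proper.rep (ℓ j)) = 0 ∧
      rowForm M.c M.d (fun j => aeval P.proper.rep (ℓ j)) = 0 := by
  have hall : ∀ α β δ, aeval P.proper.rep (M.member α β δ ℓ) = 0 := by
    intro α β δ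
    by_contra h
    have := mult_eq_zero_of_mem (L := M.netIn ℓ) ⟨α, β, δ, rfl⟩
      (M.isHomogeneous_member hℓ.homog α β δ) h
    omega
  obtain ⟨β₀, δ₀, -, hβδ⟩ := exists_dirCoord_eq_one s
  obtain ⟨μ, hμ, e0, e1⟩ := hs
  constructor
  · have := hall 1 0 0
    rw [map_member] at this
    simpa [member] using this
  · have := hall 0 β₀ δ₀
    rw [map_member, member, zero_smul, zero_add, e0, e1] at this
    refine (mul_eq_zero.1 this).resolve_left ?_
    have : β₀ • (μ * dirVec s 0) + δ₀ • (μ * dirVec s 1) = μ := by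
      rw [smul_eq_mul, smul_eq_mul]; linear_combination μ * hβδ
    rwa [this]

theorem exists_isChain (hℓ : IsFrame p ℓ) (s : OnePoint ℂ) : ∃ b, IsBaseChain M ℓ p s b := by
  by_cases hac : valAt s M.a ≠ 0 ∨ valAt s M.c ≠ 0
  · obtain ⟨q, γ, hq, hγ, hcur, hline, hfib, hcomp⟩ := M.exists_proper_chain hℓ s hac
    have hqp := hq.ne_base hℓ
    refine ⟨fun j => ⟨q, arcTail γ j⟩, ?_⟩
    constructor
    · exact fun j => Or.inr ⟨hqp, hq⟩
    · intro j hj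
      rcases hcur.systemMult_eq (arcTail γ j) hγ with h | h
      · exact h.2
      · exact absurd ⟨j, hj, rfl⟩ h.1
    · intro P hP hpos
      rcases hP with ⟨h1, ts, e⟩ | ⟨h1, h2⟩
      · exfalso
        obtain ⟨f, hf, hf0⟩ := M.exists_transform_constantCoeff_ne_zero hℓ s hac
        have := systemMult_transformAlong_eq_zero ts hf hf0
        rw [BubblePoint.mult, e, h1, transformAlong, List.foldl_cons] at hpos
        rw [transformAlong] at this
        omega
      · obtain ⟨hF, hG⟩ := M.rowForm_eq_zero_of_mult_pos hℓ hpos h2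
        have hPq := hcomp _ h2 hF hG
        rw [BubblePoint.mult, hPq] at hpos
        rcases hcur.systemMult_eq P.tail hγ with h | h
        · obtain ⟨j, hj, e⟩ := h.1
          exact ⟨j, hj, BubblePoint.ext hPq e⟩
        · rw [h.2] at hpos; exact absurd hpos (lt_irrefl 0)
    · intro i j
      exact proximate_arcTail_iff hγ q [] i j
    · intro j hj
      refine iff_of_false (fun h => hqp h.1) ?_
      rw [excContact, not_le, min_lt_iff]
      have h1 : ∀ H, valAt s H ≠ 0 → ordAt s H < ((j + 1 : ℕ) : ℕ∞) := by
        intro H hH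
        have : ordAt s H = 0 := by
          rw [← nonpos_iff_eq_zero, ← not_lt, ordAt_pos_iff]; exact hH
        rw [this]; exact_mod_cast Nat.succ_pos j
      exact hac.imp (h1 _) (h1 _)
    · intro m hm j hj
      rw [liesOn_arcTail_iff (hℓ.isHomogeneous_lineForm hm) (fun h => by
        have := hℓ.aeval_rep_lineForm hm
        rw [h, map_zero] at this
        exact this rfl) hγ]
      exact hline m hm (j + 1) hj
    · intro β δ h j hj hl
      rw [liesOn_arcTail_iff (isHomogeneous_smul_add_smul hℓ β δ) (smul_add_smul_ne_zero hℓ h) hγ]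
        at hl
      constructor
      · by_contra hj0
        exact hfib β δ h ((pow_dvd_pow _ (by omega)).trans hl)
      · have h1 := (dvd_pow_self PowerSeries.X (by omega : j + 1 ≠ 0)).trans hl
        rw [X_dvd_pull_iff hγ, constantCoeff_localMap_eq_zero_iff
          (isHomogeneous_smul_add_smul hℓ β δ), map_add, map_smul, map_smul] at h1
        obtain ⟨μ, hμ, e0, e1⟩ := hq
        rw [e0, e1, smul_eq_mul, smul_eq_mul] at h1
        apply mul_left_cancel₀ hμ
        linear_combination h1
  · push Not at hac
    obtain ⟨γ, hγ, hγ1, hcur, hexc⟩ := M.exists_exceptional_chain hℓ s hac.1 hac.2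
    have hbd : valAt s M.b ≠ 0 ∨ valAt s M.d ≠ 0 := by
      by_contra h
      push Not at h
      apply M.ne_zero_at s
      simp only [ordAt_pos_iff]
      exact ⟨hac.1, h.1, hac.2, h.2⟩
    refine ⟨fun j => ⟨p, s :: arcTail γ j⟩, ?_⟩
    constructor
    · exact fun j => Or.inl ⟨rfl, _, rfl⟩
    · intro j hj
      rcases hcur.systemMult_eq (arcTail γ j) hγ with h | h
      · exact h.2
      · exact absurd ⟨j, hj, rfl⟩ h.1
    · intro P hP hpos
      rcases hP with ⟨h1, ts, e⟩ | ⟨h1, h2⟩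
      · rw [BubblePoint.mult, e, h1, transformAlong, List.foldl_cons] at hpos
        rcases hcur.systemMult_eq ts hγ with h | h
        · obtain ⟨j, hj, e'⟩ := h.1
          exact ⟨j, hj, BubblePoint.ext h1 (by rw [e, e'])⟩
        · rw [← transformAlong, h.2] at hpos; exact absurd hpos (lt_irrefl 0)
      · exfalso
        obtain ⟨hF, hG⟩ := M.rowForm_eq_zero_of_mult_pos hℓ hpos h2
        obtain ⟨μ, hμ, e0, e1⟩ := h2
        have ex : (fun j => aeval P.proper.rep (ℓ j)) =
            ![μ * dirVec s 0, μ * dirVec s 1, aeval P.proper.rep (ℓ 2)] := by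
          ext j; fin_cases j
          · exact e0
          · exact e1
          · rfl
        rw [ex, rowForm_mul M.ha M.hb, ← valAt_eq, ← valAt_eq, hac.1] at hF
        rw [ex, rowForm_mul M.hc M.hd, ← valAt_eq, ← valAt_eq, hac.2] at hG
        simp [hμ] at hF hG
        exact hbd.elim (fun h => h hF) (fun h => h hG)
    · intro i j
      exact proximate_arcTail_iff hγ p [s] i j
    · intro j hj
      rw [← hexc (j + 1) hj, ← pull_X γ 0, ← systemMult_transformAlong_singleton j hγ
        (fun _ => ⟨0, by simp [linCoeff_X]⟩)]
      constructor
      · rintro ⟨-, t, us, e, h⟩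
        rw [List.nil_append, List.cons.injEq] at e
        rwa [e.2]
      · exact fun h => ⟨rfl, s, _, rfl, h⟩
    · intro m hm j hj
      have h1 : BubblePoint.mult {lineForm ℓ m} ⟨p, s :: arcTail γ j⟩ = 0 :=
        mult_eq_zero_of_mem rfl (hℓ.isHomogeneous_lineForm hm) (hℓ.aeval_rep_lineForm hm)
      rw [BubblePoint.LiesOn, h1]
      refine iff_of_false (lt_irrefl 0) ?_
      rw [lineContact, not_le, min_lt_iff]
      have h1 : ∀ f g, valAt s f = 0 → valAt s g ≠ 0 →
          ordAt s (f * m + g) < ((j + 1 : ℕ) : ℕ∞) := by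
        intro f g hf hg
        have : ordAt s (f * m + g) = 0 := by
          rw [← nonpos_iff_eq_zero, ← not_lt, ordAt_pos_iff, valAt, map_add, map_mul, map_add,
            map_mul]
          rw [valAt] at hf
          rwa [hf, zero_mul, zero_add]
        rw [this]; exact_mod_cast Nat.succ_pos j
      exact hbd.imp (h1 _ _ hac.1) (h1 _ _ hac.2)
    · intro β δ h j hj hl
      have hf : localMap p (β • ℓ 0 + δ • ℓ 1) = β • X 0 + δ • X 1 := by
        rw [map_add, map_smul, map_smul, hℓ.localMap_eq, hℓ.localMap_eq]; rfl
      set f : MvPolynomial (Fin 2) ℂ := β • X 0 + δ • X 1 with hfdef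
      have hfh : f.IsHomogeneous 1 := by
        rw [hfdef, smul_eq_C_mul, smul_eq_C_mul]
        exact ((isHomogeneous_X _ _).C_mul β).add ((isHomogeneous_X _ _).C_mul δ)
      have hlin : HasLinearPart f := by
        rw [← hf]
        apply hasLinearPart_localMap p (isHomogeneous_smul_add_smul hℓ β δ)
          (smul_add_smul_ne_zero hℓ h)
        rw [hf]; simp [hfdef]
      have hm : systemMult {f} = 1 := systemMult_eq_one (by simp [hfdef]) rfl hlin
      have htr : transform s {f} = {aeval (blowupDir s) f} := by
        rw [transform, Set.image_singleton, hm, blowupMap_of_isHomogeneous hfh,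
          divMonomial_X_pow_mul]
      have hloc : loc s f = β • dirCoord s 0 + δ • dirCoord s 1 := by
        rw [hfdef, map_add, map_smul, map_smul, loc, aeval_X, aeval_X]
      have hX2 : ¬ PowerSeries.X ^ 2 ∣ loc s f := by rw [hloc]; exact dirForm_expansion h
      rw [BubblePoint.LiesOn, BubblePoint.mult, Set.image_singleton, hf, transformAlong,
        List.foldl_cons, htr, ← transformAlong, systemMult_transformAlong_singleton j hγ,
        pull_aeval_blowupDir s hγ1] at hl
      · constructor
        · by_contra hj0
          exact hX2 ((pow_dvd_pow _ (by omega)).trans hl)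
        · have h1 := (dvd_pow_self PowerSeries.X (by omega : j + 1 ≠ 0)).trans hl
          rw [PowerSeries.X_dvd_iff, hloc] at h1
          simpa [PowerSeries.smul_eq_C_mul, dirVec] using h1
      · intro h0
        apply hasLinearPart_of_pull hγ.const
        rw [pull_aeval_blowupDir s hγ1]
        intro h1
        apply hX2
        rw [PowerSeries.X_pow_dvd_iff]
        intro n hn
        interval_cases n
        · rw [PowerSeries.coeff_zero_eq_constantCoeff_apply]
          rwa [constantCoeff_aeval_blowupDir] at h0
        · exact h1

end JonqMatrix

/-! ### The chains of base points in the table -/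

/-- The chains of simple base points of the graphs of the table.  The entry `(k, e, l)` stands for a
chain of `k` successive infinitely near points, the first `e` of them proximate to the double
point, and the first `l` of them on the line.  The vertices `1, 2, 3, 4` run through the chains in
this order. -/
def chainTable : Fin 31 → List (ℕ × ℕ × ℕ) :=
  ![[(4, 2, 0)],
    [(4, 1, 0)],
    [(1, 1, 0), (3, 1, 0)],
    [(2, 1, 0), (2, 1, 0)],
    [(3, 2, 0), (1, 0, 0)],
    [(1, 1, 0), (2, 1, 0), (1, 0, 0)],
    [(3, 1, 0), (1, 0, 0)],
    [(4, 0, 3)],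
    [(4, 0, 0)],
    [(1, 1, 0), (3, 0, 3)],
    [(1, 1, 0), (3, 0, 0)],
    [(2, 2, 0), (2, 0, 0)],
    [(2, 1, 0), (2, 0, 0)],
    [(1, 1, 0), (1, 1, 0), (2, 0, 0)],
    [(2, 2, 0), (1, 0, 0), (1, 0, 0)],
    [(2, 1, 0), (1, 0, 0), (1, 0, 0)],
    [(1, 0, 1), (3, 0, 2)],
    [(1, 0, 0), (3, 0, 3)],
    [(1, 0, 0), (3, 0, 0)],
    [(2, 0, 2), (2, 0, 1)],
    [(2, 0, 0), (2, 0, 0)],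
    [(1, 1, 0), (1, 0, 1), (2, 0, 2)],
    [(1, 1, 0), (1, 0, 0), (2, 0, 0)],
    [(1, 0, 1), (1, 0, 1), (2, 0, 1)],
    [(1, 0, 0), (1, 0, 1), (2, 0, 2)],
    [(1, 0, 0), (1, 0, 0), (2, 0, 0)],
    [(1, 1, 0), (1, 1, 0), (1, 0, 0), (1, 0, 0)],
    [(1, 1, 0), (1, 0, 1), (1, 0, 1), (1, 0, 1)],
    [(1, 1, 0), (1, 0, 0), (1, 0, 0), (1, 0, 0)],
    [(1, 0, 0), (1, 0, 1), (1, 0, 1), (1, 0, 1)],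
    [(1, 0, 0), (1, 0, 0), (1, 0, 0), (1, 0, 0)]]

/-- The points of a list of chains: `(i, j)` is the `j`-th point of the `i`-th chain. -/
def chainPositions (D : List (ℕ × ℕ × ℕ)) : List (ℕ × ℕ) :=
  D.zipIdx.flatMap fun x => (List.range x.1.1).map fun j => (x.2, j)

/-- The position of the vertex `u + 1` of the `n`-th graph of the table. -/
def tablePos (n : Fin 31) (u : Fin 4) : ℕ × ℕ :=
  (chainPositions (chainTable n)).getD u (0, 0)

/-- The chain containing the vertex `u + 1` of the `n`-th graph of the table. -/
def tableChain (n : Fin 31) (u : Fin 4) : ℕ × ℕ × ℕ :=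
  (chainTable n).getD (tablePos n u).1 (0, 0, 0)

theorem tablePos_lt : ∀ n u, (tablePos n u).1 < (chainTable n).length ∧
    (tablePos n u).2 < (tableChain n u).1 := by
  decide

theorem tablePos_injective : ∀ n u v, tablePos n u = tablePos n v → u = v := by
  decide

theorem exists_tablePos_eq : ∀ n, ∀ i : Fin 4, ∀ j : Fin 4,
    (i : ℕ) < (chainTable n).length →
    (j : ℕ) < ((chainTable n).getD i (0, 0, 0)).1 → ∃ u, tablePos n u = ((i : ℕ), (j : ℕ)) := by
  decide

theorem chainTable_bounds : ∀ n, (chainTable n).length ≤ 4 ∧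
    ((chainTable n).map (fun x => x.1)).sum = 4 ∧ ∀ x ∈ chainTable n, 0 < x.1 ∧ x.1 ≤ 4 := by
  decide

theorem mem_tableArrows_succ_iff : ∀ n u v, (Fin.succ u, Fin.succ v) ∈ tableArrows n ↔
    (tablePos n u).1 = (tablePos n v).1 ∧ (tablePos n u).2 = (tablePos n v).2 + 1 := by
  decide

theorem mem_tableArrows_zero_iff : ∀ n u, (Fin.succ u, 0) ∈ tableArrows n ↔
    (tablePos n u).2 < (tableChain n u).2.1 := by
  decide

theorem not_mem_tableArrows : ∀ n v, (0, v) ∉ tableArrows n := by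
  decide

theorem tableLines_eq_nil : ∀ n, (∀ x ∈ chainTable n, x.2.2 = 0) → tableLines n = [] := by
  decide

theorem exists_tableLines_eq : ∀ n, ¬ (∀ x ∈ chainTable n, x.2.2 = 0) →
    ∃ T, tableLines n = [T] ∧ T.card = 3 ∧ 0 ∉ T ∧
      (∀ u, Fin.succ u ∈ T ↔ (tablePos n u).2 < (tableChain n u).2.2) ∧
      ((chainTable n).map (fun x => x.2.2)).sum = 3 := by
  decide

/-! ### The graph of a net -/

theorem systemMult_singleton_smul {c : ℂ} (hc : c ≠ 0) (f : MvPolynomial (Fin 2) ℂ) :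
    systemMult {c • f} = systemMult {f} := by
  have : (c • f).support = f.support := by
    ext d; simp [mem_support_iff, hc]
  simp only [systemMult, Set.mem_singleton_iff, exists_eq_left, this]

theorem systemMult_transformAlong_singleton_smul {c : ℂ} (hc : c ≠ 0) (ts : List (OnePoint ℂ)) :
    ∀ f : MvPolynomial (Fin 2) ℂ, systemMult (transformAlong ts {c • f}) =
      systemMult (transformAlong ts {f}) := by
  induction ts with
  | nil => exact systemMult_singleton_smul hc
  | cons t ts ih =>
    intro f
    have : transform t {c • f} =
        {c • (blowupMap t f).divMonomial (Finsupp.single 0 (systemMult {f}))} := by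
      rw [transform, Set.image_singleton, systemMult_singleton_smul hc, map_smul]
      congr 1
      ext d
      simp only [coeff_divMonomial, coeff_smul]
    have h' : transform t {f} =
        {(blowupMap t f).divMonomial (Finsupp.single 0 (systemMult {f}))} := by
      rw [transform, Set.image_singleton]
    change systemMult (transformAlong ts (transform t {c • f})) =
      systemMult (transformAlong ts (transform t {f}))
    rw [this, h', ih]

theorem liesOn_smul_iff {c : ℂ} (hc : c ≠ 0) (P : BubblePoint) (F : MvPolynomial (Fin 3) ℂ) :
    P.LiesOn (c • F) ↔ P.LiesOn F := by
  rw [BubblePoint.LiesOn, BubblePoint.LiesOn, BubblePoint.mult, BubblePoint.mult,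
    Set.image_singleton, Set.image_singleton, map_smul,
    systemMult_transformAlong_singleton_smul hc]

/-- A linear form, up to a factor, is the equation of a line through the base point of the frame or
of a line not passing through it. -/
theorem IsFrame.linear_form_cases {p : Projectivization ℂ (Fin 3 → ℂ)}
    {ℓ : Fin 3 → MvPolynomial (Fin 3) ℂ} (hℓ : IsFrame p ℓ) {l : MvPolynomial (Fin 3) ℂ}
    (hl : l.IsHomogeneous 1) (h0 : l ≠ 0) :
    (∃ β δ : ℂ, ¬ (β = 0 ∧ δ = 0) ∧ l = β • ℓ 0 + δ • ℓ 1) ∨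
      ∃ (ε : ℂ) (m : MvPolynomial (Fin 2) ℂ), ε ≠ 0 ∧ m.IsHomogeneous 1 ∧
        l = ε • lineForm ℓ m := by
  have hspan : ∃ β δ ε : ℂ, l = β • ℓ 0 + δ • ℓ 1 + ε • ℓ 2 := by
    obtain ⟨E, hE, -⟩ := hℓ.exists_inverse
    clear h0
    rw [← mem_homogeneousSubmodule, homogeneousSubmodule_one_eq_span_X] at hl
    induction hl using Submodule.span_induction with
    | mem x hx =>
      obtain ⟨i, rfl⟩ := hx
      refine ⟨E i 0, E i 1, E i 2, ?_⟩
      rw [← hE, Fin.sum_univ_three]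
      simp only [smul_eq_C_mul]
    | zero => exact ⟨0, 0, 0, by simp⟩
    | add x y _ _ hx hy =>
      obtain ⟨β, δ, ε, rfl⟩ := hx
      obtain ⟨β', δ', ε', rfl⟩ := hy
      exact ⟨β + β', δ + δ', ε + ε', by simp only [add_smul]; abel⟩
    | smul a x _ hx =>
      obtain ⟨β, δ, ε, rfl⟩ := hx
      exact ⟨a * β, a * δ, a * ε, by simp only [smul_add, smul_smul]⟩
  obtain ⟨β, δ, ε, rfl⟩ := hspan
  by_cases hε : ε = 0
  · left
    refine ⟨β, δ, ?_, by simp [hε]⟩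
    rintro ⟨rfl, rfl⟩
    exact h0 (by simp [hε])
  · right
    refine ⟨ε, (-β / ε) • X 0 + (-δ / ε) • X 1, hε, ?_, ?_⟩
    · rw [smul_eq_C_mul, smul_eq_C_mul]
      exact ((isHomogeneous_X _ _).C_mul _).add ((isHomogeneous_X _ _).C_mul _)
    · rw [lineForm, map_add, map_smul, map_smul, aeval_X, aeval_X, smul_sub, smul_add, smul_smul,
        smul_smul, mul_div_cancel₀ _ hε, mul_div_cancel₀ _ hε]
      simp only [Matrix.cons_val_zero, Matrix.cons_val_one, neg_smul]
      abel

theorem EnrichedGraph.isomorphic_of_bijective {V W : Type} {G : EnrichedGraph V}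
    {H : EnrichedGraph W} (v : W → V) (hv : Function.Bijective v)
    (harrow : ∀ x y, G.arrow (v x) (v y) ↔ H.arrow x y)
    (hweight : ∀ x, G.weight (v x) = H.weight x)
    (hlines : ∀ T : Set W, v '' T ∈ G.lines ↔ T ∈ H.lines) : G.Isomorphic H := by
  let e := Equiv.ofBijective v hv
  have he : ∀ x, v x = e x := fun _ => rfl
  refine ⟨e.symm, fun P Q => ?_, fun P => ?_, fun S => ?_⟩
  · rw [← harrow, he, he, e.apply_symm_apply, e.apply_symm_apply]
  · rw [← hweight, he, e.apply_symm_apply]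
  · rw [← hlines]
    have : v '' (e.symm '' S) = S := by
      change e '' (e.symm '' S) = S
      rw [← Set.image_comp]; simp
    rw [this]

namespace JonqMatrix

variable (M : JonqMatrix)

theorem lineContact_le (m : MvPolynomial (Fin 2) ℂ) (s : OnePoint ℂ) :
    M.lineContact m s ≤ M.chainLength s := by
  have e : M.det = M.a * (M.c * m + M.d) - M.c * (M.a * m + M.b) := by rw [det]; ring
  rw [coe_chainLength, e, lineContact]
  refine le_trans ?_ (min_ordAt_le_sub s _ _)
  rw [ordAt_mul, ordAt_mul, min_comm]
  exact min_le_min le_add_self le_add_self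

theorem excContact_le (s : OnePoint ℂ) : M.excContact s ≤ M.chainLength s := by
  rw [coe_chainLength, det, excContact]
  refine le_trans ?_ (min_ordAt_le_sub s _ _)
  rw [ordAt_mul, ordAt_mul]
  exact min_le_min le_self_add le_add_self

theorem lineContact_eq_zero {m : MvPolynomial (Fin 2) ℂ} {s : OnePoint ℂ}
    (h : 0 < M.excContact s) : M.lineContact m s = 0 := by
  rw [excContact, lt_min_iff, ordAt_pos_iff, ordAt_pos_iff] at h
  by_contra h0
  rw [← ne_eq, ← pos_iff_ne_zero, lineContact, lt_min_iff, ordAt_pos_iff, ordAt_pos_iff] at h0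
  apply M.ne_zero_at s
  simp only [ordAt_pos_iff]
  have hval : ∀ f g, valAt s f = 0 → valAt s (f * m + g) = 0 → valAt s g = 0 := by
    intro f g hf hg
    rw [valAt, map_add, map_mul, map_add, map_mul] at hg
    rw [valAt] at hf ⊢
    rwa [hf, zero_mul, zero_add] at hg
  exact ⟨h.1, hval _ _ h.1 h0.1, h.2, hval _ _ h.2 h0.2⟩

theorem sum_lineContact_le {m : MvPolynomial (Fin 2) ℂ} (hm : m.IsHomogeneous 1)
    (S : Finset (OnePoint ℂ)) : ∑ s ∈ S, M.lineContact m s ≤ 3 := by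
  by_cases h : M.a * m + M.b = 0
  · have h' : M.c * m + M.d ≠ 0 := by
      intro h'
      apply M.det_ne_zero
      linear_combination M.a * h' - M.c * h
    refine (Finset.sum_le_sum fun s _ => min_le_right _ _).trans ?_
    exact (sum_ordAt_le ((M.hc.mul hm).add M.hd) h' S).trans (by norm_num)
  · refine (Finset.sum_le_sum fun s _ => min_le_left _ _).trans ?_
    exact sum_ordAt_le ((M.ha.mul hm).add M.hb) h S

theorem sum_excContact_le (S : Finset (OnePoint ℂ)) : ∑ s ∈ S, M.excContact s ≤ 2 := by
  by_cases h : M.a = 0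
  · have h' : M.c ≠ 0 := by
      intro h'
      exact M.det_ne_zero (by rw [h, h']; ring)
    refine (Finset.sum_le_sum fun s _ => min_le_right _ _).trans ?_
    exact (sum_ordAt_le M.hc h' S).trans (by norm_num)
  · refine (Finset.sum_le_sum fun s _ => min_le_left _ _).trans ?_
    exact sum_ordAt_le M.ha h S

theorem sum_chainLength_le (S : Finset (OnePoint ℂ)) : ∑ s ∈ S, M.chainLength s ≤ 4 := by
  have := sum_ordAt_le M.isHomogeneous_det M.det_ne_zero S
  simp only [← coe_chainLength] at this
  exact_mod_cast this

theorem coe_toNat_lineContact (m : MvPolynomial (Fin 2) ℂ) (s : OnePoint ℂ) :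
    ((M.lineContact m s).toNat : ℕ∞) = M.lineContact m s :=
  ENat.natCast_toNat (ne_top_of_le_ne_top (ENat.natCast_ne_top _) (M.lineContact_le m s))

theorem coe_toNat_excContact (s : OnePoint ℂ) :
    ((M.excContact s).toNat : ℕ∞) = M.excContact s :=
  ENat.natCast_toNat (ne_top_of_le_ne_top (ENat.natCast_ne_top _) (M.excContact_le s))

theorem min_lineContact_le (m m' : MvPolynomial (Fin 2) ℂ) (s : OnePoint ℂ) :
    min (M.lineContact m s) (M.lineContact m' s) ≤ ordAt s (m - m') := by
  by_cases h : 0 < M.excContact s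
  · rw [M.lineContact_eq_zero h]; simp
  · have key : ∀ f g, ordAt s f = 0 →
        min (ordAt s (f * m + g)) (ordAt s (f * m' + g)) ≤ ordAt s (m - m') := by
      intro f g hf
      have e : f * (m - m') = (f * m + g) - (f * m' + g) := by ring
      rw [← zero_add (ordAt s (m - m')), ← hf, ← ordAt_mul, e]
      exact min_ordAt_le_sub _ _ _
    rw [excContact, not_lt, nonpos_iff_eq_zero] at h
    rcases min_choice (ordAt s M.a) (ordAt s M.c) with h' | h'
    · exact (min_le_min (min_le_left _ _) (min_le_left _ _)).trans (key _ _ (h'.symm.trans h))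
    · exact (min_le_min (min_le_right _ _) (min_le_right _ _)).trans (key _ _ (h'.symm.trans h))

/-- At most one line contains three of the four simple base points. -/
theorem eq_of_three_le_sum_lineContact {m m' : MvPolynomial (Fin 2) ℂ} (hm : m.IsHomogeneous 1)
    (hm' : m'.IsHomogeneous 1) {S : Finset (OnePoint ℂ)} (h : 3 ≤ ∑ s ∈ S, M.lineContact m s)
    (h' : 3 ≤ ∑ s ∈ S, M.lineContact m' s) : m = m' := by
  by_contra hne
  have h1 : ∑ s ∈ S, min (M.lineContact m s) (M.lineContact m' s) ≤ 1 :=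
    (Finset.sum_le_sum fun s _ => M.min_lineContact_le m m' s).trans
      (by exact_mod_cast sum_ordAt_le (hm.sub hm') (sub_ne_zero.2 hne) S)
  have h4 := M.sum_chainLength_le S
  obtain ⟨n, hn⟩ : ∃ n : OnePoint ℂ → ℕ, ∀ s, M.lineContact m s = n s :=
    ⟨_, fun s => (M.coe_toNat_lineContact m s).symm⟩
  obtain ⟨n', hn'⟩ : ∃ n : OnePoint ℂ → ℕ, ∀ s, M.lineContact m' s = n s :=
    ⟨_, fun s => (M.coe_toNat_lineContact m' s).symm⟩
  have hle := M.lineContact_le m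
  have hle' := M.lineContact_le m'
  simp only [hn, hn'] at h h' h1 hle hle'
  have hmin : ∀ s, min (n s : ℕ∞) (n' s) = (min (n s) (n' s) : ℕ) := fun s => by
    rcases le_total (n s) (n' s) with h | h
    · rw [min_eq_left h, min_eq_left (by exact_mod_cast h)]
    · rw [min_eq_right h, min_eq_right (by exact_mod_cast h)]
  simp only [hmin] at h1
  norm_cast at h h' h1 hle hle'
  have h5 : ∑ s ∈ S, (n s + n' s) ≤ ∑ s ∈ S, (min (n s) (n' s) + M.chainLength s) := by
    apply Finset.sum_le_sum
    intro s _
    have := hle s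
    have := hle' s
    omega
  rw [Finset.sum_add_distrib, Finset.sum_add_distrib] at h5
  omega

end JonqMatrix

/-! ### The graph of a net in terms of its chains -/

namespace JonqMatrix

variable (M : JonqMatrix)

/-- The lengths of the chain of simple base points over a direction, of its part consisting of
points proximate to the double point, and of a part of `L s` further distinguished points. -/
noncomputable def chainData (L : OnePoint ℂ → ℕ) (s : OnePoint ℂ) : ℕ × ℕ × ℕ :=
  (M.chainLength s, (M.excContact s).toNat, L s)

/-- The number `L s` of points on a line, in the chain over `s`, for the line that contains three
simple base points over the directions in `S`, if it exists; otherwise zero. -/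
def IsLineData (S : List (OnePoint ℂ)) (L : OnePoint ℂ → ℕ) : Prop :=
  (∃ m : MvPolynomial (Fin 2) ℂ, m.IsHomogeneous 1 ∧ 3 ≤ (S.map L).sum ∧
      ∀ s ∈ S, L s = (M.lineContact m s).toNat) ∨
    ((∀ s ∈ S, L s = 0) ∧ ∀ m : MvPolynomial (Fin 2) ℂ, m.IsHomogeneous 1 →
      ¬ 3 ≤ (S.map fun s => (M.lineContact m s).toNat).sum)

theorem succ_le_lineContact_iff {m : MvPolynomial (Fin 2) ℂ} {s : OnePoint ℂ} {j : ℕ} :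
    ((j + 1 : ℕ) : ℕ∞) ≤ M.lineContact m s ↔ j < (M.lineContact m s).toNat := by
  rw [← coe_toNat_lineContact, Nat.cast_le, ENat.toNat_natCast, Nat.succ_le_iff]

theorem succ_le_excContact_iff {s : OnePoint ℂ} {j : ℕ} :
    ((j + 1 : ℕ) : ℕ∞) ≤ M.excContact s ↔ j < (M.excContact s).toNat := by
  rw [← coe_toNat_excContact, Nat.cast_le, ENat.toNat_natCast, Nat.succ_le_iff]

theorem mem_of_sum_chainLength_eq {S : List (OnePoint ℂ)} (hS : S.Nodup)
    (h : (S.map M.chainLength).sum = 4) {s : OnePoint ℂ} (hs : 0 < M.chainLength s) : s ∈ S := by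
  classical
  by_contra hsS
  have := M.sum_chainLength_le (insert s S.toFinset)
  rw [Finset.sum_insert (by simpa using hsS), List.sum_toFinset _ hS] at this
  exact absurd (this.trans' (Nat.add_le_add_left h.ge _)) (by omega)

end JonqMatrix

theorem not_proximate_nil (p : Projectivization ℂ (Fin 3 → ℂ)) (Q : BubblePoint) :
    ¬ BubblePoint.Proximate ⟨p, []⟩ Q := by
  rintro ⟨-, t, us, e, -⟩
  simp at e

theorem not_liesOn_lineForm {p : Projectivization ℂ (Fin 3 → ℂ)}
    {ℓ : Fin 3 → MvPolynomial (Fin 3) ℂ} (hℓ : IsFrame p ℓ) {m : MvPolynomial (Fin 2) ℂ}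
    (hm : m.IsHomogeneous 1) : ¬ BubblePoint.LiesOn ⟨p, []⟩ (lineForm ℓ m) := by
  have h := mult_eq_zero_of_mem (P := ⟨p, []⟩) (Set.mem_singleton (lineForm ℓ m))
    (hℓ.isHomogeneous_lineForm hm) (hℓ.aeval_rep_lineForm hm)
  rw [BubblePoint.LiesOn, h]
  exact lt_irrefl 0

/-- Two directions annihilated by the same nonzero linear form agree. -/
theorem dir_eq_of_dirVec {s t : OnePoint ℂ} {β δ : ℂ} (h : ¬ (β = 0 ∧ δ = 0))
    (hs : β * dirVec s 0 + δ * dirVec s 1 = 0) (ht : β * dirVec t 0 + δ * dirVec t 1 = 0) :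
    s = t := by
  have key : ∀ r : OnePoint ℂ, β * dirVec r 0 + δ * dirVec r 1 = 0 →
      ∃ ν : ℂ, ν ≠ 0 ∧ δ = ν * dirVec r 0 ∧ -β = ν * dirVec r 1 := by
    intro r hr
    obtain ⟨β₀, δ₀, -, e⟩ := exists_dirCoord_eq_one r
    refine ⟨δ * β₀ - β * δ₀, ?_, ?_, ?_⟩
    · intro h0
      apply h
      constructor
      · linear_combination (-β) * e + β₀ * hr - dirVec r 1 * h0
      · linear_combination (-δ) * e + δ₀ * hr + dirVec r 0 * h0
    · linear_combination (-δ) * e + δ₀ * hr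
    · linear_combination β * e - β₀ * hr
  obtain ⟨μ, hμ, e0, e1⟩ := key s hs
  obtain ⟨ν, hν, e0', e1'⟩ := key t ht
  apply dir_eq_of_proportional hμ hν
  intro i; fin_cases i
  · exact e0.symm.trans e0'
  · exact e1.symm.trans e1'

/-- The numerical data of the chains determine the enriched weighted proximity graph. -/
theorem PlaneCremonaMap.isomorphic_tableGraph {φ : PlaneCremonaMap} {M : JonqMatrix}
    {p : Projectivization ℂ (Fin 3 → ℂ)} {ℓ : Fin 3 → MvPolynomial (Fin 3) ℂ} (hℓ : IsFrame p ℓ)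
    (hnet : φ.net = M.netIn ℓ) {n : Fin 31} {S : List (OnePoint ℂ)} (hS : S.Nodup)
    {L : OnePoint ℂ → ℕ} (hL : M.IsLineData S L) (hD : S.map (M.chainData L) = chainTable n) :
    φ.enrichedGraph.Isomorphic (tableGraph n) := by
  classical
  choose b hb using M.exists_isChain hℓ
  set σ : ℕ → OnePoint ℂ := fun i => S.getD i OnePoint.infty with hσdef
  have hlen : S.length = (chainTable n).length := by rw [← hD, List.length_map]
  obtain ⟨hle4, hsum, -⟩ := chainTable_bounds n
  have hσ : ∀ i < S.length, (chainTable n).getD i (0, 0, 0) = M.chainData L (σ i) := by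
    intro i hi
    rw [List.getD_eq_getElem _ _ (hlen ▸ hi)]
    simp only [← hD, List.getElem_map, hσdef, List.getD_eq_getElem _ _ hi]
  have hσinj : ∀ i < S.length, ∀ j < S.length, σ i = σ j → i = j := by
    intro i hi j hj h
    simp only [hσdef, List.getD_eq_getElem _ _ hi, List.getD_eq_getElem _ _ hj] at h
    exact (List.Nodup.getElem_inj_iff hS).1 h
  have hσmem : ∀ i < S.length, σ i ∈ S := by
    intro i hi
    simp only [hσdef, List.getD_eq_getElem _ _ hi, List.getElem_mem]
  have hroot : ∀ s, 0 < M.chainLength s → ∃ i < S.length, s = σ i := by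
    intro s hs
    have h4 : (S.map M.chainLength).sum = 4 := by
      rw [← hsum, ← hD, List.map_map]; rfl
    obtain ⟨i, hi, e⟩ := List.getElem_of_mem (M.mem_of_sum_chainLength_eq hS h4 hs)
    exact ⟨i, hi, by simp only [hσdef, List.getD_eq_getElem _ _ hi, e]⟩
  have hi : ∀ u, (tablePos n u).1 < S.length := fun u => hlen ▸ (tablePos_lt n u).1
  have hchain : ∀ u, tableChain n u = M.chainData L (σ (tablePos n u).1) := fun u => hσ _ (hi u)
  have hj : ∀ u, (tablePos n u).2 < M.chainLength (σ (tablePos n u).1) := by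
    intro u
    have := (tablePos_lt n u).2
    rwa [hchain] at this
  have hpos_inj : ∀ u u', σ (tablePos n u).1 = σ (tablePos n u').1 →
      (tablePos n u).2 = (tablePos n u').2 → u = u' := by
    intro u u' h1 h2
    exact tablePos_injective n u u' (Prod.ext (hσinj _ (hi u) _ (hi u') h1) h2)
  set w : Fin 4 → BubblePoint := fun u => b (σ (tablePos n u).1) (tablePos n u).2 with hw
  have hwmult : ∀ u, (w u).mult φ.net = 1 := fun u => by
    rw [hnet]; exact (hb _).mult_eq _ (hj u)
  have hpmult : BubblePoint.mult φ.net ⟨p, []⟩ = 2 := by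
    rw [hnet]; exact M.systemMult_localMap_netIn hℓ
  have hwover : ∀ u, IsOver ℓ p (σ (tablePos n u).1) (w u) := fun u => (hb _).isOver _
  have hbinj : ∀ s i j, b s i = b s j → i = j := by
    intro s i j h
    have := ((hb s).proximate_iff (i + 1) i).2 rfl
    rw [h, (hb s).proximate_iff] at this
    omega
  let v : Fin 5 → φ.BasePoint :=
    Fin.cons ⟨⟨p, []⟩, by rw [hpmult]; norm_num⟩ fun u => ⟨w u, by rw [hwmult]; norm_num⟩
  have hv0 : (v 0).1 = ⟨p, []⟩ := rfl
  have hvs : ∀ u : Fin 4, (v u.succ).1 = w u := fun _ => rfl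
  have hv : Function.Bijective v := by
    constructor
    · intro x y hxy
      have hxy' := congrArg Subtype.val hxy
      induction x using Fin.cases with
      | zero =>
        induction y using Fin.cases with
        | zero => rfl
        | succ u => exact absurd hxy'.symm (hwover u).ne_base
      | succ u =>
        induction y using Fin.cases with
        | zero => exact absurd hxy' (hwover u).ne_base
        | succ u' =>
          rw [hvs, hvs] at hxy'
          have h1 : σ (tablePos n u).1 = σ (tablePos n u').1 :=
            (hwover u).unique (hxy' ▸ hwover u')
          have h2 : (tablePos n u).2 = (tablePos n u').2 := by
            apply hbinj (σ (tablePos n u).1)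
            rw [hw] at hxy'
            simpa only [← h1] using hxy'
          rw [hpos_inj u u' h1 h2]
    · rintro ⟨P, hP⟩
      by_cases hPp : P = ⟨p, []⟩
      · exact ⟨0, Subtype.ext (hv0.trans hPp.symm)⟩
      · obtain ⟨s, hs⟩ := exists_isOver hℓ hPp
        rw [hnet] at hP
        obtain ⟨j, hj, rfl⟩ := (hb s).complete P hs hP
        obtain ⟨i, hiS, rfl⟩ := hroot s (by omega)
        have h4 := M.sum_chainLength_le {σ i}
        rw [Finset.sum_singleton] at h4
        obtain ⟨u, hu⟩ := exists_tablePos_eq n ⟨i, by omega⟩ ⟨j, by omega⟩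
          (by rw [← hlen]; exact hiS) (by
            change j < ((chainTable n).getD i (0, 0, 0)).1
            rw [hσ i hiS]; exact hj)
        refine ⟨u.succ, Subtype.ext ?_⟩
        change w u = _
        simp only [hw, hu]
  -- membership of the vertices in a line not passing through the double point
  have hline : ∀ m : MvPolynomial (Fin 2) ℂ, m.IsHomogeneous 1 → ∀ ε : ℂ, ε ≠ 0 →
      ¬ (v 0).1.LiesOn (ε • lineForm ℓ m) ∧
      ∀ u : Fin 4, (v u.succ).1.LiesOn (ε • lineForm ℓ m) ↔
        (tablePos n u).2 < (M.lineContact m (σ (tablePos n u).1)).toNat := by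
    intro m hm ε hε
    constructor
    · rw [liesOn_smul_iff hε, hv0]
      exact not_liesOn_lineForm hℓ hm
    · intro u
      rw [liesOn_smul_iff hε, hvs, ← M.succ_le_lineContact_iff]
      exact (hb _).liesOn_lineForm_iff m hm _ (hj u)
  have hcard : ∀ f : OnePoint ℂ → ℕ,
      (Finset.univ.filter fun u : Fin 4 => (tablePos n u).2 < f (σ (tablePos n u).1)).card ≤
        (S.map f).sum := by
    intro f
    rw [← List.sum_toFinset _ hS]
    have := Finset.card_le_card_of_injOn
      (s := Finset.univ.filter fun u : Fin 4 => (tablePos n u).2 < f (σ (tablePos n u).1))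
      (t := S.toFinset.sigma fun s => Finset.range (f s))
      (fun u => ⟨σ (tablePos n u).1, (tablePos n u).2⟩)
      (fun u hu => by
        simp only [Finset.coe_filter, Finset.mem_univ, true_and, Set.mem_ofPred_eq] at hu
        simp only [Finset.coe_sigma, Set.mem_sigma_iff, Finset.mem_coe, List.mem_toFinset,
          Finset.mem_range]
        exact ⟨hσmem _ (hi u), hu⟩)
      (fun u _ u' _ h => by
        simp only [Sigma.mk.injEq, heq_eq_eq] at h
        exact hpos_inj u u' h.1 h.2)
    simpa [Finset.card_sigma] using this
  have himage : ∀ (T : Set (Fin 5)) (l : MvPolynomial (Fin 3) ℂ),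
      v '' T = {P | P.1.LiesOn l} ↔ T = {x | (v x).1.LiesOn l} := by
    intro T l
    rw [show {x | (v x).1.LiesOn l} = v ⁻¹' {P | P.1.LiesOn l} from rfl]
    constructor
    · intro h
      rw [← h, Set.preimage_image_eq _ hv.1]
    · rintro rfl
      exact Set.image_preimage_eq _ hv.2
  refine EnrichedGraph.isomorphic_of_bijective v hv (fun x y => ?_) (fun x => ?_) (fun T => ?_)
  · change (v x).1.Proximate (v y).1 ↔ (x, y) ∈ tableArrows n
    induction x using Fin.cases with
    | zero => exact iff_of_false (not_proximate_nil p _) (not_mem_tableArrows n y)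
    | succ u =>
      induction y using Fin.cases with
      | zero =>
        rw [hvs, hv0, mem_tableArrows_zero_iff, hchain]
        exact ((hb _).proximate_base_iff _ (hj u)).trans M.succ_le_excContact_iff
      | succ u' =>
        rw [hvs, hvs, mem_tableArrows_succ_iff]
        constructor
        · intro h
          have h1 : σ (tablePos n u).1 = σ (tablePos n u').1 :=
            IsOver.of_proximate h (hwover u) (hwover u')
          refine ⟨hσinj _ (hi u) _ (hi u') h1, ?_⟩
          simp only [hw, ← h1] at h
          exact ((hb _).proximate_iff _ _).1 h
        · rintro ⟨h1, h2⟩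
          simp only [hw, h1]
          exact ((hb _).proximate_iff _ _).2 h2
  · change (v x).1.mult φ.net = ![2, 1, 1, 1, 1] x
    induction x using Fin.cases with
    | zero => exact hpmult
    | succ u =>
      rw [hvs, hwmult]
      fin_cases u <;> rfl
  · have hlines : ∀ l : MvPolynomial (Fin 3) ℂ, l.IsHomogeneous 1 → l ≠ 0 → ∀ T : Set (Fin 5),
        T = {x | (v x).1.LiesOn l} → 3 ≤ T.encard → ∃ (ε : ℂ) (m : MvPolynomial (Fin 2) ℂ),
          ε ≠ 0 ∧ m.IsHomogeneous 1 ∧ l = ε • lineForm ℓ m ∧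
          3 ≤ (S.map fun s => (M.lineContact m s).toNat).sum := by
      intro l hl hl0 T hT h3
      rcases hℓ.linear_form_cases hl hl0 with ⟨β, δ, h0, rfl⟩ | ⟨ε, m, hε, hm, rfl⟩
      · exfalso
        have hone : ∀ u u' : Fin 4, u.succ ∈ T → u'.succ ∈ T → u = u' := by
          intro u u' hu hu'
          rw [hT] at hu hu'
          obtain ⟨e1, e2⟩ := (hb _).liesOn_fibre β δ h0 _ (hj u) hu
          obtain ⟨e1', e2'⟩ := (hb _).liesOn_fibre β δ h0 _ (hj u') hu'
          exact hpos_inj u u' (dir_eq_of_dirVec h0 e2 e2') (e1.trans e1'.symm)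
        by_cases hex : ∃ u : Fin 4, u.succ ∈ T
        · obtain ⟨u, hu⟩ := hex
          have hsub : T ⊆ {0, u.succ} := by
            intro x hx
            induction x using Fin.cases with
            | zero => simp
            | succ u' => rw [hone u' u hx hu]; simp
          have := h3.trans ((Set.encard_le_encard hsub).trans (Set.encard_insert_le _ _))
          rw [Set.encard_singleton] at this
          exact absurd this (by decide)
        · have hsub : T ⊆ {0} := by
            intro x hx
            induction x using Fin.cases with
            | zero => simp
            | succ u' => exact absurd ⟨u', hx⟩ hex
          have := h3.trans (Set.encard_le_encard hsub)
          rw [Set.encard_singleton] at this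
          exact absurd this (by decide)
      · refine ⟨ε, m, hε, hm, rfl, le_trans ?_ (hcard _)⟩
        obtain ⟨h0, hs⟩ := hline m hm ε hε
        have hsub : T ⊆ (((Finset.univ.filter fun u : Fin 4 => (tablePos n u).2 <
            (M.lineContact m (σ (tablePos n u).1)).toNat).image Fin.succ : Finset (Fin 5)) :
            Set (Fin 5)) := by
          intro x hx
          rw [hT] at hx
          induction x using Fin.cases with
          | zero => exact absurd hx h0
          | succ u =>
            simp only [Finset.coe_image, Set.mem_image, Finset.mem_coe, Finset.mem_filter,
              Finset.mem_univ, true_and]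
            exact ⟨u, (hs u).1 hx, rfl⟩
        have := h3.trans (Set.encard_le_encard hsub)
        rw [Set.encard_coe_eq_coe_finsetCard] at this
        exact (by exact_mod_cast this : 3 ≤ _).trans Finset.card_image_le
    change (∃ l : MvPolynomial (Fin 3) ℂ, l.IsHomogeneous 1 ∧ l ≠ 0 ∧
      v '' T = {P | P.1.LiesOn l} ∧ 3 ≤ (v '' T).encard) ↔ ∃ T' ∈ tableLines n, T = (T' : Set _)
    simp only [himage, hv.1.encard_image]
    rcases hL with ⟨m, hm, h3, hLm⟩ | ⟨hL0, hno⟩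
    · have hLm' : ∀ i < S.length, L (σ i) = (M.lineContact m (σ i)).toNat := fun i hi =>
        hLm _ (hσmem i hi)
      have hne : ¬ ∀ x ∈ chainTable n, x.2.2 = 0 := by
        intro h
        rw [← hD] at h
        have : (S.map L).sum = 0 := by
          rw [List.sum_eq_zero]
          intro y hy
          obtain ⟨s, hs, rfl⟩ := List.mem_map.1 hy
          exact h _ (List.mem_map.2 ⟨s, hs, rfl⟩)
        omega
      obtain ⟨T₀, hT₀, hc3, h0T, hsT, -⟩ := exists_tableLines_eq n hne
      have hT₀' : (T₀ : Set (Fin 5)) = {x | (v x).1.LiesOn (lineForm ℓ m)} := by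
        obtain ⟨h0, hs⟩ := hline m hm 1 one_ne_zero
        rw [one_smul] at h0 hs
        ext x
        induction x using Fin.cases with
        | zero => exact iff_of_false h0T h0
        | succ u =>
          rw [Finset.mem_coe, hsT, Set.mem_ofPred_eq, hs, hchain, ← hLm' _ (hi u)]
          rfl
      constructor
      · rintro ⟨l, hl, hl0, hT, h3'⟩
        obtain ⟨ε, m', hε, hm', rfl, hsum'⟩ := hlines l hl hl0 T hT h3'
        have hmm : m' = m := by
          have hconv : ∀ k : MvPolynomial (Fin 2) ℂ,
              3 ≤ (S.map fun s => (M.lineContact k s).toNat).sum →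
              3 ≤ ∑ s ∈ S.toFinset, M.lineContact k s := by
            intro k hk
            rw [← List.sum_toFinset _ hS] at hk
            rw [← Finset.sum_congr rfl fun s _ => M.coe_toNat_lineContact k s]
            exact_mod_cast hk
          refine M.eq_of_three_le_sum_lineContact hm' hm (hconv _ hsum') (hconv _ ?_)
          rwa [← List.map_congr_left hLm]
        subst hmm
        refine ⟨T₀, by rw [hT₀]; simp, hT.trans ?_⟩
        rw [hT₀']
        ext x
        exact liesOn_smul_iff hε _ _
      · rintro ⟨T', hT', rfl⟩
        rw [hT₀, List.mem_singleton] at hT'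
        subst hT'
        refine ⟨lineForm ℓ m, hℓ.isHomogeneous_lineForm hm, ?_, hT₀', ?_⟩
        · intro h
          have := hℓ.aeval_rep_lineForm hm
          rw [h, map_zero] at this
          exact this rfl
        · rw [Set.encard_coe_eq_coe_finsetCard, hc3]; rfl
    · rw [tableLines_eq_nil n]
      · refine iff_of_false ?_ (by simp)
        rintro ⟨l, hl, hl0, hT, h3'⟩
        obtain ⟨ε, m, -, hm, -, h⟩ := hlines l hl hl0 T hT h3'
        exact hno m hm h
      · rw [← hD]
        intro x hx
        obtain ⟨s, hs, rfl⟩ := List.mem_map.1 hx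
        exact hL0 s hs

/-! ### The possible chains -/

/-- The numerical possibilities `(k, e, l)` for a chain of `k` points, of which `e` are proximate to
the double point and `l` lie on the line through three simple base points.  One of `e` and `l` is
zero, as such a line does not pass through the double point. -/
def chainChoices (k : ℕ) : List (ℕ × ℕ × ℕ) :=
  (List.range (min k 2 + 1)).map (fun e => (k, e, 0)) ++
    (List.range (min k 3)).map fun l => (k, 0, l + 1)

/-- The lists of at most `f` possible chains, with `K` points altogether if `K ≤ f`. -/
def chainLists : ℕ → ℕ → List (List (ℕ × ℕ × ℕ))
  | 0, _ => [[]]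
  | f + 1, K => [] :: (List.range K).flatMap fun j =>
      (chainChoices (j + 1)).flatMap fun x => (chainLists f (K - (j + 1))).map (x :: ·)

theorem mem_chainChoices {k e l : ℕ} (hek : e ≤ k) (he : e ≤ 2) (hlk : l ≤ k) (hl : l ≤ 3)
    (h : 0 < l → e = 0) : (k, e, l) ∈ chainChoices k := by
  rw [chainChoices, List.mem_append, List.mem_map, List.mem_map]
  rcases Nat.eq_zero_or_pos l with rfl | h0
  · exact Or.inl ⟨e, by rw [List.mem_range]; omega, rfl⟩
  · refine Or.inr ⟨l - 1, by rw [List.mem_range]; omega, ?_⟩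
    rw [h h0, Nat.sub_add_cancel h0]

theorem mem_chainLists : ∀ (f : ℕ) (D : List (ℕ × ℕ × ℕ)), D.length ≤ f →
    (∀ x ∈ D, 0 < x.1 ∧ x ∈ chainChoices x.1) → D ∈ chainLists f (D.map fun x => x.1).sum := by
  intro f
  induction f with
  | zero =>
    intro D hD _
    rw [List.length_eq_zero_iff.1 (Nat.le_zero.1 hD)]
    simp [chainLists]
  | succ f ih =>
    intro D hD h
    rcases D with _ | ⟨x, D⟩
    · simp [chainLists]
    · rw [chainLists]
      refine List.mem_cons_of_mem _ ?_
      obtain ⟨h0, hx⟩ := h x List.mem_cons_self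
      have hD' : D.length ≤ f := by simpa using hD
      have := ih D hD' fun y hy => h y (List.mem_cons_of_mem _ hy)
      simp only [List.map_cons, List.sum_cons]
      rw [List.mem_flatMap]
      refine ⟨x.1 - 1, by rw [List.mem_range]; omega, ?_⟩
      rw [Nat.sub_add_cancel h0, Nat.add_sub_cancel_left]
      exact List.mem_flatMap.2 ⟨x, hx, List.mem_map.2 ⟨D, this, rfl⟩⟩

theorem exists_isPerm_chainTable : ∀ D ∈ chainLists 4 4, (D.map fun x => x.1).sum = 4 →
    (D.map fun x => x.2.1).sum ≤ 2 →
    (D.map fun x => x.2.2).sum = 3 ∨ (D.map fun x => x.2.2).sum = 0 →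
    ∃ n, D.isPerm (chainTable n) = true := by
  decide +kernel

namespace JonqMatrix

variable (M : JonqMatrix)

theorem exists_isLineData (S : List (OnePoint ℂ)) : ∃ L, M.IsLineData S L := by
  by_cases h : ∃ m : MvPolynomial (Fin 2) ℂ, m.IsHomogeneous 1 ∧
      3 ≤ (S.map fun s => (M.lineContact m s).toNat).sum
  · obtain ⟨m, hm, h3⟩ := h
    exact ⟨fun s => (M.lineContact m s).toNat, Or.inl ⟨m, hm, h3, fun _ _ => rfl⟩⟩
  · push Not at h
    exact ⟨fun _ => 0, Or.inr ⟨fun _ _ => rfl, fun m hm => not_le.2 (h m hm)⟩⟩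

theorem sum_toNat_excContact_le {S : List (OnePoint ℂ)} (hS : S.Nodup) :
    (S.map fun s => (M.excContact s).toNat).sum ≤ 2 := by
  classical
  rw [← List.sum_toFinset _ hS]
  have := M.sum_excContact_le S.toFinset
  rw [← Finset.sum_congr rfl fun s _ => M.coe_toNat_excContact s] at this
  exact_mod_cast this

theorem sum_toNat_lineContact_le {S : List (OnePoint ℂ)} (hS : S.Nodup)
    {m : MvPolynomial (Fin 2) ℂ} (hm : m.IsHomogeneous 1) :
    (S.map fun s => (M.lineContact m s).toNat).sum ≤ 3 := by
  classical
  rw [← List.sum_toFinset _ hS]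
  have := M.sum_lineContact_le hm S.toFinset
  rw [← Finset.sum_congr rfl fun s _ => M.coe_toNat_lineContact m s] at this
  exact_mod_cast this

theorem IsLineData.le_and_eq {S : List (OnePoint ℂ)} {L : OnePoint ℂ → ℕ}
    (hL : M.IsLineData S L) (hS : S.Nodup) :
    (∀ s ∈ S, L s ≤ M.chainLength s ∧ (0 < L s → (M.excContact s).toNat = 0)) ∧
      ((S.map L).sum = 3 ∨ (S.map L).sum = 0) := by
  rcases hL with ⟨m, hm, h3, hLm⟩ | ⟨h0, -⟩
  · refine ⟨fun s hs => ?_, Or.inl (le_antisymm ?_ h3)⟩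
    · rw [hLm s hs]
      constructor
      · have := M.lineContact_le m s
        rw [← coe_toNat_lineContact] at this
        exact_mod_cast this
      · intro h
        by_contra he
        have he' : 0 < M.excContact s := by
          rw [← coe_toNat_excContact]; exact_mod_cast Nat.pos_of_ne_zero he
        rw [M.lineContact_eq_zero he'] at h
        exact absurd h (by simp)
    · rw [List.map_congr_left hLm]
      exact M.sum_toNat_lineContact_le hS hm
  · refine ⟨fun s hs => ?_, Or.inr ?_⟩
    · rw [h0 s hs]; exact ⟨Nat.zero_le _, fun h => absurd h (lt_irrefl 0)⟩
    · rw [List.sum_eq_zero]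
      intro x hx
      obtain ⟨s, hs, rfl⟩ := List.mem_map.1 hx
      exact h0 s hs

/-- The numerical data of the chains of a net are those of a graph of the table, up to the order of
the chains. -/
theorem exists_chainData_eq : ∃ (n : Fin 31) (S : List (OnePoint ℂ)) (L : OnePoint ℂ → ℕ),
    S.Nodup ∧ M.IsLineData S L ∧ S.map (M.chainData L) = chainTable n := by
  classical
  obtain ⟨R, hR, hmem⟩ := exists_sum_ordAt_eq M.isHomogeneous_det M.det_ne_zero
  simp only [← coe_chainLength] at hR hmem
  norm_cast at hR
  obtain ⟨L, hL⟩ := M.exists_isLineData R.toList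
  have hS : R.toList.Nodup := R.nodup_toList
  obtain ⟨hle, hsum⟩ := hL.le_and_eq M hS
  have hk : (R.toList.map M.chainLength).sum = 4 := by
    rw [Finset.sum_map_toList]; exact hR
  have he := M.sum_toNat_excContact_le hS
  have hlen : R.toList.length ≤ 4 := by
    rw [← hk, ← List.length_map (f := M.chainLength)]
    apply List.length_le_sum_of_one_le
    intro x hx
    obtain ⟨s, hs, rfl⟩ := List.mem_map.1 hx
    have := (hmem s).1 (Finset.mem_toList.1 hs)
    exact_mod_cast this
  have hfst : ((R.toList.map (M.chainData L)).map fun x => x.1).sum = 4 := by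
    rw [List.map_map]; exact hk
  have hsnd : ((R.toList.map (M.chainData L)).map fun x => x.2.1).sum ≤ 2 := by
    rw [List.map_map]; exact he
  have hthd : ((R.toList.map (M.chainData L)).map fun x => x.2.2).sum = 3 ∨
      ((R.toList.map (M.chainData L)).map fun x => x.2.2).sum = 0 := by
    rw [List.map_map]; exact hsum
  have hin := mem_chainLists 4 (R.toList.map (M.chainData L)) (by rwa [List.length_map]) (by
    intro x hx
    obtain ⟨s, hs, rfl⟩ := List.mem_map.1 hx
    have h1 := (hmem s).1 (Finset.mem_toList.1 hs)
    refine ⟨by exact_mod_cast h1, mem_chainChoices ?_ ?_ (hle s hs).1 ?_ (hle s hs).2⟩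
    · have := M.excContact_le s
      rw [← coe_toNat_excContact] at this
      exact_mod_cast this
    · exact (List.single_le_sum (fun _ _ => Nat.zero_le _) _
        (List.mem_map.2 ⟨s, hs, rfl⟩)).trans he
    · exact (List.single_le_sum (fun _ _ => Nat.zero_le _) _
        (List.mem_map.2 ⟨s, hs, rfl⟩)).trans (by omega : (R.toList.map L).sum ≤ 3))
  rw [hfst] at hin
  obtain ⟨n, hn⟩ := exists_isPerm_chainTable _ hin hfst hsnd hthd
  have hperm := List.isPerm_iff.1 hn
  have hrel := (congrFun₂ (List.eq_map_comp_perm (M.chainData L)) _ _).mpr hperm.symm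
  obtain ⟨S, hSn, hSR⟩ := hrel
  have hRS := hSR.symm
  refine ⟨n, S, L, hRS.nodup_iff.1 hS, ?_, hSn.symm⟩
  have hs : ∀ f : OnePoint ℂ → ℕ, (S.map f).sum = (R.toList.map f).sum := fun f =>
    ((hRS.map f).sum_eq).symm
  rcases hL with ⟨m, hm, h3, hLm⟩ | ⟨h0, hno⟩
  · exact Or.inl ⟨m, hm, by rwa [hs], fun s h => hLm s (hRS.mem_iff.2 h)⟩
  · exact Or.inr ⟨fun s h => h0 s (hRS.mem_iff.2 h), fun m hm => by rw [hs]; exact hno m hm⟩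

end JonqMatrix

/-- If the net of a cubic Cremona map is, in suitable coordinates, spanned by `F, x G, y G`, then
its enriched weighted proximity graph is in the table. -/
theorem PlaneCremonaMap.exists_isomorphic_tableGraph {φ : PlaneCremonaMap} {M : JonqMatrix}
    {p : Projectivization ℂ (Fin 3 → ℂ)} {ℓ : Fin 3 → MvPolynomial (Fin 3) ℂ} (hℓ : IsFrame p ℓ)
    (hnet : φ.net = M.netIn ℓ) : ∃ n, φ.enrichedGraph.Isomorphic (tableGraph n) := by
  obtain ⟨n, S, L, hS, hL, hD⟩ := M.exists_chainData_eq
  exact ⟨n, φ.isomorphic_tableGraph hℓ hnet hS hL hD⟩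

/-! ### The graphs of the table are pairwise non-isomorphic -/

/-- The arrow relation of the table as a Boolean function. -/
def tableArrowB (n : Fin 31) (u v : Fin 5) : Bool := (tableArrows n).contains (u, v)

/-- The numbers of vertices standing in various relations to a given vertex of the table: the
targets and the sources of its arrows, the sources of paths of length two ending in it, and the
vertices collinear with it; together with its weight. -/
def tableSignature (n : Fin 31) (v : Fin 5) : List ℕ :=
  [(List.finRange 5).countP fun w => tableArrowB n v w,
    (List.finRange 5).countP fun w => tableArrowB n w v,
    (List.finRange 5).countP fun w => (List.finRange 5).any fun u =>
      tableArrowB n w u && tableArrowB n u v,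
    (List.finRange 5).countP fun w => (tableLines n).any fun T => decide (v ∈ T) && decide (w ∈ T),
    ![2, 1, 1, 1, 1] v]

/-- The signatures of the vertices distinguish the graphs of the table. -/
theorem eq_of_tableSignature_perm : ∀ m n,
    ((List.finRange 5).map (tableSignature m)).isPerm ((List.finRange 5).map (tableSignature n)) =
      true → m = n := by
  decide +kernel

theorem map_finRange_perm {k : ℕ} (e : Fin k ≃ Fin k) :
    ((List.finRange k).map e).Perm (List.finRange k) := by
  rw [List.perm_ext_iff_of_nodup ((List.nodup_finRange k).map e.injective)
    (List.nodup_finRange k)]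
  intro a
  simpa using ⟨e.symm a, e.apply_symm_apply a⟩

theorem countP_finRange_equiv {k : ℕ} (e : Fin k ≃ Fin k) {f g : Fin k → Bool}
    (h : ∀ w, f w = g (e w)) : (List.finRange k).countP f = (List.finRange k).countP g := by
  obtain rfl : f = g ∘ e := _root_.funext h
  rw [← List.countP_map]
  exact (map_finRange_perm e).countP_eq _

theorem eq_of_tableGraph_isomorphic {m n : Fin 31}
    (h : (tableGraph m).Isomorphic (tableGraph n)) : m = n := by
  obtain ⟨e, harrow, hweight, hlines⟩ := h
  have hA : ∀ u v, tableArrowB m u v = tableArrowB n (e u) (e v) := by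
    intro u v
    rw [Bool.eq_iff_iff, tableArrowB, tableArrowB, List.contains_iff_mem, List.contains_iff_mem]
    exact harrow u v
  have hL : ∀ v w, (∃ T ∈ tableLines m, v ∈ T ∧ w ∈ T) ↔
      ∃ T ∈ tableLines n, e v ∈ T ∧ e w ∈ T := by
    intro v w
    constructor
    · rintro ⟨T, hT, hv, hw⟩
      obtain ⟨T', hT', h⟩ := (hlines T).1 ⟨T, hT, rfl⟩
      refine ⟨T', hT', ?_, ?_⟩ <;> rw [← Finset.mem_coe, ← h]
      · exact ⟨v, hv, rfl⟩
      · exact ⟨w, hw, rfl⟩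
    · rintro ⟨T, hT, hv, hw⟩
      obtain ⟨T', hT', h⟩ := (hlines (e ⁻¹' T)).2 ⟨T, hT, Set.image_preimage_eq _ e.surjective⟩
      refine ⟨T', hT', ?_, ?_⟩ <;> rw [← Finset.mem_coe, ← h]
      · exact hv
      · exact hw
  have hsig : ∀ v, tableSignature m v = tableSignature n (e v) := by
    intro v
    rw [tableSignature, tableSignature]
    congr 1
    · exact countP_finRange_equiv e fun w => hA v w
    congr 1
    · exact countP_finRange_equiv e fun w => hA w v
    congr 1
    · refine countP_finRange_equiv e fun w => ?_
      rw [Bool.eq_iff_iff]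
      simp only [List.any_eq_true, List.mem_finRange, true_and, Bool.and_eq_true, hA]
      exact e.exists_congr_left.trans (by simp)
    congr 1
    · refine countP_finRange_equiv e fun w => ?_
      rw [Bool.eq_iff_iff]
      simpa only [List.any_eq_true, Bool.and_eq_true, decide_eq_true_eq] using hL v w
    congr 1
    exact hweight v
  apply eq_of_tableSignature_perm
  rw [List.isPerm_iff]
  have := (map_finRange_perm e).map (tableSignature n)
  rw [List.map_map] at this
  rwa [show tableSignature n ∘ e = tableSignature m from funext fun v => (hsig v).symm] at this

/-! ### The Cremona map of a net -/

theorem irreducible_of_isHomogeneous_one {σ : Type*} {l : MvPolynomial σ ℂ}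
    (hl : l.IsHomogeneous 1) (h0 : l ≠ 0) : Irreducible l := by
  refine irreducible_of_totalDegree_eq_one (hl.totalDegree h0) fun x hx => ?_
  rw [isUnit_iff_ne_zero]
  rintro rfl
  exact h0 (MvPolynomial.ext _ _ fun i => by rw [coeff_zero]; exact zero_dvd_iff.1 (hx i))

/-- A polynomial in two variables as a polynomial in three variables that does not involve the last
one. -/
noncomputable def planeForm : MvPolynomial (Fin 2) ℂ →ₐ[ℂ] MvPolynomial (Fin 3) ℂ :=
  aeval ![X 0, X 1]

theorem aeval_planeForm {R : Type} [CommRing R] [Algebra ℂ R] (x : Fin 3 → R)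
    (H : MvPolynomial (Fin 2) ℂ) : aeval x (planeForm H) = aeval ![x 0, x 1] H := by
  rw [planeForm, map_aeval_pair, aeval_X, aeval_X]

theorem aeval_X_pair (H : MvPolynomial (Fin 2) ℂ) : aeval ![X 0, X 1] H = H := by
  rw [show (![X 0, X 1] : Fin 2 → MvPolynomial (Fin 2) ℂ) = X by ext i; fin_cases i <;> rfl,
    aeval_X_left, AlgHom.id_apply]

namespace JonqMatrix

variable (M : JonqMatrix)

theorem rowForm_X (u v : MvPolynomial (Fin 2) ℂ) :
    rowForm u v (X : Fin 3 → MvPolynomial (Fin 3) ℂ) = planeForm u * X 2 + planeForm v := rfl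

theorem planeForm_injective : Function.Injective planeForm := by
  intro H K h
  have := congrArg (aeval ![X 0, X 1, (0 : MvPolynomial (Fin 2) ℂ)]) h
  rwa [aeval_planeForm, aeval_planeForm, Matrix.cons_val_zero, Matrix.cons_val_one,
    Matrix.cons_val_zero, aeval_X_pair, aeval_X_pair] at this

theorem planeForm_det : planeForm M.det = planeForm M.a * planeForm M.d -
    planeForm M.b * planeForm M.c := by rw [det, map_sub, map_mul, map_mul]

theorem isUnit_of_dvd_rowForm {h : MvPolynomial (Fin 3) ℂ}
    (hF : h ∣ rowForm M.a M.b X) (hxG : h ∣ X 0 * rowForm M.c M.d X)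
    (hyG : h ∣ X 1 * rowForm M.c M.d X) : IsUnit h := by
  by_contra hu
  rw [rowForm_X] at hF hxG hyG
  have hdet : planeForm M.det ≠ 0 := fun h0 =>
    M.det_ne_zero (planeForm_injective (h0.trans (map_zero _).symm))
  have e : planeForm M.det = planeForm M.a * (planeForm M.c * X 2 + planeForm M.d) -
      planeForm M.c * (planeForm M.a * X 2 + planeForm M.b) := by
    rw [planeForm_det]; ring
  have h0 : h ≠ 0 := by
    rintro rfl
    have h1 := zero_dvd_iff.1 hF
    have h2 := (mul_eq_zero.1 (zero_dvd_iff.1 hxG)).resolve_left (X_ne_zero 0)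
    rw [h1, h2] at e
    exact hdet (by rw [e]; ring)
  obtain ⟨π, hπ, hπh⟩ := WfDvdMonoid.exists_irreducible_factor hu h0
  have hp : Prime π := hπ.prime
  have hF' := hπh.trans hF
  have hG' : π ∣ planeForm M.c * X 2 + planeForm M.d := by
    rcases hp.dvd_or_dvd (hπh.trans hxG) with h1 | h1
    · rcases hp.dvd_or_dvd (hπh.trans hyG) with h2 | h2
      · exfalso
        have hX : ∀ i : Fin 3, Irreducible (X i : MvPolynomial (Fin 3) ℂ) := fun i =>
          irreducible_of_isHomogeneous_one (isHomogeneous_X _ _) (X_ne_zero i)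
        have h3 := ((hπ.dvd_irreducible_iff_associated (hX 0)).1 h1).symm.trans
          ((hπ.dvd_irreducible_iff_associated (hX 1)).1 h2)
        have h4 := map_dvd (aeval (![0, 1, 0] : Fin 3 → ℂ)) h3.dvd
        simp at h4
      · exact h2
    · exact h1
  have hπdet : π ∣ planeForm M.det := by
    rw [e]; exact dvd_sub (hG'.mul_left _) (hF'.mul_left _)
  obtain ⟨R, a, ha, -, hR⟩ := exists_eq_prod_dirForm M.isHomogeneous_det M.det_ne_zero
  rw [hR, map_mul, map_multiset_prod, Multiset.map_map] at hπdet
  have hπa : ¬ π ∣ planeForm (C a) := by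
    intro h1
    refine hπ.not_isUnit (isUnit_of_dvd_unit h1 ?_)
    rw [planeForm, aeval_C]
    exact (isUnit_iff_ne_zero.2 ha).map _
  obtain ⟨s, -, hs⟩ : ∃ s ∈ R, π ∣ planeForm (dirForm s) := by
    obtain ⟨q, hq, hπq⟩ := hp.exists_mem_multiset_dvd ((hp.dvd_or_dvd hπdet).resolve_left hπa)
    obtain ⟨s, hs, rfl⟩ := Multiset.mem_map.1 hq
    exact ⟨s, hs, hπq⟩
  have hirr : Irreducible (planeForm (dirForm s)) := by
    apply irreducible_of_isHomogeneous_one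
    · have := (isHomogeneous_dirForm s).aeval (n := 1)
        (![X 0, X 1] : Fin 2 → MvPolynomial (Fin 3) ℂ) (fun i => by
          fin_cases i <;> exact isHomogeneous_X _ _)
      rwa [one_mul] at this
    · exact fun h0 => dirForm_ne_zero s (planeForm_injective (h0.trans (map_zero _).symm))
  have hassoc := ((hπ.dvd_irreducible_iff_associated hirr).1 hs).symm.dvd
  have hval : ∀ u v : MvPolynomial (Fin 2) ℂ, π ∣ planeForm u * X 2 + planeForm v →
      valAt s u = 0 ∧ valAt s v = 0 := by
    intro u v h1
    have h2 : ∀ t : ℂ, valAt s u * t + valAt s v = 0 := by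
      intro t
      have h3 := map_dvd (aeval ![dirVec s 0, dirVec s 1, t]) (hassoc.trans h1)
      rw [map_add, map_mul, aeval_planeForm, aeval_planeForm, aeval_planeForm, aeval_X] at h3
      simp only [Matrix.cons_val_zero, Matrix.cons_val_one, Matrix.cons_val, ← valAt_eq] at h3
      have : valAt s (dirForm s) = 0 := by
        rw [← ordAt_pos_iff, ordAt_dirForm, if_pos rfl]; norm_num
      rw [this] at h3
      exact zero_dvd_iff.1 h3
    have h0 := h2 0
    have h1 := h2 1
    rw [mul_zero, zero_add] at h0
    rw [mul_one, h0, add_zero] at h1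
    exact ⟨h1, h0⟩
  apply M.ne_zero_at s
  simp only [ordAt_pos_iff]
  exact ⟨(hval _ _ hF').1, (hval _ _ hF').2, (hval _ _ hG').1, (hval _ _ hG').2⟩

theorem a_or_c_ne_zero : ¬ (M.a = 0 ∧ M.c = 0) := by
  rintro ⟨h, h'⟩
  exact M.det_ne_zero (by rw [h, h']; ring)

theorem c_or_d_ne_zero : ¬ (M.c = 0 ∧ M.d = 0) := by
  rintro ⟨h, h'⟩
  exact M.det_ne_zero (by rw [h, h']; ring)

/-- The forms `F, x G, y G`. -/
noncomputable def forms : Fin 3 → MvPolynomial (Fin 3) ℂ :=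
  ![rowForm M.a M.b X, X 0 * rowForm M.c M.d X, X 1 * rowForm M.c M.d X]

theorem aeval_pair_mul {R : Type} [CommRing R] [Algebra ℂ R] {H : MvPolynomial (Fin 2) ℂ} {n : ℕ}
    (hH : H.IsHomogeneous n) (x y t : R) :
    aeval ![x * t, y * t] H = t ^ n * aeval ![x, y] H := by
  rw [← aeval_mul_left_of_isHomogeneous hH]
  congr 2
  ext i; fin_cases i <;> simp [mul_comm]

/-- The inverse map, obtained from the equations `[x : y] = [u₁ : u₂]` and
`(a z + b) = u₀ (c z + d)`. -/
theorem exists_inverse_forms : ∃ (e : ℕ) (g : Fin 3 → MvPolynomial (Fin 3) ℂ)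
    (h h' : MvPolynomial (Fin 3) ℂ), (∀ i, (g i).IsHomogeneous e) ∧ h ≠ 0 ∧ h' ≠ 0 ∧
      (∀ i, aeval g (M.forms i) = h * X i) ∧ (∀ i, aeval M.forms (g i) = h' * X i) := by
  set P : MvPolynomial (Fin 2) ℂ →ₐ[ℂ] MvPolynomial (Fin 3) ℂ := aeval ![X 1, X 2] with hP
  have hPhom : ∀ {H : MvPolynomial (Fin 2) ℂ} {n : ℕ}, H.IsHomogeneous n →
      (P H).IsHomogeneous n := by
    intro H n hH
    have := hH.aeval (n := 1) (![X 1, X 2] : Fin 2 → MvPolynomial (Fin 3) ℂ) (fun i => by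
      fin_cases i <;> exact isHomogeneous_X _ _)
    rwa [one_mul] at this
  have hPback : ∀ (t : MvPolynomial (Fin 2) ℂ) H, aeval ![t, X 0, X 1] (P H) = H := by
    intro t H
    rw [hP, map_aeval_pair, aeval_X, aeval_X]
    simpa using aeval_X_pair H
  set D := P M.a - X 0 * P M.c with hD
  set N := X 0 * P M.d - P M.b with hN
  set G := rowForm M.c M.d (X : Fin 3 → MvPolynomial (Fin 3) ℂ) with hG
  set F := rowForm M.a M.b (X : Fin 3 → MvPolynomial (Fin 3) ℂ) with hF
  have hD0 : D ≠ 0 := by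
    intro h
    have h0 := congrArg (aeval ![0, X 0, (X 1 : MvPolynomial (Fin 2) ℂ)]) h
    have h1 := congrArg (aeval ![1, X 0, (X 1 : MvPolynomial (Fin 2) ℂ)]) h
    rw [hD, map_sub, map_mul, hPback, hPback, aeval_X, map_zero] at h0 h1
    simp only [Matrix.cons_val_zero, zero_mul, sub_zero, one_mul] at h0 h1
    exact M.a_or_c_ne_zero ⟨h0, by rw [h0] at h1; simpa using h1⟩
  have hG0 : G ≠ 0 := by
    intro h
    have h0 := congrArg (aeval ![X 0, X 1, (0 : MvPolynomial (Fin 2) ℂ)]) h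
    have h1 := congrArg (aeval ![X 0, X 1, (1 : MvPolynomial (Fin 2) ℂ)]) h
    rw [hG, rowForm_X, map_add, map_mul, aeval_planeForm, aeval_planeForm, aeval_X, map_zero]
      at h0 h1
    simp only [Matrix.cons_val_zero, Matrix.cons_val_one, Matrix.cons_val, mul_zero, zero_add,
      mul_one, aeval_X_pair] at h0 h1
    exact M.c_or_d_ne_zero ⟨by rw [h0] at h1; simpa using h1, h0⟩
  have hPdet : P M.det ≠ 0 := by
    intro h
    have := congrArg (aeval ![0, X 0, (X 1 : MvPolynomial (Fin 2) ℂ)]) h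
    rw [hPback, map_zero] at this
    exact M.det_ne_zero this
  have hdet : planeForm M.det ≠ 0 := fun h0 =>
    M.det_ne_zero (planeForm_injective (h0.trans (map_zero _).symm))
  have ePdet : P M.det = P M.a * P M.d - P M.b * P M.c := by rw [det, map_sub, map_mul, map_mul]
  refine ⟨3, ![X 1 * D, X 2 * D, N], D ^ 2 * P M.det, G ^ 2 * planeForm M.det, ?_,
    mul_ne_zero (pow_ne_zero _ hD0) hPdet, mul_ne_zero (pow_ne_zero _ hG0) hdet, ?_, ?_⟩
  · have h1 : D.IsHomogeneous 2 := (hPhom M.ha).sub ((isHomogeneous_X _ _).mul (hPhom M.hc))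
    intro i; fin_cases i
    · exact (isHomogeneous_X _ _).mul h1
    · exact (isHomogeneous_X _ _).mul h1
    · exact ((isHomogeneous_X _ _).mul (hPhom M.hd)).sub (hPhom M.hb)
  · have hrow : ∀ {u v : MvPolynomial (Fin 2) ℂ} {n : ℕ}, u.IsHomogeneous n →
        v.IsHomogeneous (n + 1) → aeval ![X 1 * D, X 2 * D, N] (rowForm u v (X : Fin 3 → MvPolynomial (Fin 3) ℂ)) =
          D ^ n * (P u * N + D * P v) := by
      intro u v n hu hv
      rw [rowForm_X, map_add, map_mul, aeval_planeForm, aeval_planeForm, aeval_X]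
      simp only [Matrix.cons_val_zero, Matrix.cons_val_one, Matrix.cons_val]
      rw [aeval_pair_mul hu, aeval_pair_mul hv, ← hP, pow_succ]
      ring
    intro i; fin_cases i
    · change aeval _ (rowForm M.a M.b X) = _ * X 0
      rw [hrow M.ha M.hb, ePdet, hN, hD]; ring
    · change aeval _ (X 0 * rowForm M.c M.d X) = _ * X 1
      rw [map_mul, hrow M.hc M.hd, aeval_X, ePdet, hN]
      simp only [Matrix.cons_val_zero]
      rw [hD]; ring
    · change aeval _ (X 1 * rowForm M.c M.d X) = _ * X 2
      rw [map_mul, hrow M.hc M.hd, aeval_X, ePdet, hN]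
      simp only [Matrix.cons_val_one, Matrix.cons_val_zero]
      rw [hD]; ring
  · have hPf : ∀ {H : MvPolynomial (Fin 2) ℂ} {n : ℕ}, H.IsHomogeneous n →
        aeval M.forms (P H) = G ^ n * planeForm H := by
      intro H n hH
      rw [hP, map_aeval_pair, aeval_X, aeval_X, planeForm, ← aeval_pair_mul hH]
      rfl
    have h0 : aeval M.forms (X 0 : MvPolynomial (Fin 3) ℂ) = F := aeval_X _ _
    have h1 : aeval M.forms (X 1 : MvPolynomial (Fin 3) ℂ) = X 0 * G := aeval_X _ _
    have h2 : aeval M.forms (X 2 : MvPolynomial (Fin 3) ℂ) = X 1 * G := aeval_X _ _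
    have hDf : aeval M.forms D = G * planeForm M.det := by
      rw [hD, map_sub, map_mul, hPf M.ha, hPf M.hc, h0, planeForm_det, hF, hG, rowForm_X,
        rowForm_X]
      ring
    intro i; fin_cases i
    · change aeval _ (X 1 * D) = _ * X 0
      rw [map_mul, hDf, h1]; ring
    · change aeval _ (X 2 * D) = _ * X 1
      rw [map_mul, hDf, h2]; ring
    · change aeval _ N = _ * X 2
      rw [hN, map_sub, map_mul, hPf M.hd, hPf M.hb, h0, planeForm_det, hF, hG, rowForm_X,
        rowForm_X]
      ring

/-- The Cremona map `[F : x G : y G]`. -/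
noncomputable def cremona : PlaneCremonaMap where
  degree := 3
  form := M.forms
  isHomogeneous := by
    have h1 := isHomogeneous_rowForm M.ha M.hb (ℓ := X) (isHomogeneous_X ℂ)
    have h2 := isHomogeneous_rowForm M.hc M.hd (ℓ := X) (isHomogeneous_X ℂ)
    intro i; fin_cases i
    · exact h1
    · exact (isHomogeneous_X _ _).mul h2
    · exact (isHomogeneous_X _ _).mul h2
  noCommonFactor h hh := M.isUnit_of_dvd_rowForm (hh 0) (hh 1) (hh 2)
  birational := M.exists_inverse_forms

theorem net_cremona : M.cremona.net = M.netIn X := by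
  ext g
  change g ∈ Submodule.span ℂ (Set.range M.forms) ↔ _
  rw [Submodule.mem_span_range_iff_exists_fun]
  have e : ∀ α β δ : ℂ, M.member α β δ X =
      α • M.forms 0 + β • M.forms 1 + δ • M.forms 2 := by
    intro α β δ
    simp only [member, forms, Matrix.cons_val_zero, Matrix.cons_val_one, Matrix.cons_val,
      smul_eq_C_mul]
    ring
  constructor
  · rintro ⟨c, rfl⟩
    exact ⟨c 0, c 1, c 2, by rw [e, Fin.sum_univ_three]⟩
  · rintro ⟨α, β, δ, rfl⟩
    exact ⟨![α, β, δ], by rw [e, Fin.sum_univ_three]; simp⟩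

end JonqMatrix

theorem exists_isFrame_X : ∃ p, IsFrame p X := by
  have hv : (![0, 0, 1] : Fin 3 → ℂ) ≠ 0 := fun h => by simpa using congrFun h 2
  refine ⟨Projectivization.mk ℂ _ hv, isHomogeneous_X ℂ, ?_, fun i j => if i = j then 1 else 0, ?_, ?_⟩
  · obtain ⟨a, ha⟩ := Projectivization.exists_smul_eq_mk_rep ℂ _ hv
    have hrep : ∀ i, (Projectivization.mk ℂ _ hv).rep i = (a : ℂ) * (![0, 0, 1] : Fin 3 → ℂ) i :=
      fun i => by rw [← ha]; rfl
    have h2 : (Projectivization.mk ℂ _ hv).rep 2 ≠ 0 := by rw [hrep]; simp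
    intro j
    rw [localMap_X_zero _ h2, hrep 0, hrep 1]
    fin_cases j <;> simp
  · intro i; simp [apply_ite C, ite_mul]
  · intro i; simp [apply_ite C, ite_mul]

/-- A net with suitable chains realizes a graph of the table. -/
theorem JonqMatrix.exists_cremona_isomorphic (M : JonqMatrix) {n : Fin 31}
    {S : List (OnePoint ℂ)} (hS : S.Nodup) {L : OnePoint ℂ → ℕ} (hL : M.IsLineData S L)
    (hD : S.map (M.chainData L) = chainTable n) :
    ∃ φ : PlaneCremonaMap, φ.degree = 3 ∧ φ.enrichedGraph.Isomorphic (tableGraph n) := by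
  obtain ⟨p, hp⟩ := exists_isFrame_X
  exact ⟨M.cremona, rfl, M.cremona.isomorphic_tableGraph hp M.net_cremona hS hL hD⟩

/-! ### A Cremona map for each graph of the table -/

/-- A sequence of distinct directions: `∞, 0, 1, 2, …`. -/
noncomputable def dirSeq : ℕ → OnePoint ℂ
  | 0 => OnePoint.infty
  | k + 1 => OnePoint.some (k : ℂ)

theorem dirSeq_injective : Function.Injective dirSeq := by
  intro i j h
  rcases i with _ | i <;> rcases j with _ | j
  · rfl
  · exact absurd h.symm (OnePoint.coe_ne_infty _)
  · exact absurd h (OnePoint.coe_ne_infty _)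
  · simpa [dirSeq] using h

/-- The binary form with the given zeros. -/
noncomputable def seqForm (R : List ℕ) : MvPolynomial (Fin 2) ℂ :=
  (R.map fun i => dirForm (dirSeq i)).prod

theorem isHomogeneous_seqForm (R : List ℕ) : (seqForm R).IsHomogeneous R.length := by
  induction R with
  | nil => exact isHomogeneous_one _ _
  | cons i R ih =>
    rw [seqForm, List.map_cons, List.prod_cons, List.length_cons, add_comm]
    exact (isHomogeneous_dirForm _).mul ih

theorem seqForm_ne_zero (R : List ℕ) : seqForm R ≠ 0 := by
  rw [seqForm, ne_eq, List.prod_eq_zero_iff, List.mem_map]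
  rintro ⟨i, -, h⟩
  exact dirForm_ne_zero _ h

theorem ordAt_seqForm_eq (s : OnePoint ℂ) (R : List ℕ) :
    ordAt s (seqForm R) = R.countP (fun i => open Classical in decide (s = dirSeq i)) := by
  induction R with
  | nil => simp [seqForm, ordAt_one]
  | cons i R ih =>
    rw [seqForm, List.map_cons, List.prod_cons, ordAt_mul, ordAt_dirForm, ← seqForm, ih,
      List.countP_cons, add_comm]
    push_cast
    by_cases h : s = dirSeq i <;> simp [h]

theorem ordAt_seqForm (i : ℕ) (R : List ℕ) : ordAt (dirSeq i) (seqForm R) = R.count i := by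
  classical
  rw [ordAt_seqForm_eq, List.count]
  congr 2
  ext j
  rw [Bool.eq_iff_iff, decide_eq_true_eq, dirSeq_injective.eq_iff, beq_iff_eq, eq_comm]

theorem ordAt_seqForm_pos {s : OnePoint ℂ} {R : List ℕ} (h : 0 < ordAt s (seqForm R)) :
    ∃ i ∈ R, s = dirSeq i := by
  rw [ordAt_seqForm_eq] at h
  obtain ⟨i, hi, h⟩ := List.countP_pos_iff.1 (by exact_mod_cast h)
  exact ⟨i, hi, by simpa using h⟩

theorem seqForm_append (R T : List ℕ) : seqForm (R ++ T) = seqForm R * seqForm T := by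
  rw [seqForm, List.map_append, List.prod_append]; rfl

theorem not_ordAt_seqForm_pos {s : OnePoint ℂ} {R T : List ℕ} (hRT : ∀ i ∈ R, i ∉ T)
    (hR : 0 < ordAt s (seqForm R)) : ¬ 0 < ordAt s (seqForm T) := by
  intro hT
  obtain ⟨i, hi, rfl⟩ := ordAt_seqForm_pos hR
  obtain ⟨j, hj, e⟩ := ordAt_seqForm_pos hT
  exact hRT i hi (dirSeq_injective e ▸ hj)

theorem toNat_min_natCast (m n : ℕ) : (min (m : ℕ∞) n).toNat = min m n := by
  rcases le_total m n with h | h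
  · rw [min_eq_left h, min_eq_left (by exact_mod_cast h), ENat.toNat_natCast]
  · rw [min_eq_right h, min_eq_right (by exact_mod_cast h), ENat.toNat_natCast]

namespace JonqMatrix

variable (M : JonqMatrix)

/-- If the second row of the matrix never vanishes on a line, then no line contains three simple
base points, for reasons of degree. -/
theorem isLineData_zero (h : ∀ m : MvPolynomial (Fin 2) ℂ, m.IsHomogeneous 1 → M.c * m + M.d ≠ 0)
    {S : List (OnePoint ℂ)} (hS : S.Nodup) : M.IsLineData S fun _ => 0 := by
  classical
  refine Or.inr ⟨fun _ _ => rfl, fun m hm => ?_⟩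
  have h1 : ∑ s ∈ S.toFinset, M.lineContact m s ≤ 2 :=
    (Finset.sum_le_sum fun s _ => min_le_right _ _).trans
      (sum_ordAt_le ((M.hc.mul hm).add M.hd) (h m hm) _)
  rw [← Finset.sum_congr rfl fun s _ => M.coe_toNat_lineContact m s] at h1
  rw [← List.sum_toFinset _ hS, not_le, Nat.lt_succ_iff]
  exact_mod_cast h1

/-- A linear form has no multiple of `x` added to it that makes `x` a factor. -/
theorem X_mul_add_ne_zero {R : List ℕ} (hR : 0 ∉ R) (m : MvPolynomial (Fin 2) ℂ) :
    seqForm [0] * m + seqForm R ≠ 0 := by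
  intro h
  have h1 : seqForm R = -(seqForm [0] * m) := by linear_combination h
  have h2 := congrArg (ordAt (dirSeq 0)) h1
  rw [ordAt_neg, ordAt_mul, ordAt_seqForm, ordAt_seqForm, List.count_eq_zero_of_not_mem hR] at h2
  exact absurd h2.symm (by simp)

end JonqMatrix

/-- The matrices with `c = 0` or `b = 0`, and no line through three simple base points. -/
theorem exists_cremona_of_mul {n : Fin 31} {Ra Rd S : List ℕ} (T : List ℕ)
    (ha : Ra.length = 2) (hd : Rd.length = 2) (h0a : 0 ∉ Ra) (h0d : 0 ∉ Rd) (hS : S.Nodup)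
    (hT : T = [] ∨ T = [0])
    (hD : S.map (fun i => ((Ra ++ Rd).count i, if T = [] then Ra.count i else 0, 0)) =
      chainTable n) :
    ∃ φ : PlaneCremonaMap, φ.degree = 3 ∧ φ.enrichedGraph.Isomorphic (tableGraph n) := by
  have hA := isHomogeneous_seqForm Ra
  have hB := isHomogeneous_seqForm Rd
  rw [ha] at hA
  rw [hd] at hB
  have hne : seqForm Ra * seqForm Rd ≠ 0 := mul_ne_zero (seqForm_ne_zero _) (seqForm_ne_zero _)
  have hdisj : ∀ s, ∀ k, 0 < ordAt s (seqForm Ra) → ¬ 0 < ordAt s (seqForm (List.replicate k 0)) :=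
    fun s k h => not_ordAt_seqForm_pos (fun i hi hi' => h0a (List.eq_of_mem_replicate hi' ▸ hi)) h
  have hSm : (S.map dirSeq).Nodup := hS.map dirSeq_injective
  rcases hT with rfl | rfl
  · let M : JonqMatrix := ⟨seqForm Ra, seqForm [0, 0, 0], 0, seqForm Rd, hA,
      isHomogeneous_seqForm [0, 0, 0], isHomogeneous_zero _ _ _, hB, by rwa [mul_zero, sub_zero],
      fun s h => hdisj s 3 h.1 h.2.1⟩
    refine M.exists_cremona_isomorphic hSm (M.isLineData_zero (fun m _ => ?_) hSm) ?_
    · change 0 * m + seqForm Rd ≠ 0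
      rw [zero_mul, zero_add]
      exact seqForm_ne_zero _
    · rw [← hD, List.map_map]
      refine List.map_congr_left fun i _ => ?_
      have e : M.det = seqForm (Ra ++ Rd) := by
        rw [seqForm_append, JonqMatrix.det]
        change _ - _ * 0 = _
        rw [mul_zero, sub_zero]
      refine Prod.ext ?_ (Prod.ext ?_ rfl)
      · change (ordAt _ M.det).toNat = _
        rw [e, ordAt_seqForm, ENat.toNat_natCast]
      · change (min (ordAt _ (seqForm Ra)) (ordAt _ 0)).toNat = _
        rw [ordAt_zero, min_top_right, ordAt_seqForm, ENat.toNat_natCast]; rfl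
  · let M : JonqMatrix := ⟨seqForm Ra, 0, seqForm [0], seqForm Rd, hA,
      isHomogeneous_zero _ _ _, isHomogeneous_seqForm [0], hB, by rwa [zero_mul, sub_zero],
      fun s h => hdisj s 1 h.1 h.2.2.1⟩
    refine M.exists_cremona_isomorphic hSm
      (M.isLineData_zero (fun m _ => JonqMatrix.X_mul_add_ne_zero h0d m) hSm) ?_
    rw [← hD, List.map_map]
    refine List.map_congr_left fun i _ => ?_
    have e : M.det = seqForm (Ra ++ Rd) := by
      rw [seqForm_append, JonqMatrix.det]
      change _ - 0 * _ = _
      rw [zero_mul, sub_zero]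
    refine Prod.ext ?_ (Prod.ext ?_ rfl)
    · change (ordAt _ M.det).toNat = _
      rw [e, ordAt_seqForm, ENat.toNat_natCast]
    · change (min (ordAt _ (seqForm Ra)) (ordAt _ (seqForm [0]))).toNat = 0
      rw [ordAt_seqForm, ordAt_seqForm, toNat_min_natCast, Nat.min_eq_zero_iff,
        List.count_eq_zero, List.count_eq_zero]
      by_cases hi : i = 0
      · exact Or.inl (hi ▸ h0a)
      · exact Or.inr (by simpa using hi)

/-- The matrices with `c = x`, `d = 0` and `a = 0` or `a = y ^ 2`, for which the line `z = 0`
contains three simple base points. -/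
theorem exists_cremona_with_line {n : Fin 31} {R S : List ℕ} (exc : Bool)
    (hR : R.length = 3) (h0 : exc = true → 0 ∉ R) (hS : S.Nodup)
    (h3 : 3 ≤ (S.map fun i => R.count i).sum)
    (hD : S.map (fun i => ((0 :: R).count i, if exc then [0].count i else 0, R.count i)) =
      chainTable n) :
    ∃ φ : PlaneCremonaMap, φ.degree = 3 ∧ φ.enrichedGraph.Isomorphic (tableGraph n) := by
  have hB := isHomogeneous_seqForm R
  rw [hR] at hB
  have hne : ∀ a : MvPolynomial (Fin 2) ℂ, a * 0 - seqForm R * seqForm [0] ≠ 0 := by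
    intro a
    rw [mul_zero, zero_sub]
    exact neg_ne_zero.2 (mul_ne_zero (seqForm_ne_zero _) (seqForm_ne_zero _))
  have hSm : (S.map dirSeq).Nodup := hS.map dirSeq_injective
  obtain ⟨a, hah, hae, ha0⟩ : ∃ a : MvPolynomial (Fin 2) ℂ, a.IsHomogeneous 2 ∧
      (∀ i, (min (ordAt (dirSeq i) a) (ordAt (dirSeq i) (seqForm [0]))).toNat =
        if exc then [0].count i else 0) ∧
      ∀ s, ¬ (0 < ordAt s a ∧ 0 < ordAt s (seqForm R) ∧ 0 < ordAt s (seqForm [0])) := by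
    cases exc with
    | true =>
      refine ⟨0, isHomogeneous_zero _ _ _, fun i => ?_, fun s h => ?_⟩
      · rw [ordAt_zero, min_top_left, ordAt_seqForm, ENat.toNat_natCast]; rfl
      · exact not_ordAt_seqForm_pos (fun i hi hi' => h0 rfl (by rwa [List.mem_singleton.1 hi'] at hi))
          h.2.1 h.2.2
    | false =>
      refine ⟨seqForm [1, 1], isHomogeneous_seqForm [1, 1], fun i => ?_, fun s h => ?_⟩
      · rw [ordAt_seqForm, ordAt_seqForm, toNat_min_natCast]
        rcases i with _ | i <;> simp
      · exact not_ordAt_seqForm_pos (by simp) h.1 h.2.2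
  let M : JonqMatrix := ⟨a, seqForm R, seqForm [0], 0, hah, hB, isHomogeneous_seqForm [0],
    isHomogeneous_zero _ _ _, hne a, fun s h => ha0 s ⟨h.1, h.2.1, h.2.2.1⟩⟩
  have hline : ∀ i, (M.lineContact 0 (dirSeq i)).toNat = R.count i := by
    intro i
    change (min (ordAt _ (a * 0 + seqForm R)) (ordAt _ (seqForm [0] * 0 + 0))).toNat = _
    rw [mul_zero, mul_zero, zero_add, zero_add, ordAt_zero, min_top_right, ordAt_seqForm,
      ENat.toNat_natCast]
  refine M.exists_cremona_isomorphic hSm (L := fun s => (M.lineContact 0 s).toNat)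
    (Or.inl ⟨0, isHomogeneous_zero _ _ _, ?_, fun _ _ => rfl⟩) ?_
  · rw [List.map_map]
    simpa only [Function.comp_def, hline] using h3
  · rw [← hD, List.map_map]
    refine List.map_congr_left fun i _ => Prod.ext ?_ (Prod.ext (hae i) (hline i))
    change (ordAt _ (a * 0 - seqForm R * seqForm [0])).toNat = _
    rw [mul_zero, zero_sub, ordAt_neg, mul_comm, ← seqForm_append, ordAt_seqForm,
      ENat.toNat_natCast]
    rfl

/-- The matrices with `a = 0`, `c = x` and `d = y ^ 2`. -/
theorem exists_cremona_of_a_eq_zero {n : Fin 31} {R S : List ℕ} (hR : R.length = 3)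
    (hS : S.Nodup)
    (hD : S.map (fun i => ((0 :: R).count i, [0].count i, 0)) = chainTable n) :
    ∃ φ : PlaneCremonaMap, φ.degree = 3 ∧ φ.enrichedGraph.Isomorphic (tableGraph n) := by
  have hB := isHomogeneous_seqForm R
  rw [hR] at hB
  have hSm : (S.map dirSeq).Nodup := hS.map dirSeq_injective
  let M : JonqMatrix := ⟨0, seqForm R, seqForm [0], seqForm [1, 1], isHomogeneous_zero _ _ _, hB,
    isHomogeneous_seqForm [0], isHomogeneous_seqForm [1, 1], by
      rw [zero_mul, zero_sub]
      exact neg_ne_zero.2 (mul_ne_zero (seqForm_ne_zero _) (seqForm_ne_zero _)),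
    fun s h => not_ordAt_seqForm_pos (by simp) h.2.2.1 h.2.2.2⟩
  refine M.exists_cremona_isomorphic hSm
    (M.isLineData_zero (fun m _ => JonqMatrix.X_mul_add_ne_zero (by simp) m) hSm) ?_
  rw [← hD, List.map_map]
  refine List.map_congr_left fun i _ => Prod.ext ?_ (Prod.ext ?_ rfl)
  · change (ordAt _ (0 * _ - seqForm R * seqForm [0])).toNat = _
    rw [zero_mul, zero_sub, ordAt_neg, mul_comm, ← seqForm_append, ordAt_seqForm,
      ENat.toNat_natCast]
    rfl
  · change (min (ordAt _ 0) (ordAt _ (seqForm [0]))).toNat = _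
    rw [ordAt_zero, min_top_left, ordAt_seqForm, ENat.toNat_natCast]

theorem exists_cremona_isomorphic_tableGraph (n : Fin 31) :
    ∃ φ : PlaneCremonaMap, φ.degree = 3 ∧ φ.enrichedGraph.Isomorphic (tableGraph n) := by
  fin_cases n
  · exact exists_cremona_of_mul (Ra := [1, 1]) (Rd := [1, 1]) (S := [1]) []
      rfl rfl (by decide) (by decide) (by decide) (by decide) (by decide)
  · exact exists_cremona_of_a_eq_zero (R := [0, 0, 0]) (S := [0]) rfl (by decide) (by decide)
  · exact exists_cremona_of_mul (Ra := [1, 2]) (Rd := [2, 2]) (S := [1, 2]) []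
      rfl rfl (by decide) (by decide) (by decide) (by decide) (by decide)
  · exact exists_cremona_of_mul (Ra := [1, 2]) (Rd := [1, 2]) (S := [1, 2]) []
      rfl rfl (by decide) (by decide) (by decide) (by decide) (by decide)
  · exact exists_cremona_of_mul (Ra := [1, 1]) (Rd := [1, 2]) (S := [1, 2]) []
      rfl rfl (by decide) (by decide) (by decide) (by decide) (by decide)
  · exact exists_cremona_of_mul (Ra := [1, 2]) (Rd := [2, 3]) (S := [1, 2, 3]) []
      rfl rfl (by decide) (by decide) (by decide) (by decide) (by decide)
  · exact exists_cremona_of_a_eq_zero (R := [0, 0, 1]) (S := [0, 1]) rfl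
      (by decide) (by decide)
  · exact exists_cremona_with_line (R := [0, 0, 0]) (S := [0]) false rfl (by decide)
      (by decide) (by decide) (by decide)
  · exact exists_cremona_of_mul (Ra := [1, 1]) (Rd := [1, 1]) (S := [1]) [0]
      rfl rfl (by decide) (by decide) (by decide) (by decide) (by decide)
  · exact exists_cremona_with_line (R := [1, 1, 1]) (S := [0, 1]) true rfl (by decide)
      (by decide) (by decide) (by decide)
  · exact exists_cremona_of_a_eq_zero (R := [1, 1, 1]) (S := [0, 1]) rfl
      (by decide) (by decide)
  · exact exists_cremona_of_mul (Ra := [1, 1]) (Rd := [2, 2]) (S := [1, 2]) []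
      rfl rfl (by decide) (by decide) (by decide) (by decide) (by decide)
  · exact exists_cremona_of_a_eq_zero (R := [0, 1, 1]) (S := [0, 1]) rfl
      (by decide) (by decide)
  · exact exists_cremona_of_mul (Ra := [1, 2]) (Rd := [3, 3]) (S := [1, 2, 3]) []
      rfl rfl (by decide) (by decide) (by decide) (by decide) (by decide)
  · exact exists_cremona_of_mul (Ra := [1, 1]) (Rd := [2, 3]) (S := [1, 2, 3]) []
      rfl rfl (by decide) (by decide) (by decide) (by decide) (by decide)
  · exact exists_cremona_of_a_eq_zero (R := [0, 1, 2]) (S := [0, 1, 2]) rfl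
      (by decide) (by decide)
  · exact exists_cremona_with_line (R := [1, 0, 0]) (S := [1, 0]) false rfl (by decide)
      (by decide) (by decide) (by decide)
  · exact exists_cremona_with_line (R := [1, 1, 1]) (S := [0, 1]) false rfl (by decide)
      (by decide) (by decide) (by decide)
  · exact exists_cremona_of_mul (Ra := [1, 2]) (Rd := [2, 2]) (S := [1, 2]) [0]
      rfl rfl (by decide) (by decide) (by decide) (by decide) (by decide)
  · exact exists_cremona_with_line (R := [1, 1, 0]) (S := [1, 0]) false rfl (by decide)
      (by decide) (by decide) (by decide)
  · exact exists_cremona_of_mul (Ra := [1, 1]) (Rd := [2, 2]) (S := [1, 2]) [0]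
      rfl rfl (by decide) (by decide) (by decide) (by decide) (by decide)
  · exact exists_cremona_with_line (R := [1, 2, 2]) (S := [0, 1, 2]) true rfl (by decide)
      (by decide) (by decide) (by decide)
  · exact exists_cremona_of_a_eq_zero (R := [1, 2, 2]) (S := [0, 1, 2]) rfl
      (by decide) (by decide)
  · exact exists_cremona_with_line (R := [1, 2, 0]) (S := [1, 2, 0]) false rfl (by decide)
      (by decide) (by decide) (by decide)
  · exact exists_cremona_with_line (R := [1, 2, 2]) (S := [0, 1, 2]) false rfl (by decide)
      (by decide) (by decide) (by decide)
  · exact exists_cremona_of_mul (Ra := [1, 2]) (Rd := [3, 3]) (S := [1, 2, 3]) [0]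
      rfl rfl (by decide) (by decide) (by decide) (by decide) (by decide)
  · exact exists_cremona_of_mul (Ra := [1, 2]) (Rd := [3, 4]) (S := [1, 2, 3, 4]) []
      rfl rfl (by decide) (by decide) (by decide) (by decide) (by decide)
  · exact exists_cremona_with_line (R := [1, 2, 3]) (S := [0, 1, 2, 3]) true rfl
      (by decide) (by decide) (by decide) (by decide)
  · exact exists_cremona_of_a_eq_zero (R := [1, 2, 3]) (S := [0, 1, 2, 3]) rfl
      (by decide) (by decide)
  · exact exists_cremona_with_line (R := [1, 2, 3]) (S := [0, 1, 2, 3]) false rfl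
      (by decide) (by decide) (by decide) (by decide)
  · exact exists_cremona_of_mul (Ra := [1, 2]) (Rd := [3, 4]) (S := [1, 2, 3, 4]) [0]
      rfl rfl (by decide) (by decide) (by decide) (by decide) (by decide)

/-! ### Forms without common factor have finitely many common zeros -/

/-- The eliminant of a prime polynomial and a polynomial that it does not divide. -/
theorem exists_C_eq_of_prime {R : Type*} [CommRing R] [IsDomain R] [UniqueFactorizationMonoid R]
    {p q : Polynomial R} (hp : Prime p) (hpq : ¬ p ∣ q) :
    ∃ r : R, r ≠ 0 ∧ ∃ A B, Polynomial.C r = p * A + q * B := by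
  classical
  let : StrongNormalizationMonoid R := UniqueFactorizationMonoid.strongNormalizationMonoid
  let : NormalizedGCDMonoid R := UniqueFactorizationMonoid.toNormalizedGCDMonoid R
  by_cases h0 : p.natDegree = 0
  · obtain ⟨r, rfl⟩ := Polynomial.natDegree_eq_zero.1 h0
    refine ⟨r, ?_, 1, 0, by ring⟩
    rintro rfl
    exact hp.ne_zero (map_zero _)
  · set K := FractionRing R
    have hprim : p.IsPrimitive := hp.irreducible.isPrimitive h0
    have hirr : Irreducible (p.map (algebraMap R K)) :=
      (hprim.irreducible_iff_irreducible_map_fraction_map (K := K)).1 hp.irreducible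
    have hco : IsCoprime (p.map (algebraMap R K)) (q.map (algebraMap R K)) :=
      hirr.coprime_iff_not_dvd.2 fun h => hpq (hprim.dvd_of_fraction_map_dvd_fraction_map h)
    have hres := Polynomial.resultant_ne_zero _ _ hco
    have hinj := FaithfulSMul.algebraMap_injective R K
    rw [Polynomial.natDegree_map_eq_of_injective hinj,
      Polynomial.natDegree_map_eq_of_injective hinj, Polynomial.resultant_map_map] at hres
    obtain ⟨A, B, -, -, e⟩ := Polynomial.exists_mul_add_mul_eq_C_resultant p q le_rfl le_rfl
      (Or.inl h0)
    exact ⟨_, fun h => hres (by rw [h, map_zero]), A, B, e.symm⟩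

/-- An ideal of polynomials without common factor contains a nonzero constant. -/
theorem exists_C_mem_of_noCommonFactor {R : Type*} [CommRing R] [IsDomain R]
    [UniqueFactorizationMonoid R] {J : Ideal (Polynomial R)} (hJ : J ≠ ⊥)
    (h : ∀ p, (∀ f ∈ J, p ∣ f) → IsUnit p) : ∃ r : R, r ≠ 0 ∧ Polynomial.C r ∈ J := by
  have key : ∀ a : Polynomial R, a ≠ 0 → ∃ r : R, r ≠ 0 ∧ ∃ A, ∃ j ∈ J,
      Polynomial.C r = a * A + j := by
    intro a
    induction a using UniqueFactorizationMonoid.induction_on_prime with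
    | h₁ => exact fun h => absurd rfl h
    | h₂ a ha =>
      intro _
      obtain ⟨u, rfl⟩ := ha
      exact ⟨1, one_ne_zero, (u⁻¹ : (Polynomial R)ˣ), 0, J.zero_mem, by simp⟩
    | h₃ a p ha hp ih =>
      intro _
      obtain ⟨r, hr, A, j, hj, e⟩ := ih ha
      obtain ⟨q, hq, hpq⟩ : ∃ q ∈ J, ¬ p ∣ q := by
        by_contra hc
        push Not at hc
        exact hp.not_isUnit (h p hc)
      obtain ⟨r', hr', A', B', e'⟩ := exists_C_eq_of_prime hp hpq
      refine ⟨r * r', mul_ne_zero hr hr', A * A', j * (p * A' + q * B') + a * A * q * B',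
        J.add_mem (J.mul_mem_right _ hj) (J.mul_mem_right _ (J.mul_mem_left _ hq)), ?_⟩
      rw [map_mul, e, e']; ring
  obtain ⟨a, haJ, ha⟩ := Submodule.exists_mem_ne_zero_of_ne_bot hJ
  obtain ⟨r, hr, A, j, hj, e⟩ := key a ha
  exact ⟨r, hr, e ▸ J.add_mem (J.mul_mem_right _ haJ) hj⟩

/-- A vanishing polynomial on scaled points has vanishing homogeneous components there. -/
theorem aeval_homogeneousComponent_eq_zero {σ : Type*} {r : MvPolynomial σ ℂ} {w : σ → ℂ}
    (h : ∀ t : ℂ, aeval (fun i => t * w i) r = 0) (k : ℕ) :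
    aeval w (homogeneousComponent k r) = 0 := by
  set p : Polynomial ℂ := ∑ k ∈ Finset.range (r.totalDegree + 1),
    Polynomial.C (aeval w (homogeneousComponent k r)) * Polynomial.X ^ k with hp
  have hp0 : p = 0 := by
    apply Polynomial.funext
    intro t
    rw [Polynomial.eval_zero, hp, Polynomial.eval_finsetSum, ← h t]
    conv_rhs => rw [← sum_homogeneousComponent r, map_sum]
    refine Finset.sum_congr rfl fun k _ => ?_
    rw [aeval_mul_left_of_isHomogeneous (homogeneousComponent_isHomogeneous k r)]
    rw [Polynomial.eval_mul, Polynomial.eval_C, Polynomial.eval_pow, Polynomial.eval_X, mul_comm]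
  by_cases hk : k < r.totalDegree + 1
  · have := congrArg (fun p => Polynomial.coeff p k) hp0
    simp only [hp, Polynomial.finsetSum_coeff, Polynomial.coeff_C_mul_X_pow,
      Polynomial.coeff_zero, Finset.sum_ite_eq, Finset.mem_range, hk, if_true] at this
    exact this
  · rw [homogeneousComponent_eq_zero _ _ (by omega), map_zero]

/-- A binary form that is not zero has finitely many zeros up to scaling. -/
theorem exists_finset_binary_zeros {r : MvPolynomial (Fin 2) ℂ} {d : ℕ} (hr : r.IsHomogeneous d)
    (h0 : r ≠ 0) : ∃ T : Finset ℂ, ∀ t : ℂ,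
      (aeval ![1, t] r = 0 → t ∈ T) ∧ (aeval ![t, 1] r = 0 → t ∈ T) := by
  classical
  obtain ⟨R, hR, hmem⟩ := exists_sum_ordAt_eq hr h0
  have key : ∀ x y : ℂ, ¬ (x = 0 ∧ y = 0) → aeval ![x, y] r = 0 →
      ∃ s ∈ R, ∃ μ : ℂ, x = μ * dirVec s 0 ∧ y = μ * dirVec s 1 := by
    intro x y hxy h
    obtain ⟨s, μ, hμ, hx, hy⟩ := exists_dir hxy
    refine ⟨s, ?_, μ, hx, hy⟩
    rw [hmem, ordAt_pos_iff, valAt_eq]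
    have e : (![x, y] : Fin 2 → ℂ) = fun i => μ * ![dirVec s 0, dirVec s 1] i := by
      ext i; fin_cases i
      · exact hx
      · exact hy
    rw [e, aeval_mul_left_of_isHomogeneous hr] at h
    exact (mul_eq_zero.1 h).resolve_left (pow_ne_zero _ hμ)
  refine ⟨R.image (fun s => dirVec s 1 / dirVec s 0) ∪ R.image (fun s => dirVec s 0 / dirVec s 1),
    fun t => ⟨fun h => ?_, fun h => ?_⟩⟩
  · obtain ⟨s, hs, μ, hx, hy⟩ := key 1 t (by simp) h
    refine Finset.mem_union_left _ (Finset.mem_image.2 ⟨s, hs, ?_⟩)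
    have hμ : μ ≠ 0 := by rintro rfl; simp at hx
    rw [← mul_div_mul_left _ _ hμ, ← hx, ← hy, div_one]
  · obtain ⟨s, hs, μ, hx, hy⟩ := key t 1 (by simp) h
    refine Finset.mem_union_right _ (Finset.mem_image.2 ⟨s, hs, ?_⟩)
    have hμ : μ ≠ 0 := by rintro rfl; simp at hy
    rw [← mul_div_mul_left _ _ hμ, ← hx, ← hy, div_one]

section CommonZeros

variable {ι : Type} {f : ι → MvPolynomial (Fin 3) ℂ}

/-- Elimination of the first variable. -/
theorem exists_eliminant (hne : ∃ i, f i ≠ 0) (h : ∀ p, (∀ i, p ∣ f i) → IsUnit p) :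
    ∃ r : MvPolynomial (Fin 2) ℂ, r ≠ 0 ∧
      ∀ v : Fin 3 → ℂ, (∀ i, aeval v (f i) = 0) → aeval ![v 1, v 2] r = 0 := by
  set Φ := finSuccEquiv ℂ 2
  obtain ⟨r, hr, hrJ⟩ := exists_C_mem_of_noCommonFactor
    (J := Ideal.span (Set.range fun i => Φ (f i)))
    (by
      obtain ⟨i, hi⟩ := hne
      intro hbot
      rw [Ideal.span_eq_bot] at hbot
      exact hi (Φ.map_eq_zero_iff.1 (hbot _ ⟨i, rfl⟩)))
    (by
      intro p hp
      have : IsUnit (Φ.symm p) := h _ fun i => by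
        have := map_dvd Φ.symm (hp _ (Ideal.subset_span ⟨i, rfl⟩))
        rwa [Φ.symm_apply_apply] at this
      simpa using this.map Φ)
  refine ⟨r, hr, fun v hv => ?_⟩
  set E : Polynomial (MvPolynomial (Fin 2) ℂ) →+* ℂ :=
    (Polynomial.evalRingHom (v 0)).comp (Polynomial.mapRingHom (eval ![v 1, v 2]))
  have hE : ∀ q, E (Φ q) = aeval v q := by
    intro q
    have hv : v = Fin.cons (v 0) ![v 1, v 2] := by ext i; fin_cases i <;> rfl
    have := eval_eq_eval_mv_eval' ![v 1, v 2] (v 0) q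
    rw [← hv] at this
    exact this.symm
  have hle : Ideal.span (Set.range fun i => Φ (f i)) ≤ RingHom.ker E := by
    rw [Ideal.span_le]
    rintro _ ⟨i, rfl⟩
    exact (hE _).trans (hv i)
  have := hle hrJ
  rw [RingHom.mem_ker] at this
  simpa [E] using this

theorem exists_homogeneous_eliminant {d : ℕ} (hf : ∀ i, (f i).IsHomogeneous d)
    (hne : ∃ i, f i ≠ 0) (h : ∀ p, (∀ i, p ∣ f i) → IsUnit p) :
    ∃ (r : MvPolynomial (Fin 2) ℂ) (e : ℕ), r.IsHomogeneous e ∧ r ≠ 0 ∧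
      ∀ v : Fin 3 → ℂ, (∀ i, aeval v (f i) = 0) → aeval ![v 1, v 2] r = 0 := by
  obtain ⟨r, hr, hrv⟩ := exists_eliminant hne h
  obtain ⟨k, hk⟩ : ∃ k, homogeneousComponent k r ≠ 0 := by
    by_contra hc
    push Not at hc
    apply hr
    rw [← sum_homogeneousComponent r]
    exact Finset.sum_eq_zero fun k _ => hc k
  refine ⟨_, k, homogeneousComponent_isHomogeneous k r, hk, fun v hv => ?_⟩
  apply aeval_homogeneousComponent_eq_zero
  intro t
  have := hrv (fun i => t * v i) fun i => by
    rw [aeval_mul_left_of_isHomogeneous (hf i), hv, mul_zero]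
  rw [← this]
  congr 2
  ext i; fin_cases i <;> rfl

/-- Elimination of any of the variables. -/
theorem exists_homogeneous_eliminant' {d : ℕ} (hf : ∀ i, (f i).IsHomogeneous d)
    (hne : ∃ i, f i ≠ 0) (h : ∀ p, (∀ i, p ∣ f i) → IsUnit p) (k : Fin 3) :
    ∃ (r : MvPolynomial (Fin 2) ℂ) (e : ℕ), r.IsHomogeneous e ∧ r ≠ 0 ∧
      ∀ v : Fin 3 → ℂ, (∀ i, aeval v (f i) = 0) →
        aeval ![v (Equiv.swap 0 k 1), v (Equiv.swap 0 k 2)] r = 0 := by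
  set Ψ := renameEquiv ℂ (Equiv.swap 0 k) with hΨ
  obtain ⟨r, e, hr, hr0, hrv⟩ := exists_homogeneous_eliminant (f := fun i => Ψ (f i))
    (fun i => (hf i).rename_isHomogeneous)
    (hne.imp fun i hi h0 => hi (Ψ.map_eq_zero_iff.1 h0)) (by
      intro p hp
      have : IsUnit (Ψ.symm p) := h _ fun i => by
        have := map_dvd Ψ.symm (hp i)
        rwa [Ψ.symm_apply_apply] at this
      simpa using this.map Ψ)
  refine ⟨r, e, hr, hr0, fun v hv => ?_⟩
  refine hrv (fun i => v (Equiv.swap 0 k i)) fun i => ?_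
  rw [hΨ, renameEquiv_apply, aeval_rename, ← hv i]
  congr 2
  ext j
  simp

/-- Forms without common factor have finitely many common zeros in the projective plane. -/
theorem exists_finset_common_zeros {d : ℕ} (hf : ∀ i, (f i).IsHomogeneous d)
    (hne : ∃ i, f i ≠ 0) (h : ∀ p, (∀ i, p ∣ f i) → IsUnit p) :
    ∃ Z : Finset (Fin 3 → ℂ), (∀ z ∈ Z, z ≠ 0) ∧
      ∀ v : Fin 3 → ℂ, v ≠ 0 → (∀ i, aeval v (f i) = 0) → ∃ z ∈ Z, ∃ c : ℂ, c ≠ 0 ∧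
        z = fun i => c * v i := by
  classical
  choose r e hr hr0 hrv using exists_homogeneous_eliminant' hf hne h
  choose T hT using fun k => exists_finset_binary_zeros (hr k) (hr0 k)
  set U : Finset ℂ := {1} ∪ Finset.univ.biUnion T with hU
  have hmem : ∀ k t, t ∈ T k → t ∈ U := fun k t ht =>
    Finset.mem_union_right _ (Finset.mem_biUnion.2 ⟨k, Finset.mem_univ _, ht⟩)
  have h1 : (1 : ℂ) ∈ U := Finset.mem_union_left _ (Finset.mem_singleton_self 1)
  refine ⟨(Fintype.piFinset fun _ : Fin 3 => U).erase 0, fun z hz => Finset.ne_of_mem_erase hz,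
    fun v hv hvf => ?_⟩
  obtain ⟨j, hj⟩ := Function.ne_iff.1 hv
  have hc : (v j)⁻¹ ≠ 0 := inv_ne_zero hj
  set z : Fin 3 → ℂ := fun i => (v j)⁻¹ * v i with hz
  have hzj : z j = 1 := inv_mul_cancel₀ hj
  refine ⟨z, Finset.mem_erase.2 ⟨fun h0 => ?_, Fintype.mem_piFinset.2 fun i => ?_⟩, _, hc, rfl⟩
  · rw [h0] at hzj; simp at hzj
  · have hzf : ∀ i, aeval z (f i) = 0 := fun i => by
      rw [hz, aeval_mul_left_of_isHomogeneous (hf i), hvf, mul_zero]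
    by_cases hij : i = j
    · rw [hij, hzj]; exact h1
    · -- the third index is the eliminated variable
      have hk : ∃ k : Fin 3, (Equiv.swap 0 k 1 = i ∧ Equiv.swap 0 k 2 = j) ∨
          (Equiv.swap 0 k 1 = j ∧ Equiv.swap 0 k 2 = i) := by
        exact (by decide : ∀ i j : Fin 3, i ≠ j → ∃ k : Fin 3,
          (Equiv.swap 0 k 1 = i ∧ Equiv.swap 0 k 2 = j) ∨
            (Equiv.swap 0 k 1 = j ∧ Equiv.swap 0 k 2 = i)) i j hij
      obtain ⟨k, ⟨e1, e2⟩ | ⟨e1, e2⟩⟩ := hk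
      · have := hrv k z hzf
        rw [e1, e2, hzj] at this
        exact hmem k _ ((hT k _).2 this)
      · have := hrv k z hzf
        rw [e1, e2, hzj] at this
        exact hmem k _ ((hT k _).1 this)

end CommonZeros

/-! ### Factors of forms -/

section Factors

variable {σ : Type*}

/-- The substitution `Xᵢ ↦ T Xᵢ`, which records the degrees of the homogeneous components. -/
noncomputable def scaleMap : MvPolynomial σ ℂ →ₐ[ℂ] Polynomial (MvPolynomial σ ℂ) :=
  aeval fun i => Polynomial.X * Polynomial.C (X i)

theorem scaleMap_of_isHomogeneous {H : MvPolynomial σ ℂ} {n : ℕ} (hH : H.IsHomogeneous n) :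
    scaleMap H = Polynomial.C H * Polynomial.X ^ n := by
  rw [scaleMap, aeval_mul_left_of_isHomogeneous hH, mul_comm]
  congr 1
  have : aeval (fun i => Polynomial.C (X i : MvPolynomial σ ℂ)) =
      (Polynomial.CAlgHom : MvPolynomial σ ℂ →ₐ[ℂ] Polynomial (MvPolynomial σ ℂ)) := by
    apply MvPolynomial.algHom_ext
    intro i
    rw [aeval_X]; rfl
  rw [this]; rfl

theorem coeff_scaleMap (H : MvPolynomial σ ℂ) (k : ℕ) :
    (scaleMap H).coeff k = homogeneousComponent k H := by
  have e : scaleMap H = ∑ i ∈ Finset.range (H.totalDegree + 1),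
      Polynomial.C (homogeneousComponent i H) * Polynomial.X ^ i := by
    conv_lhs => rw [← sum_homogeneousComponent H, map_sum]
    exact Finset.sum_congr rfl fun i _ =>
      scaleMap_of_isHomogeneous (homogeneousComponent_isHomogeneous i H)
  rw [e]
  simp only [Polynomial.finsetSum_coeff, Polynomial.coeff_C_mul_X_pow, Finset.sum_ite_eq,
    Finset.mem_range]
  split_ifs with h
  · rfl
  · rw [homogeneousComponent_eq_zero _ _ (by omega)]

theorem isHomogeneous_of_scaleMap {H : MvPolynomial σ ℂ}
    (h : (scaleMap H).natDegree = (scaleMap H).natTrailingDegree) :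
    H.IsHomogeneous (scaleMap H).natDegree := by
  have e : H = homogeneousComponent (scaleMap H).natDegree H := by
    conv_lhs => rw [← sum_homogeneousComponent H]
    refine Finset.sum_eq_single _ (fun k _ hk => ?_) fun hk => ?_
    · rw [← coeff_scaleMap]
      rcases lt_or_gt_of_ne hk with h1 | h1
      · exact Polynomial.coeff_eq_zero_of_lt_natTrailingDegree (h ▸ h1)
      · exact Polynomial.coeff_eq_zero_of_natDegree_lt h1
    · exact homogeneousComponent_eq_zero _ _ (by simpa using hk)
  have h' := homogeneousComponent_isHomogeneous (scaleMap H).natDegree H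
  rwa [← e] at h'

/-- The factors of a form are forms. -/
theorem isHomogeneous_of_mul {a b : MvPolynomial σ ℂ} {n : ℕ} (h : (a * b).IsHomogeneous n)
    (h0 : a * b ≠ 0) : ∃ i j, i + j = n ∧ a.IsHomogeneous i ∧ b.IsHomogeneous j := by
  have e := scaleMap_of_isHomogeneous h
  rw [map_mul] at e
  have hne : Polynomial.C (a * b) * Polynomial.X ^ n ≠ 0 :=
    mul_ne_zero (by simpa using h0) (pow_ne_zero _ Polynomial.X_ne_zero)
  have ha0 : scaleMap a ≠ 0 := fun h' => hne (by rw [← e, h', zero_mul])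
  have hb0 : scaleMap b ≠ 0 := fun h' => hne (by rw [← e, h', mul_zero])
  have h1 := congrArg Polynomial.natDegree e
  have h2 := congrArg Polynomial.natTrailingDegree e
  rw [Polynomial.natDegree_mul ha0 hb0, Polynomial.natDegree_C_mul_X_pow _ _ h0] at h1
  rw [Polynomial.natTrailingDegree_mul ha0 hb0, Polynomial.C_mul_X_pow_eq_monomial,
    Polynomial.natTrailingDegree_monomial h0] at h2
  have h3 := Polynomial.natTrailingDegree_le_natDegree (scaleMap a)
  have h4 := Polynomial.natTrailingDegree_le_natDegree (scaleMap b)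
  exact ⟨_, _, h1, isHomogeneous_of_scaleMap (by omega), isHomogeneous_of_scaleMap (by omega)⟩

/-- Division of forms by their greatest common divisor. -/
theorem exists_eq_mul_noCommonFactor {ι : Type} [Fintype ι] {g : ι → MvPolynomial σ ℂ}
    {e : ℕ} (hg : ∀ i, (g i).IsHomogeneous e) (hne : ∃ i, g i ≠ 0) :
    ∃ (k : MvPolynomial σ ℂ) (g' : ι → MvPolynomial σ ℂ) (m e' : ℕ), m + e' = e ∧ k ≠ 0 ∧
      k.IsHomogeneous m ∧ (∀ i, g i = k * g' i) ∧ (∀ i, (g' i).IsHomogeneous e') ∧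
      ∀ p, (∀ i, p ∣ g' i) → IsUnit p := by
  classical
  let : StrongNormalizationMonoid (MvPolynomial σ ℂ) :=
    UniqueFactorizationMonoid.strongNormalizationMonoid
  let : NormalizedGCDMonoid (MvPolynomial σ ℂ) :=
    UniqueFactorizationMonoid.toNormalizedGCDMonoid _
  obtain ⟨i₀, hi₀⟩ := hne
  obtain ⟨g', hg', h1⟩ := Finset.extract_gcd g (s := Finset.univ) ⟨i₀, Finset.mem_univ _⟩
  simp only [Finset.mem_univ, true_imp_iff] at hg'
  set k := Finset.univ.gcd g
  have hk : k ≠ 0 := fun h => hi₀ (by rw [hg', h, zero_mul])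
  obtain ⟨m, e', hme, hm, -⟩ := isHomogeneous_of_mul (hg' i₀ ▸ hg i₀) (hg' i₀ ▸ hi₀)
  refine ⟨k, g', m, e', hme, hk, hm, hg', fun i => ?_, fun p hp => ?_⟩
  · by_cases h0 : g' i = 0
    · rw [h0]; exact isHomogeneous_zero _ _ _
    · obtain ⟨m', e'', hme', hm', he'⟩ :=
        isHomogeneous_of_mul (hg' i ▸ hg i) (mul_ne_zero hk h0)
      have := hm.inj_right hm' hk
      have : e'' = e' := by omega
      rwa [← this]
  · exact isUnit_of_dvd_one (h1 ▸ Finset.dvd_gcd fun i _ => hp i)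

/-- The chain rule. -/
theorem pderiv_aeval_eq {τ : Type*} [Fintype τ] (g : τ → MvPolynomial σ ℂ) (k : σ)
    (F : MvPolynomial τ ℂ) :
    pderiv k (aeval g F) = ∑ j, aeval g (pderiv j F) * pderiv k (g j) := by
  classical
  induction F using MvPolynomial.induction_on with
  | C a => simp [← algebraMap_eq]
  | add p q hp hq =>
    simp only [map_add, hp, hq, add_mul, Finset.sum_add_distrib]
  | mul_X p i hp =>
    rw [map_mul, aeval_X, pderiv_mul, hp]
    simp only [pderiv_mul, map_add, map_mul, aeval_X, pderiv_X, add_mul, Finset.sum_add_distrib]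
    congr 1
    · rw [Finset.sum_mul]
      exact Finset.sum_congr rfl fun j _ => by ring
    · rw [Finset.sum_eq_single i (fun j _ hj => by simp [hj.symm]) (by simp)]
      simp

end Factors

/-! ### The double point of a cubic Cremona map -/

theorem exists_aeval_ne_zero {σ : Type} {P : MvPolynomial σ ℂ} (hP : P ≠ 0) :
    ∃ v : σ → ℂ, aeval v P ≠ 0 := by
  by_contra h
  push Not at h
  exact hP (MvPolynomial.funext fun v => by rw [map_zero, ← coe_aeval_eq_eval]; exact h v)

section CrossProduct

variable {R : Type*} [CommRing R]

theorem sum_mul_crossProduct (n p q : Fin 3 → R) :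
    ∑ i, n i * crossProduct p q i = ∑ i, crossProduct n p i * q i := by
  simp only [Fin.sum_univ_three, cross_apply, Matrix.cons_val_zero, Matrix.cons_val_one,
    Matrix.cons_val]
  ring

theorem mul_eq_mul_of_crossProduct_eq_zero {p q : Fin 3 → R} (h : crossProduct p q = 0)
    (i j : Fin 3) : p i * q j = p j * q i := by
  have h0 : p 1 * q 2 - p 2 * q 1 = 0 := congrFun h 0
  have h1 : p 2 * q 0 - p 0 * q 2 = 0 := congrFun h 1
  have h2 : p 0 * q 1 - p 1 * q 0 = 0 := congrFun h 2
  fin_cases i <;> fin_cases j <;> simp only [Fin.zero_eta, Fin.mk_one, Fin.reduceFinMk] <;>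
    first | ring1 | linear_combination h0 | linear_combination h1 | linear_combination h2 |
      linear_combination -h0 | linear_combination -h1 | linear_combination -h2

theorem crossProduct_eq_zero_of_mul_eq_mul {p q : Fin 3 → R}
    (h : ∀ i j, p i * q j = p j * q i) : crossProduct p q = 0 := by
  rw [cross_apply, h 1 2, h 2 0, h 0 1, sub_self, sub_self, sub_self]
  ext j; fin_cases j <;> rfl

/-- A vector orthogonal to two vectors is proportional to their cross product. -/
theorem crossProduct_mul_eq {d p q : Fin 3 → R} (hp : d 0 * p 0 + d 1 * p 1 + d 2 * p 2 = 0)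
    (hq : d 0 * q 0 + d 1 * q 1 + d 2 * q 2 = 0) (i j : Fin 3) :
    crossProduct p q i * d j = crossProduct p q j * d i := by
  have h01 : crossProduct p q 0 * d 1 = crossProduct p q 1 * d 0 := by
    change (p 1 * q 2 - p 2 * q 1) * d 1 = (p 2 * q 0 - p 0 * q 2) * d 0
    linear_combination q 2 * hp - p 2 * hq
  have h02 : crossProduct p q 0 * d 2 = crossProduct p q 2 * d 0 := by
    change (p 1 * q 2 - p 2 * q 1) * d 2 = (p 0 * q 1 - p 1 * q 0) * d 0
    linear_combination p 1 * hq - q 1 * hp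
  have h12 : crossProduct p q 1 * d 2 = crossProduct p q 2 * d 1 := by
    change (p 2 * q 0 - p 0 * q 2) * d 2 = (p 0 * q 1 - p 1 * q 0) * d 1
    linear_combination q 0 * hp - p 0 * hq
  fin_cases i <;> fin_cases j
  · rfl
  · exact h01
  · exact h02
  · exact h01.symm
  · rfl
  · exact h12
  · exact h02.symm
  · exact h12.symm
  · rfl

end CrossProduct

theorem exists_crossProduct_ne_zero {n : Fin 3 → ℂ} (hn : n ≠ 0) :
    ∃ l : MvPolynomial (Fin 3) ℂ, l ≠ 0 ∧ ∀ p, aeval p l ≠ 0 → crossProduct n p ≠ 0 := by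
  have key : ∀ i j : Fin 3, i ≠ j → n i ≠ 0 →
      C (n i) * X j - C (n j) * X i ≠ (0 : MvPolynomial (Fin 3) ℂ) := by
    intro i j hij hi h
    have := congrArg (aeval (Pi.single j 1 : Fin 3 → ℂ)) h
    simp [hij] at this
    exact hi this
  obtain ⟨i, hi⟩ := Function.ne_iff.1 hn
  obtain ⟨j, hij⟩ := exists_ne i
  refine ⟨_, key i j hij.symm hi, fun p hp h => hp ?_⟩
  rw [map_sub, map_mul, map_mul, aeval_C, aeval_C, aeval_X, aeval_X, sub_eq_zero]
  exact mul_eq_mul_of_crossProduct_eq_zero h i j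

/-- There is a line, spanned by `p` and `q`, that avoids finitely many given points and is not
contained in the curve `h = 0`. -/
theorem exists_generic_line {h : MvPolynomial (Fin 3) ℂ} (h0 : h ≠ 0) (N : Finset (Fin 3 → ℂ))
    (hN : ∀ n ∈ N, n ≠ 0) : ∃ p q : Fin 3 → ℂ, aeval p h ≠ 0 ∧
      ∀ n ∈ N, ∑ i, n i * crossProduct p q i ≠ 0 := by
  have hl : ∀ n : Fin 3 → ℂ, ∃ l : MvPolynomial (Fin 3) ℂ, l ≠ 0 ∧
      (n ≠ 0 → ∀ p, aeval p l ≠ 0 → crossProduct n p ≠ 0) := by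
    intro n
    by_cases hn : n = 0
    · exact ⟨1, one_ne_zero, fun h => absurd hn h⟩
    · obtain ⟨l, h1, h2⟩ := exists_crossProduct_ne_zero hn
      exact ⟨l, h1, fun _ => h2⟩
  choose l hl0 hl using hl
  obtain ⟨p, hp⟩ := exists_aeval_ne_zero
    (mul_ne_zero h0 (Finset.prod_ne_zero_iff.2 fun n (_ : n ∈ N) => hl0 n))
  rw [map_mul, map_prod] at hp
  have hp1 := left_ne_zero_of_mul hp
  have hp2 := Finset.prod_ne_zero_iff.1 (right_ne_zero_of_mul hp)
  have hlin : ∀ n ∈ N, ∑ i, C (crossProduct n p i) * X i ≠ (0 : MvPolynomial (Fin 3) ℂ) := by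
    intro n hn h
    apply hl n (hN n hn) p (hp2 n hn)
    ext i
    have := congrArg (aeval (Pi.single i 1 : Fin 3 → ℂ)) h
    rw [map_sum, Finset.sum_eq_single i (fun j _ hj => by simp [hj]) (by simp)] at this
    simpa using this
  obtain ⟨q, hq⟩ := exists_aeval_ne_zero
    (Finset.prod_ne_zero_iff.2 fun n (hn : n ∈ N) => hlin n hn)
  rw [map_prod] at hq
  refine ⟨p, q, hp1, fun n hn => ?_⟩
  have := Finset.prod_ne_zero_iff.1 hq n hn
  rw [sum_mul_crossProduct]
  simpa using this

theorem pderiv_eq_zero_of_isHomogeneous_zero {σ : Type*} {H : MvPolynomial σ ℂ}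
    (h : H.IsHomogeneous 0) (k : σ) : pderiv k H = 0 := by
  rw [totalDegree_eq_zero_iff_eq_C.1 ((totalDegree_zero_iff_isHomogeneous _).2 h), pderiv_C]

/-- If two triples of binary forms, of degrees `d` and `d' < d`, are proportional and the first
one has no common zero, then the second one is zero. -/
theorem eq_zero_of_proportional_forms {D W : Fin 3 → MvPolynomial (Fin 2) ℂ} {d d' : ℕ}
    (hD : ∀ i, (D i).IsHomogeneous d) (hW : ∀ i, (W i).IsHomogeneous d') (hd : d' < d)
    (hno : ∀ s, ∃ j, valAt s (D j) ≠ 0) (hprop : ∀ i j, W i * D j = W j * D i) (i : Fin 3) :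
    W i = 0 := by
  by_contra hWi
  have hDi : D i ≠ 0 := by
    intro h
    obtain ⟨j, hj⟩ := hno OnePoint.infty
    have := hprop i j
    rw [h, mul_zero] at this
    exact hj (by rw [(mul_eq_zero.1 this).resolve_left hWi, valAt, map_zero, map_zero])
  obtain ⟨R, hR, -⟩ := exists_sum_ordAt_eq (hD i) hDi
  have h1 : ∑ s ∈ R, ordAt s (D i) ≤ ∑ s ∈ R, ordAt s (W i) := by
    refine Finset.sum_le_sum fun s _ => ?_
    obtain ⟨j, hj⟩ := hno s
    have h0 : ordAt s (D j) = 0 := by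
      rw [← nonpos_iff_eq_zero, ← not_lt, ordAt_pos_iff]; exact hj
    have := congrArg (ordAt s) (hprop i j)
    rw [ordAt_mul, ordAt_mul, h0, add_zero] at this
    rw [this]
    exact le_add_self
  have h2 := h1.trans (sum_ordAt_le (hW i) hWi R)
  rw [hR] at h2
  exact absurd (by exact_mod_cast h2) (not_le.2 hd)

/-- A parametrized curve of degree `e`, whose tangent lines are given by forms of degree `2 e`
without common zero, is contracted to a point, as the tangent lines of a curve are given by forms of
degree `2 e - 2`. -/
theorem contracted_of_tangent {γ D : Fin 3 → MvPolynomial (Fin 2) ℂ} {e : ℕ}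
    (hγ : ∀ i, (γ i).IsHomogeneous e) (hD : ∀ j, (D j).IsHomogeneous (e * 2))
    (hsum : ∀ k, D 0 * pderiv k (γ 0) + D 1 * pderiv k (γ 1) + D 2 * pderiv k (γ 2) = 0)
    (hno : ∀ s, ∃ j, valAt s (D j) ≠ 0) (i j : Fin 3) :
    γ i * pderiv 0 (γ j) = γ j * pderiv 0 (γ i) := by
  rcases Nat.eq_zero_or_pos e with he | he
  · rw [pderiv_eq_zero_of_isHomogeneous_zero (he ▸ hγ j),
      pderiv_eq_zero_of_isHomogeneous_zero (he ▸ hγ i), mul_zero, mul_zero]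
  obtain ⟨A, hA⟩ : ∃ A : Fin 3 → MvPolynomial (Fin 2) ℂ, ∀ i, A i = pderiv 0 (γ i) :=
    ⟨_, fun _ => rfl⟩
  obtain ⟨B, hB⟩ : ∃ B : Fin 3 → MvPolynomial (Fin 2) ℂ, ∀ i, B i = pderiv 1 (γ i) :=
    ⟨_, fun _ => rfl⟩
  have hA' := hsum 0
  have hB' := hsum 1
  simp only [← hA, ← hB] at hA' hB' ⊢
  have hhom : ∀ i j, (A i * B j).IsHomogeneous ((e - 1) + (e - 1)) := fun i j => by
    rw [hA, hB]; exact (hγ i).pderiv.mul (hγ j).pderiv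
  have hW : ∀ i, (crossProduct A B i).IsHomogeneous ((e - 1) + (e - 1)) := by
    intro i
    rw [cross_apply]
    fin_cases i
    · exact (hhom 1 2).sub (hhom 2 1)
    · exact (hhom 2 0).sub (hhom 0 2)
    · exact (hhom 0 1).sub (hhom 1 0)
  have h0 : crossProduct A B = 0 := _root_.funext fun i =>
    eq_zero_of_proportional_forms hD hW (by omega) hno (crossProduct_mul_eq hA' hB') i
  have hij := mul_eq_mul_of_crossProduct_eq_zero h0 i j
  have hi := (hγ i).sum_X_mul_pderiv
  have hj := (hγ j).sum_X_mul_pderiv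
  rw [Fin.sum_univ_two, nsmul_eq_mul, ← hA, ← hB] at hi hj
  have hne : (e : MvPolynomial (Fin 2) ℂ) ≠ 0 := by exact_mod_cast he.ne'
  apply mul_left_cancel₀ hne
  linear_combination A i * hj - A j * hi - X 1 * hij

section

variable {f g : Fin 3 → MvPolynomial (Fin 3) ℂ} {h : MvPolynomial (Fin 3) ℂ} {e : ℕ}

/-- The cubic of the net that corresponds to a line is rational, parametrized by the line, and
hence has a singular point. -/
theorem exists_singular_point_on_line (hf : ∀ i, (f i).IsHomogeneous 3)
    (hg : ∀ i, (g i).IsHomogeneous e) (hfg : ∀ i, aeval g (f i) = h * X i) {p q : Fin 3 → ℂ}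
    (hp : aeval p h ≠ 0) (hc : crossProduct p q ≠ 0) :
    ∃ s t : ℂ, ¬ (s = 0 ∧ t = 0) ∧ ∀ j, ∑ i, crossProduct p q i *
      aeval (fun k => aeval (fun m => s * p m + t * q m) (g k)) (pderiv j (f i)) = 0 := by
  set c := crossProduct p q with hcdef
  set lam : Fin 3 → MvPolynomial (Fin 2) ℂ := fun i => C (p i) * X 0 + C (q i) * X 1 with hlam
  set γ : Fin 3 → MvPolynomial (Fin 2) ℂ := fun i => aeval lam (g i) with hγ
  set H := aeval lam h with hH
  set F : MvPolynomial (Fin 3) ℂ := ∑ i, C (c i) * f i with hF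
  set D : Fin 3 → MvPolynomial (Fin 2) ℂ := fun j => aeval γ (pderiv j F) with hD
  have hlamhom : ∀ i, (lam i).IsHomogeneous 1 := fun i =>
    (isHomogeneous_C_mul_X _ _).add (isHomogeneous_C_mul_X _ _)
  have hγhom : ∀ i, (γ i).IsHomogeneous e := fun i => by
    have := (hg i).aeval (n := 1) lam hlamhom
    rwa [one_mul] at this
  have hFhom : F.IsHomogeneous 3 := IsHomogeneous.sum _ _ _ fun i _ => (hf i).C_mul _
  have hDhom : ∀ j, (D j).IsHomogeneous (e * 2) := fun j => (hFhom.pderiv).aeval γ hγhom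
  have hcomp : ∀ P : MvPolynomial (Fin 3) ℂ, aeval γ P = aeval lam (aeval g P) := by
    intro P
    rw [← AlgHom.comp_apply]
    congr 1
    apply MvPolynomial.algHom_ext
    intro i
    rw [aeval_X, AlgHom.comp_apply, aeval_X]
  have hfγ : ∀ i, aeval γ (f i) = H * lam i := fun i => by
    rw [hcomp, hfg, map_mul, aeval_X]
  have hpair : ∀ x y : ℂ, ∀ P : MvPolynomial (Fin 3) ℂ,
      aeval ![x, y] (aeval lam P) = aeval (fun m => x * p m + y * q m) P := by
    intro x y P
    rw [← AlgHom.comp_apply]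
    congr 1
    apply MvPolynomial.algHom_ext
    intro i
    simp [hlam, mul_comm]
  have hH0 : H ≠ 0 := by
    intro h0
    have := hpair 1 0 h
    rw [← hH, h0, map_zero] at this
    simp only [one_mul, zero_mul, add_zero] at this
    exact hp this.symm
  have hFγ : aeval γ F = 0 := by
    rw [hF, map_sum, Fin.sum_univ_three]
    simp only [map_mul, aeval_C, hfγ, algebraMap_eq, hlam, hcdef, cross_apply,
      Matrix.cons_val_zero, Matrix.cons_val_one, Matrix.cons_val, map_sub]
    ring
  have hDsum : ∀ k, D 0 * pderiv k (γ 0) + D 1 * pderiv k (γ 1) + D 2 * pderiv k (γ 2) = 0 := by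
    intro k
    have := pderiv_aeval_eq γ k F
    rw [hFγ, map_zero, Fin.sum_univ_three] at this
    exact this.symm
  by_contra hcon
  have hno : ∀ s, ∃ j, valAt s (D j) ≠ 0 := by
    intro s
    by_contra hs
    push Not at hs
    apply hcon
    refine ⟨dirVec s 0, dirVec s 1, dirVec_ne_zero s, fun j => ?_⟩
    have := hs j
    rw [valAt_eq, hD] at this
    simp only at this
    rw [hF, map_sum, map_sum, map_sum] at this
    rw [← this]
    refine Finset.sum_congr rfl fun i _ => ?_
    rw [pderiv_C_mul, map_mul, map_mul, aeval_C, algebraMap_eq, aeval_C]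
    congr 1
    rw [← AlgHom.comp_apply]
    congr 1
    apply MvPolynomial.algHom_ext
    intro k
    rw [aeval_X, AlgHom.comp_apply, aeval_X, hγ, hpair]
  have hγγ := contracted_of_tangent hγhom hDhom hDsum hno
  have hΦ : ∀ i j, γ i * pderiv 0 (H * lam j) = 3 * (H * lam j) * pderiv 0 (γ i) := by
    intro i j
    have h3 := congrArg (aeval γ) (hf j).sum_X_mul_pderiv
    rw [Fin.sum_univ_three] at h3
    simp only [map_add, map_mul, aeval_X, nsmul_eq_mul, map_natCast] at h3
    rw [← hfγ j, pderiv_aeval_eq, Fin.sum_univ_three]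
    push_cast at h3
    linear_combination aeval γ (pderiv 0 (f j)) * hγγ i 0 + aeval γ (pderiv 1 (f j)) * hγγ i 1 +
      aeval γ (pderiv 2 (f j)) * hγγ i 2 + pderiv 0 (γ i) * h3
  obtain ⟨i, hi⟩ : ∃ i, γ i ≠ 0 := by
    by_contra h0
    push Not at h0
    have hγ0 : γ = fun i => 0 * γ i := by ext1 i; rw [h0, zero_mul]
    have hl : ∀ j, lam j = 0 := fun j => by
      have := hfγ j
      rw [hγ0, aeval_mul_left_of_isHomogeneous (hf j)] at this
      rw [zero_pow (by norm_num), zero_mul] at this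
      exact (mul_eq_zero.1 this.symm).resolve_left hH0
    apply hc
    have hpq : ∀ j, p j = 0 := by
      intro j
      have := congrArg (aeval ![(1 : ℂ), 0]) (hl j)
      simpa [hlam] using this
    ext j
    fin_cases j <;> simp [hcdef, cross_apply, hpq]
  have hll : ∀ j l, p j * q l = p l * q j := by
    intro j l
    have h1 : H * lam l * pderiv 0 (H * lam j) = H * lam j * pderiv 0 (H * lam l) := by
      apply mul_left_cancel₀ hi
      linear_combination H * lam l * hΦ i j - H * lam j * hΦ i l
    have hpd : ∀ j, pderiv 0 (lam j) = C (p j) := by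
      intro j
      simp [hlam, pderiv_X]
    have h2 : lam l * C (p j) = lam j * C (p l) := by
      apply mul_left_cancel₀ (pow_ne_zero 2 hH0)
      rw [pderiv_mul, pderiv_mul, hpd, hpd] at h1
      linear_combination h1
    have h3 := congrArg (aeval ![(0 : ℂ), 1]) h2
    simp [hlam] at h3
    linear_combination h3
  exact hc (crossProduct_eq_zero_of_mul_eq_mul hll)

/-- A cubic Cremona map has a double point.  The cubic of the net that corresponds to a line in
general position has a singular point, the image of a point `u` of the line.  By differentiation
transversally to the line, `u` is a zero of `h`, so that its image is one of the finitely many base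
points.  If none of them were singular for the whole net, then the cubics of the net that are
singular at one of them would correspond to the lines through one of finitely many points. -/
theorem exists_double_point (hf : ∀ i, (f i).IsHomogeneous 3)
    (hfc : ∀ p, (∀ i, p ∣ f i) → IsUnit p) (hg : ∀ i, (g i).IsHomogeneous e)
    (hgc : ∀ p, (∀ i, p ∣ g i) → IsUnit p) (h0 : h ≠ 0) (hfg : ∀ i, aeval g (f i) = h * X i) :
    ∃ b : Fin 3 → ℂ, b ≠ 0 ∧ ∀ i j, aeval b (pderiv j (f i)) = 0 := by
  classical
  have hX : ¬ IsUnit (X 0 : MvPolynomial (Fin 3) ℂ) := by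
    intro hu
    have := hu.map (aeval (0 : Fin 3 → ℂ))
    simp at this
  have hfne : ∃ i, f i ≠ 0 := by
    by_contra hc
    push Not at hc
    exact hX (hfc _ fun i => by rw [hc]; exact dvd_zero _)
  have hgne : ∃ i, g i ≠ 0 := by
    by_contra hc
    push Not at hc
    exact hX (hgc _ fun i => by rw [hc]; exact dvd_zero _)
  obtain ⟨Z, hZ0, hZ⟩ := exists_finset_common_zeros hf hfne hfc
  obtain ⟨Y, hY0, hY⟩ := exists_finset_common_zeros hg hgne hgc
  by_contra hcon
  push Not at hcon
  have hn : ∀ b : Fin 3 → ℂ, ∃ n : Fin 3 → ℂ, n ≠ 0 ∧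
      (b ≠ 0 → ∃ j, n = fun i => aeval b (pderiv j (f i))) := by
    intro b
    by_cases hb : b = 0
    · exact ⟨1, one_ne_zero, fun h => absurd hb h⟩
    · obtain ⟨i, j, hij⟩ := hcon b hb
      exact ⟨_, fun h => hij (congrFun h i), fun _ => ⟨j, rfl⟩⟩
  choose n hn0 hn using hn
  obtain ⟨p, q, hp, hpq⟩ := exists_generic_line h0 ({1} ∪ Y ∪ Z.image n) (by
    intro v hv
    rcases Finset.mem_union.1 hv with hv | hv
    · rcases Finset.mem_union.1 hv with hv | hv
      · rw [Finset.mem_singleton.1 hv]; exact one_ne_zero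
      · exact hY0 v hv
    · obtain ⟨z, -, rfl⟩ := Finset.mem_image.1 hv
      exact hn0 z)
  have hc : crossProduct p q ≠ 0 := by
    intro h
    apply hpq 1 (by simp)
    simp [h]
  obtain ⟨s, t, hst, hsing⟩ := exists_singular_point_on_line hf hg hfg hp hc
  set u : Fin 3 → ℂ := fun m => s * p m + t * q m with hu
  have hcu : ∑ i, u i * crossProduct p q i = 0 := by
    simp only [hu, Fin.sum_univ_three, cross_apply, Matrix.cons_val_zero, Matrix.cons_val_one,
      Matrix.cons_val]
    ring
  have hu0 : u ≠ 0 := by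
    intro h
    have hm : ∀ m, s * p m + t * q m = 0 := fun m => congrFun h m
    apply hc
    by_cases hs : s = 0
    · have ht : t ≠ 0 := fun ht => hst ⟨hs, ht⟩
      have hq : ∀ m, q m = 0 := fun m => by
        have := hm m
        rw [hs, zero_mul, zero_add] at this
        exact (mul_eq_zero.1 this).resolve_left ht
      ext j; fin_cases j <;> simp [cross_apply, hq]
    · refine crossProduct_eq_zero_of_mul_eq_mul fun m l => ?_
      apply mul_left_cancel₀ hs
      linear_combination q l * hm m - q m * hm l
  set b : Fin 3 → ℂ := fun k => aeval u (g k) with hb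
  have hb0 : b ≠ 0 := by
    intro h
    obtain ⟨z, hz, a, -, rfl⟩ := hY u hu0 fun k => congrFun h k
    apply hpq _ (Finset.mem_union_left _ (Finset.mem_union_right _ hz))
    simp only [mul_assoc, ← Finset.mul_sum, hcu, mul_zero]
  have hcomp : ∀ P : MvPolynomial (Fin 3) ℂ, aeval u (aeval g P) = aeval b P := by
    intro P
    rw [← AlgHom.comp_apply]
    congr 1
    apply MvPolynomial.algHom_ext
    intro i
    rw [AlgHom.comp_apply, aeval_X, aeval_X]
  -- the derivative of the equation of the net, transversal to the line
  have hhu : aeval u h = 0 := by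
    obtain ⟨k, hk⟩ := Function.ne_iff.1 hc
    have e : aeval g (∑ i, C (crossProduct p q i) * f i) =
        h * ∑ i, C (crossProduct p q i) * (X i : MvPolynomial (Fin 3) ℂ) := by
      rw [map_sum, Finset.mul_sum]
      refine Finset.sum_congr rfl fun i _ => ?_
      rw [map_mul, hfg, aeval_C, algebraMap_eq]; ring
    have hl : ∀ x, aeval b (pderiv x (∑ i, C (crossProduct p q i) * f i)) = 0 := by
      intro x
      rw [map_sum, map_sum, ← hsing x]
      refine Finset.sum_congr rfl fun i _ => ?_
      rw [pderiv_C_mul, map_mul, aeval_C]; rfl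
    have hL : aeval u (pderiv k (aeval g (∑ i, C (crossProduct p q i) * f i))) = 0 := by
      rw [pderiv_aeval_eq, map_sum]
      exact Finset.sum_eq_zero fun x _ => by rw [map_mul, hcomp, hl, zero_mul]
    have hu : aeval u (∑ i, C (crossProduct p q i) * (X i : MvPolynomial (Fin 3) ℂ)) = 0 := by
      rw [map_sum, ← hcu]
      exact Finset.sum_congr rfl fun i _ => by
        rw [map_mul, aeval_C, aeval_X, mul_comm]; rfl
    have hpd : pderiv k (∑ i, C (crossProduct p q i) * (X i : MvPolynomial (Fin 3) ℂ)) =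
        C (crossProduct p q k) := by
      rw [map_sum, Finset.sum_eq_single k (fun i _ hi => by
        rw [pderiv_C_mul, pderiv_X_of_ne hi, mul_zero]) (by simp), pderiv_C_mul, pderiv_X_self,
        mul_one]
    rw [e, pderiv_mul, map_add, map_mul, map_mul, hu, mul_zero, zero_add, hpd, aeval_C] at hL
    exact (mul_eq_zero.1 hL).resolve_right hk
  have hfb : ∀ i, aeval b (f i) = 0 := by
    intro i
    rw [← hcomp, hfg, map_mul, hhu, zero_mul]
  obtain ⟨z, hz, a, ha, hza⟩ := hZ b hb0 hfb
  apply hpq _ (Finset.mem_union_right _ (Finset.mem_image_of_mem n hz))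
  obtain ⟨j, hj⟩ := hn z (hZ0 z hz)
  rw [hj]
  have : ∀ i, aeval z (pderiv j (f i)) = a ^ 2 * aeval b (pderiv j (f i)) := by
    intro i
    rw [hza, aeval_mul_left_of_isHomogeneous (hf i).pderiv]
  simp only [this]
  have hs := hsing j
  calc ∑ i, a ^ 2 * aeval b (pderiv j (f i)) * crossProduct p q i
      = a ^ 2 * ∑ i, crossProduct p q i * aeval b (pderiv j (f i)) := by
        rw [Finset.mul_sum]
        exact Finset.sum_congr rfl fun i _ => by ring
    _ = 0 := by rw [hs, mul_zero]

end

/-! ### Cubic forms with a double point -/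

/-- Division by the last variable. -/
theorem exists_eq_X_mul_add {P : MvPolynomial (Fin 3) ℂ} {n : ℕ} (hP : P.IsHomogeneous (n + 1)) :
    ∃ (Q : MvPolynomial (Fin 3) ℂ) (H : MvPolynomial (Fin 2) ℂ), Q.IsHomogeneous n ∧
      H.IsHomogeneous (n + 1) ∧ P = Q * X 2 + planeForm H := by
  set H : MvPolynomial (Fin 2) ℂ := aeval ![X 0, X 1, 0] P with hH
  have hHhom : H.IsHomogeneous (n + 1) := by
    have := hP.aeval (n := 1) (![X 0, X 1, 0] : Fin 3 → MvPolynomial (Fin 2) ℂ) (fun i => by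
      fin_cases i
      · exact isHomogeneous_X _ _
      · exact isHomogeneous_X _ _
      · exact isHomogeneous_zero _ _ _)
    rwa [one_mul] at this
  have hPH : (planeForm H).IsHomogeneous (n + 1) := by
    have := hHhom.aeval (n := 1) (![X 0, X 1] : Fin 2 → MvPolynomial (Fin 3) ℂ) (fun i => by
      fin_cases i <;> exact isHomogeneous_X _ _)
    rwa [one_mul] at this
  obtain ⟨Q, hQ⟩ : X 2 ∣ P - planeForm H := by
    rw [← Ideal.mem_span_singleton, ← Ideal.Quotient.eq]
    set I := Ideal.span {(X 2 : MvPolynomial (Fin 3) ℂ)}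
    have : (Ideal.Quotient.mkₐ ℂ I) = ((Ideal.Quotient.mkₐ ℂ I).comp planeForm).comp
        (aeval ![X 0, X 1, 0]) := by
      apply MvPolynomial.algHom_ext
      intro i
      rw [AlgHom.comp_apply, AlgHom.comp_apply, aeval_X]
      fin_cases i
      · simp [planeForm]
      · simp [planeForm]
      · have h0 : Ideal.Quotient.mkₐ ℂ I (X 2) = 0 :=
          Ideal.Quotient.eq_zero_iff_mem.2 (Ideal.mem_span_singleton_self _)
        simp [h0]
    exact DFunLike.congr_fun this P
  have hQ' : P = Q * X 2 + planeForm H := by linear_combination hQ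
  refine ⟨Q, H, ?_, hHhom, hQ'⟩
  by_cases h0 : Q = 0
  · rw [h0]; exact isHomogeneous_zero _ _ _
  · have h1 := hP.sub hPH
    have h2 : (X 2 : MvPolynomial (Fin 3) ℂ) * Q ≠ 0 := mul_ne_zero (X_ne_zero _) h0
    obtain ⟨i, j, hij, hi, hj⟩ := isHomogeneous_of_mul (hQ ▸ h1) h2
    have := hi.inj_right (isHomogeneous_X _ _) (X_ne_zero _)
    have : j = n := by omega
    rwa [← this]

/-- A cubic form with a double point at `[0 : 0 : 1]` is linear in the last variable. -/
theorem exists_eq_planeForm_of_double_point {F : MvPolynomial (Fin 3) ℂ} (hF : F.IsHomogeneous 3)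
    {w : Fin 3 → ℂ} (h0 : w 0 = 0) (h1 : w 1 = 0) (h2 : w 2 ≠ 0)
    (hd : ∀ j, aeval w (pderiv j F) = 0) :
    ∃ A B : MvPolynomial (Fin 2) ℂ, A.IsHomogeneous 2 ∧ B.IsHomogeneous 3 ∧
      F = planeForm A * X 2 + planeForm B := by
  obtain ⟨Q, B, hQ, hB, hFQ⟩ := exists_eq_X_mul_add hF
  obtain ⟨Q', A, hQ', hA, hQQ⟩ := exists_eq_X_mul_add hQ
  refine ⟨A, B, hA, hB, ?_⟩
  suffices h : Q' = 0 by rw [hFQ, hQQ, h]; ring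
  -- the value and the derivatives of a binary form of degree at least two at the origin vanish
  have hval : ∀ {H : MvPolynomial (Fin 2) ℂ} {n : ℕ}, H.IsHomogeneous (n + 1) →
      aeval w (planeForm H) = 0 := by
    intro H n hH
    have e : (![w 0, w 1] : Fin 2 → ℂ) = fun i => 0 * (0 : Fin 2 → ℂ) i := by
      ext i; fin_cases i <;> simp [h0, h1]
    rw [aeval_planeForm, e, aeval_mul_left_of_isHomogeneous hH, zero_pow (by omega), zero_mul]
  have hder : ∀ {H : MvPolynomial (Fin 2) ℂ} {n : ℕ}, H.IsHomogeneous (n + 2) → ∀ j,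
      aeval w (pderiv j (planeForm H)) = 0 := by
    intro H n hH j
    rw [planeForm, pderiv_aeval_eq, map_sum]
    refine Finset.sum_eq_zero fun i _ => ?_
    rw [map_mul, ← planeForm, hval (n := n) hH.pderiv, zero_mul]
  have hF' : F = Q' * X 2 ^ 2 + planeForm A * X 2 + planeForm B := by rw [hFQ, hQQ]; ring
  have hw2 : aeval w (Q') = 0 ∧ ∀ j, aeval w (pderiv j Q') = 0 := by
    have key : ∀ j, aeval w (pderiv j Q') * w 2 ^ 2 +
        aeval w Q' * aeval w (pderiv j (X 2 ^ 2 : MvPolynomial (Fin 3) ℂ)) = 0 := by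
      intro j
      have := hd j
      rw [hF'] at this
      simp only [map_add, pderiv_mul, map_mul, hder hA, hder hB, hval hA, map_pow, aeval_X,
        zero_mul, add_zero] at this
      linear_combination this
    have hX : aeval w (pderiv 2 (X 2 ^ 2 : MvPolynomial (Fin 3) ℂ)) = 2 * w 2 := by
      simp [Derivation.leibniz_pow]
    have hX' : ∀ j, j ≠ 2 → aeval w (pderiv j (X 2 ^ 2 : MvPolynomial (Fin 3) ℂ)) = 0 := by
      intro j hj
      simp [Derivation.leibniz_pow, pderiv_X_of_ne hj.symm]
    have he := congrArg (aeval w) hQ'.sum_X_mul_pderiv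
    rw [Fin.sum_univ_three, map_add, map_add, map_mul, map_mul, map_mul, aeval_X, aeval_X,
      aeval_X, h0, h1, one_smul] at he
    have k2 := key 2
    rw [hX] at k2
    have hv : aeval w Q' = 0 := by
      apply mul_left_cancel₀ (mul_ne_zero three_ne_zero h2)
      linear_combination k2 - w 2 * he
    refine ⟨hv, fun j => ?_⟩
    have := key j
    rw [hv, zero_mul, add_zero] at this
    exact (mul_eq_zero.1 this).resolve_right (pow_ne_zero _ h2)
  -- a linear form is determined by its derivatives
  have hc : ∀ j, pderiv j Q' = 0 := by
    intro j
    have h := hQ'.pderiv (i := j)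
    have hC := totalDegree_eq_zero_iff_eq_C.1 ((totalDegree_zero_iff_isHomogeneous _).2 h)
    have := hw2.2 j
    rw [hC, aeval_C] at this
    rw [hC, show coeff 0 (pderiv j Q') = 0 from this, map_zero]
  have := hQ'.sum_X_mul_pderiv
  simpa [hc] using this.symm

/-! ### Linear forms with coefficients in a ring of polynomials -/

section LinearForms

variable {R n : Type*} [CommRing R] [Fintype n]

theorem coeff_sum_C_mul_X (c : n → R) (i : n) :
    coeff (Finsupp.single i 1) (∑ j, C (c j) * X j) = c i := by
  classical
  rw [coeff_sum, Finset.sum_eq_single i _ (by simp)]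
  · rw [coeff_C_mul, coeff_X, if_pos rfl, mul_one]
  · intro j _ hj
    rw [coeff_C_mul, coeff_X, if_neg, mul_zero]
    rwa [Finsupp.single_left_inj Nat.one_ne_zero]

theorem irreducible_sum_C_mul_X [IsDomain R] {c : n → R} (h0 : ∃ i, c i ≠ 0)
    (hc : ∀ r, (∀ i, r ∣ c i) → IsUnit r) : Irreducible (∑ j, C (c j) * X j) := by
  have hne : ∑ j, C (c j) * X j ≠ 0 := by
    obtain ⟨i, hi⟩ := h0
    intro h
    have := coeff_sum_C_mul_X c i
    rw [h, coeff_zero] at this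
    exact hi this.symm
  refine irreducible_of_totalDegree_eq_one
    ((IsHomogeneous.sum _ _ _ fun i _ => isHomogeneous_C_mul_X _ _).totalDegree hne)
    fun r hr => hc r fun i => ?_
  rw [← coeff_sum_C_mul_X c i]
  exact hr _

end LinearForms

/-- The difference of the values of a polynomial at two points lies in each ideal that contains the
differences of the coordinates. -/
theorem dvd_aeval_sub_aeval {σ S : Type*} [CommRing S] [Algebra ℂ S] {L : S} {u v : σ → S}
    (h : ∀ i, L ∣ u i - v i) (P : MvPolynomial σ ℂ) : L ∣ aeval u P - aeval v P := by
  rw [← Ideal.mem_span_singleton, ← Ideal.Quotient.eq]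
  have : (Ideal.Quotient.mkₐ ℂ (Ideal.span {L})).comp (aeval u) =
      (Ideal.Quotient.mkₐ ℂ (Ideal.span {L})).comp (aeval v) := by
    apply MvPolynomial.algHom_ext
    intro i
    rw [AlgHom.comp_apply, AlgHom.comp_apply, aeval_X, aeval_X]
    exact Ideal.Quotient.eq.2 (Ideal.mem_span_singleton.2 (h i))
  exact DFunLike.congr_fun this P

/-- If the linear forms `c₀ Y₀ + c₁ Y₁ + c₂ Y₂`, whose coefficients are binary forms of degree `m`
without common factor, have a zero that is a rational function of `Y`, then `m = 1`: by Gauss's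
lemma the corresponding linear factor is the whole of the irreducible polynomial
`c₀ Y₀ + c₁ Y₁ + c₂ Y₂`. -/
theorem degree_eq_one_of_rational_zero {c : Fin 3 → MvPolynomial (Fin 2) ℂ} {m : ℕ}
    (hc : ∀ i, (c i).IsHomogeneous m) (hc0 : ∃ i, c i ≠ 0)
    (hcc : ∀ r, (∀ i, r ∣ c i) → IsUnit r) {γ : Fin 2 → MvPolynomial (Fin 3) ℂ}
    (hγ0 : ∃ i, γ i ≠ 0) (hγ : ∀ r, (∀ i, r ∣ γ i) → IsUnit r)
    (hz : ∑ i, aeval γ (c i) * X i = 0) : m = 1 := by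
  set σ := commAlgEquiv ℂ (Fin 3) (Fin 2)
  set K := ∑ i, C (c i) * (X i : MvPolynomial (Fin 3) (MvPolynomial (Fin 2) ℂ)) with hK
  have hKirr : Irreducible K := irreducible_sum_C_mul_X hc0 hcc
  have hσirr : Irreducible (σ K) := (MulEquiv.irreducible_iff σ).2 hKirr
  have hσC : ∀ P : MvPolynomial (Fin 2) ℂ, σ (C P) = aeval X P := by
    intro P
    have : (σ : MvPolynomial (Fin 3) (MvPolynomial (Fin 2) ℂ) →ₐ[ℂ]
        MvPolynomial (Fin 2) (MvPolynomial (Fin 3) ℂ)).comp (IsScalarTower.toAlgHom ℂ (MvPolynomial (Fin 2) ℂ)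
        (MvPolynomial (Fin 3) (MvPolynomial (Fin 2) ℂ))) = aeval X := by
      apply MvPolynomial.algHom_ext
      intro i
      simp [σ, algebraMap_eq]
    exact DFunLike.congr_fun this P
  have hσK : σ K = ∑ i, aeval X (c i) * C (X i) := by
    rw [hK, map_sum]
    refine Finset.sum_congr rfl fun i _ => ?_
    rw [map_mul, hσC]
    simp [σ]
  set L := ∑ j, C ((![γ 1, -γ 0] : Fin 2 → MvPolynomial (Fin 3) ℂ) j) *
    (X j : MvPolynomial (Fin 2) (MvPolynomial (Fin 3) ℂ)) with hL
  have hLe : L = C (γ 1) * X 0 - C (γ 0) * X 1 := by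
    rw [hL, Fin.sum_univ_two]; simp; ring
  have hLirr : Irreducible L := by
    refine irreducible_sum_C_mul_X ?_ fun r hr => hγ r fun i => ?_
    · obtain ⟨i, hi⟩ := hγ0
      fin_cases i
      · exact ⟨1, by simpa using hi⟩
      · exact ⟨0, by simpa using hi⟩
    · fin_cases i
      · simpa using hr 1
      · simpa using hr 0
  have hdvd : ∀ j, L ∣ C (γ j) ^ m * σ K := by
    intro j
    have h1 : ∀ i, L ∣ C (γ j) * X i - X j * C (γ i) := by
      intro i
      fin_cases i <;> fin_cases j
      · exact ⟨0, by simp; ring⟩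
      · exact ⟨1, by rw [hLe]; simp; ring⟩
      · exact ⟨-1, by rw [hLe]; simp; ring⟩
      · exact ⟨0, by simp; ring⟩
    have h2 : ∀ i, L ∣ C (γ j) ^ m * aeval X (c i) - X j ^ m * C (aeval γ (c i)) := by
      intro i
      have := dvd_aeval_sub_aeval h1 (c i)
      rw [aeval_mul_left_of_isHomogeneous (hc i), aeval_mul_left_of_isHomogeneous (hc i)] at this
      convert this using 3
      have h3 : (IsScalarTower.toAlgHom ℂ (MvPolynomial (Fin 3) ℂ)
        (MvPolynomial (Fin 2) (MvPolynomial (Fin 3) ℂ))).comp (aeval γ) =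
          aeval fun i => C (γ i) := by
        apply MvPolynomial.algHom_ext
        intro i
        simp [algebraMap_eq]
      exact DFunLike.congr_fun h3 (c i)
    have h3 : C (γ j) ^ m * σ K =
        ∑ i, (C (γ j) ^ m * aeval X (c i) - X j ^ m * C (aeval γ (c i))) * C (X i) := by
      have := congrArg (C : _ → MvPolynomial (Fin 2) (MvPolynomial (Fin 3) ℂ)) hz
      rw [map_sum, map_zero] at this
      simp only [map_mul] at this
      rw [hσK, Finset.mul_sum]
      simp only [sub_mul, Finset.sum_sub_distrib, mul_assoc, ← Finset.mul_sum, this]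
      rw [mul_zero, sub_zero]
    rw [h3]
    exact Finset.dvd_sum fun i _ => (h2 i).mul_right _
  have hLK : L ∣ σ K := by
    obtain ⟨j, hj⟩ := hγ0
    refine (hLirr.prime.dvd_or_dvd (hdvd j)).resolve_left fun h => ?_
    have h1 := map_dvd (eval (0 : Fin 2 → MvPolynomial (Fin 3) ℂ)) (hLirr.prime.dvd_of_dvd_pow h)
    rw [hLe] at h1
    simp at h1
    exact hj h1
  have hass := hLirr.associated_of_dvd hσirr hLK
  obtain ⟨u, hu⟩ := hass
  have hLh : L.IsHomogeneous 1 := IsHomogeneous.sum _ _ _ fun i _ => isHomogeneous_C_mul_X _ _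
  have hKh : (σ K).IsHomogeneous m := by
    rw [hσK]
    refine IsHomogeneous.sum _ _ _ fun i _ => ?_
    have h := (((hc i).map (C : ℂ →+* MvPolynomial (Fin 3) ℂ)).mul
      (isHomogeneous_C (Fin 2) (X i : MvPolynomial (Fin 3) ℂ)))
    rw [add_zero] at h
    convert h using 2
    rw [← hσC]
    exact commAlgEquiv_C _
  have d1 := hLh.totalDegree hLirr.ne_zero
  have d2 := hKh.totalDegree hσirr.ne_zero
  have d3 := totalDegree_mul_of_isDomain hLirr.ne_zero u.ne_zero
  have d4 := totalDegree_mul_of_isDomain u.ne_zero (u⁻¹).ne_zero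
  rw [u.mul_inv, totalDegree_one] at d4
  rw [hu] at d3
  omega

/-! ### The linear syzygy of the net -/

section Syzygy

variable {A B : Fin 3 → MvPolynomial (Fin 2) ℂ} {F g : Fin 3 → MvPolynomial (Fin 3) ℂ}
  {h h' : MvPolynomial (Fin 3) ℂ} {e : ℕ}

/-- A map that is dominant does not take values in a curve parametrized by binary forms. -/
theorem not_proportional_planeForm (hg : ∀ i, (g i).IsHomogeneous e) (h0 : h' ≠ 0)
    (hFg : ∀ i, aeval F (g i) = h' * X i) {P Q : MvPolynomial (Fin 3) ℂ} (hP : P ≠ 0)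
    {a : Fin 3 → MvPolynomial (Fin 2) ℂ} (ha : ∀ i, P * F i = Q * planeForm (a i)) : False := by
  have key : ∀ i, P ^ e * (h' * X i) = Q ^ e * planeForm (aeval a (g i)) := by
    intro i
    rw [← hFg, ← aeval_mul_left_of_isHomogeneous (hg i)]
    simp only [ha]
    rw [aeval_mul_left_of_isHomogeneous (hg i)]
    congr 1
    have : (aeval fun i => planeForm (a i)) = planeForm.comp (aeval a) := by
      apply MvPolynomial.algHom_ext
      intro i
      rw [AlgHom.comp_apply, aeval_X, aeval_X]
    rw [this, AlgHom.comp_apply]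
  have hne : ∀ i, P ^ e * (h' * X i) ≠ 0 := fun i =>
    mul_ne_zero (pow_ne_zero _ hP) (mul_ne_zero h0 (X_ne_zero _))
  have hQ : Q ^ e ≠ 0 := fun hQ => hne 0 (by rw [key, hQ, zero_mul])
  have h1 : X 2 * planeForm (aeval a (g 0)) = X 0 * planeForm (aeval a (g 2)) := by
    apply mul_left_cancel₀ hQ
    linear_combination X 0 * key 2 - X 2 * key 0
  have h2 := congrArg (aeval ![X 0, X 1, (0 : MvPolynomial (Fin 2) ℂ)]) h1
  simp only [map_mul, aeval_X, aeval_planeForm, Matrix.cons_val_zero, Matrix.cons_val_one,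
    Matrix.cons_val, aeval_X_pair, zero_mul] at h2
  have h3 := (mul_eq_zero.1 h2.symm).resolve_left (X_ne_zero _)
  exact hne 2 (by rw [key, h3, map_zero, mul_zero])

theorem exists_crossProduct_apply_ne_zero (hF : ∀ i, F i = planeForm (A i) * X 2 + planeForm (B i))
    (hg : ∀ i, (g i).IsHomogeneous e) (h0 : h' ≠ 0) (hFg : ∀ i, aeval F (g i) = h' * X i) :
    ∃ i, crossProduct A B i ≠ 0 := by
  by_contra hc
  push Not at hc
  have hm := mul_eq_mul_of_crossProduct_eq_zero (_root_.funext hc)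
  by_cases hA0 : ∀ i, A i = 0
  · exact not_proportional_planeForm hg h0 hFg (P := 1) (Q := 1) one_ne_zero (a := B) fun i => by
      rw [hF, hA0, map_zero, zero_mul, zero_add]
  · push Not at hA0
    obtain ⟨j, hj⟩ := hA0
    refine not_proportional_planeForm hg h0 hFg (P := planeForm (A j)) (Q := F j) (a := A)
      (fun h => hj (JonqMatrix.planeForm_injective (h.trans (map_zero _).symm))) fun i => ?_
    have := congrArg planeForm (hm j i)
    simp only [map_mul] at this
    rw [hF, hF]
    linear_combination this

/-- The lines through the double point are mapped to the lines through a point, as the inverse map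
is a rational section of the family of their images. -/
theorem exists_linear_syzygy (hF : ∀ i, F i = planeForm (A i) * X 2 + planeForm (B i))
    (hA : ∀ i, (A i).IsHomogeneous 2) (hB : ∀ i, (B i).IsHomogeneous 3)
    (hg : ∀ i, (g i).IsHomogeneous e) (h0 : h ≠ 0) (h0' : h' ≠ 0)
    (hgF : ∀ i, aeval g (F i) = h * X i) (hFg : ∀ i, aeval F (g i) = h' * X i) :
    ∃ c : Fin 3 → MvPolynomial (Fin 2) ℂ, (∀ i, (c i).IsHomogeneous 1) ∧
      (∀ p, (∀ i, p ∣ c i) → IsUnit p) ∧ ∑ i, c i * A i = 0 ∧ ∑ i, c i * B i = 0 := by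
  obtain ⟨i₀, hi₀⟩ := exists_crossProduct_apply_ne_zero hF hg h0' hFg
  have hhom : ∀ i j, (A i * B j).IsHomogeneous (2 + 3) := fun i j => (hA i).mul (hB j)
  have hW : ∀ i, (crossProduct A B i).IsHomogeneous (2 + 3) := by
    intro i
    rw [cross_apply]
    fin_cases i
    · exact (hhom 1 2).sub ((hhom 2 1))
    · exact (hhom 2 0).sub (hhom 0 2)
    · exact (hhom 0 1).sub (hhom 1 0)
  obtain ⟨d, c, _, m, -, hd0, -, hdc, hc, hcc⟩ := exists_eq_mul_noCommonFactor hW ⟨i₀, hi₀⟩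
  have hcA : ∑ i, c i * A i = 0 := by
    apply mul_left_cancel₀ hd0
    rw [Finset.mul_sum]
    simp only [← mul_assoc, ← hdc, Fin.sum_univ_three, cross_apply, Matrix.cons_val_zero,
      Matrix.cons_val_one, Matrix.cons_val]
    ring
  have hcB : ∑ i, c i * B i = 0 := by
    apply mul_left_cancel₀ hd0
    rw [Finset.mul_sum]
    simp only [← mul_assoc, ← hdc, Fin.sum_univ_three, cross_apply, Matrix.cons_val_zero,
      Matrix.cons_val_one, Matrix.cons_val]
    ring
  -- the first two coordinates of the inverse map
  have hgne : ∃ i : Fin 2, (![g 0, g 1] : Fin 2 → _) i ≠ 0 := by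
    by_contra hcon
    push Not at hcon
    have e0 : (![g 0, g 1] : Fin 2 → _) = fun i => (0 : MvPolynomial (Fin 3) ℂ) * X i.castSucc :=
      _root_.funext fun i => by rw [zero_mul]; exact hcon i
    have := hgF 0
    rw [hF, map_add, map_mul, aeval_planeForm, aeval_planeForm, e0,
      aeval_mul_left_of_isHomogeneous (hA 0), aeval_mul_left_of_isHomogeneous (hB 0)] at this
    simp [h0] at this
  obtain ⟨k, γ, _, _, -, hk0, -, hkγ, -, hγ⟩ :=
    exists_eq_mul_noCommonFactor (g := (![g 0, g 1] : Fin 2 → _)) (e := e) (fun i => by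
      fin_cases i <;> exact hg _) hgne
  have hγ0 : ∃ i, γ i ≠ 0 := by
    obtain ⟨i, hi⟩ := hgne
    exact ⟨i, fun h => hi (by rw [hkγ, h, mul_zero])⟩
  have hz : ∑ i, aeval γ (c i) * X i = 0 := by
    have hsum : ∑ i, planeForm (c i) * F i = 0 := by
      have e1 := congrArg planeForm hcA
      have e2 := congrArg planeForm hcB
      simp only [Fin.sum_univ_three, map_add, map_mul, map_zero] at e1 e2
      simp only [Fin.sum_univ_three, hF]
      linear_combination X 2 * e1 + e2
    have := congrArg (aeval g) hsum
    have hgγ : (![g 0, g 1] : Fin 2 → _) = fun i => k * γ i := _root_.funext hkγ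
    rw [map_sum, map_zero] at this
    simp only [map_mul, aeval_planeForm, hgF, hgγ, aeval_mul_left_of_isHomogeneous (hc _)] at this
    apply mul_left_cancel₀ (mul_ne_zero (pow_ne_zero m hk0) h0)
    rw [mul_zero, ← this, Finset.mul_sum]
    exact Finset.sum_congr rfl fun i _ => by ring
  have hm := degree_eq_one_of_rational_zero hc
    ⟨i₀, fun h => hi₀ (by rw [hdc, h, mul_zero])⟩ hcc hγ0 hγ hz
  exact ⟨c, fun i => hm ▸ hc i, hcc, hcA, hcB⟩

/-- The solutions of the equation `x u + y v = 0`. -/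
theorem exists_eq_of_X_mul_add_eq_zero {u v : MvPolynomial (Fin 2) ℂ} {n : ℕ}
    (hu : u.IsHomogeneous (n + 1)) (huv : X 0 * u + X 1 * v = 0) :
    ∃ w : MvPolynomial (Fin 2) ℂ, w.IsHomogeneous n ∧ u = X 1 * w ∧ v = -X 0 * w := by
  have h1 : (X 1 : MvPolynomial (Fin 2) ℂ) ∣ X 0 * u := ⟨-v, by linear_combination huv⟩
  obtain ⟨w, hw⟩ := (X_prime.dvd_or_dvd h1).resolve_left (by rw [X_dvd_X]; simp)
  refine ⟨w, ?_, hw, ?_⟩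
  · by_cases h0 : w = 0
    · rw [h0]; exact isHomogeneous_zero _ _ _
    · obtain ⟨i, j, hij, hi, hj⟩ := isHomogeneous_of_mul (hw ▸ hu) (mul_ne_zero (X_ne_zero _) h0)
      have := hi.inj_right (isHomogeneous_X _ _) (X_ne_zero _)
      have : j = n := by omega
      rwa [← this]
  · apply mul_left_cancel₀ (X_ne_zero (R := ℂ) (1 : Fin 2))
    rw [hw] at huv
    linear_combination huv

theorem dirForm_dvd_of_ordAt_pos {H : MvPolynomial (Fin 2) ℂ} {d : ℕ} (hH : H.IsHomogeneous d)
    {s : OnePoint ℂ} (hs : 0 < ordAt s H) : dirForm s ∣ H := by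
  classical
  by_cases h0 : H = 0
  · rw [h0]; exact dvd_zero _
  · obtain ⟨R, a, ha, -, rfl⟩ := exists_eq_prod_dirForm hH h0
    rw [ordAt_mul, ordAt_C _ ha, zero_add, ordAt_prod_dirForm] at hs
    have : s ∈ R := Multiset.count_pos.1 (by exact_mod_cast hs)
    exact (Multiset.dvd_prod (Multiset.mem_map_of_mem _ this)).mul_left _

/-- The coefficients of a linear form in two variables. -/
theorem exists_eq_of_isHomogeneous_one {l : MvPolynomial (Fin 2) ℂ} (hl : l.IsHomogeneous 1) :
    ∃ a b : ℂ, l = C a * X 0 + C b * X 1 := by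
  rw [← mem_homogeneousSubmodule, homogeneousSubmodule_one_eq_span_X] at hl
  induction hl using Submodule.span_induction with
  | mem x hx =>
    obtain ⟨i, rfl⟩ := hx
    fin_cases i
    · exact ⟨1, 0, by simp⟩
    · exact ⟨0, 1, by simp⟩
  | zero => exact ⟨0, 0, by simp⟩
  | add x y _ _ hx hy =>
    obtain ⟨a, b, rfl⟩ := hx
    obtain ⟨a', b', rfl⟩ := hy
    exact ⟨a + a', b + b', by simp only [C_add]; ring⟩
  | smul r x _ hx =>
    obtain ⟨a, b, rfl⟩ := hx
    exact ⟨r * a, r * b, by simp only [C_mul, smul_eq_C_mul]; ring⟩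

/-- Two triples of binary forms with a common linear syzygy are the combinations of two rows. -/
theorem exists_rows_of_linear_syzygy (hA : ∀ i, (A i).IsHomogeneous 2)
    (hB : ∀ i, (B i).IsHomogeneous 3) {c : Fin 3 → MvPolynomial (Fin 2) ℂ}
    (hc : ∀ i, (c i).IsHomogeneous 1) (hcc : ∀ p, (∀ i, p ∣ c i) → IsUnit p)
    (hcA : ∑ i, c i * A i = 0) (hcB : ∑ i, c i * B i = 0) :
    ∃ (k : Fin 3) (a b : Fin 3 → ℂ) (w p q : Fin 3 → ℂ) (u v : MvPolynomial (Fin 2) ℂ),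
      u.IsHomogeneous 1 ∧ v.IsHomogeneous 2 ∧
      (∑ i, C (a i) * A i = X 1 * u) ∧ (∑ i, C (b i) * A i = - X 0 * u) ∧
      (∑ i, C (a i) * B i = X 1 * v) ∧ (∑ i, C (b i) * B i = - X 0 * v) ∧
      (∀ i, A i = C (w i) * A k + (C (p i) * X 0 + C (q i) * X 1) * u) ∧
      (∀ i, B i = C (w i) * B k + (C (p i) * X 0 + C (q i) * X 1) * v) := by
  choose a b hab using fun i => exists_eq_of_isHomogeneous_one (hc i)
  have hcombA : ∀ a : Fin 3 → ℂ, (∑ i, C (a i) * A i).IsHomogeneous 2 := fun a =>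
    IsHomogeneous.sum _ _ _ fun i _ => (hA i).C_mul _
  have hcombB : ∀ a : Fin 3 → ℂ, (∑ i, C (a i) * B i).IsHomogeneous 3 := fun a =>
    IsHomogeneous.sum _ _ _ fun i _ => (hB i).C_mul _
  obtain ⟨u, hu, hau, hbu⟩ := exists_eq_of_X_mul_add_eq_zero (hcombA a)
    (v := ∑ i, C (b i) * A i) (by
      simp only [Fin.sum_univ_three, hab] at hcA ⊢
      linear_combination hcA)
  obtain ⟨v, hv, hav, hbv⟩ := exists_eq_of_X_mul_add_eq_zero (hcombB a)
    (v := ∑ i, C (b i) * B i) (by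
      simp only [Fin.sum_univ_three, hab] at hcB ⊢
      linear_combination hcB)
  obtain ⟨k, hk⟩ : ∃ k, crossProduct a b k ≠ 0 := by
    by_contra hcon
    push Not at hcon
    have hm := mul_eq_mul_of_crossProduct_eq_zero (_root_.funext hcon)
    have hX : ∀ s t : ℂ, ¬ IsUnit (C s * X 0 + C t * X 1 : MvPolynomial (Fin 2) ℂ) := by
      intro s t hu
      have := hu.map (aeval (0 : Fin 2 → ℂ))
      simp at this
    by_cases h0 : ∀ i, a i = 0
    · exact hX 0 1 (hcc _ fun i => ⟨C (b i), by rw [hab, h0]; simp [mul_comm]⟩)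
    · push Not at h0
      obtain ⟨j, hj⟩ := h0
      refine hX (a j) (b j) (hcc _ fun i => ⟨C (a i / a j), ?_⟩)
      have e1 : C (a i) = C (a j) * (C (a i / a j) : MvPolynomial (Fin 2) ℂ) := by
        rw [← C_mul, mul_div_cancel₀ _ hj]
      have e2 : C (b i) = C (b j) * (C (a i / a j) : MvPolynomial (Fin 2) ℂ) := by
        rw [← C_mul]; congr 1; field_simp; linear_combination hm j i
      rw [hab]
      linear_combination X 0 * e1 + X 1 * e2
  -- Cramer's rule in the basis formed by `a`, `b` and the `k`-th unit vector
  set D := crossProduct a b k with hD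
  set E : Fin 3 → ℂ := Pi.single k 1 with hE
  have cramer : ∀ H : Fin 3 → MvPolynomial (Fin 2) ℂ, ∀ i, C D * H i =
      C (crossProduct a b i) * H k + C (crossProduct b E i) * ∑ j, C (a j) * H j +
        C (crossProduct E a i) * ∑ j, C (b j) * H j := by
    intro H i
    simp only [hD, hE, Fin.sum_univ_three, cross_apply]
    fin_cases k <;> fin_cases i <;> simp <;> ring
  have hDD : (C D⁻¹ : MvPolynomial (Fin 2) ℂ) * C D = 1 := by
    rw [← C_mul, inv_mul_cancel₀ hk, C_1]
  have fin : ∀ (H : Fin 3 → MvPolynomial (Fin 2) ℂ) (r : MvPolynomial (Fin 2) ℂ),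
      ∑ j, C (a j) * H j = X 1 * r → ∑ j, C (b j) * H j = - X 0 * r → ∀ i, H i =
        C (D⁻¹ * crossProduct a b i) * H k + (C (-D⁻¹ * crossProduct E a i) * X 0 +
          C (D⁻¹ * crossProduct b E i) * X 1) * r := by
    intro H r h1 h2 i
    have := cramer H i
    rw [h1, h2] at this
    simp only [C_mul, C_neg]
    linear_combination C D⁻¹ * this - H i * hDD
  exact ⟨k, a, b, _, _, _, u, v, hu, hv, hau, hbu, hav, hbv, fin A u hau hbu, fin B v hav hbv⟩

/-- The net of a cubic Cremona map whose double point is `[0 : 0 : 1]`. -/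
theorem exists_span_eq_netIn (hF : ∀ i, F i = planeForm (A i) * X 2 + planeForm (B i))
    (hA : ∀ i, (A i).IsHomogeneous 2) (hB : ∀ i, (B i).IsHomogeneous 3)
    (hFc : ∀ p, (∀ i, p ∣ F i) → IsUnit p)
    (hg : ∀ i, (g i).IsHomogeneous e) (h0 : h ≠ 0) (h0' : h' ≠ 0)
    (hgF : ∀ i, aeval g (F i) = h * X i) (hFg : ∀ i, aeval F (g i) = h' * X i) :
    ∃ M : JonqMatrix, (Submodule.span ℂ (Set.range F) : Set (MvPolynomial (Fin 3) ℂ)) =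
      M.netIn X := by
  obtain ⟨c, hc, hcc, hcA, hcB⟩ := exists_linear_syzygy hF hA hB hg h0 h0' hgF hFg
  obtain ⟨k, a, b, w, p, q, u, v, hu, hv, hau, hbu, hav, hbv, hAi, hBi⟩ :=
    exists_rows_of_linear_syzygy hA hB hc hcc hcA hcB
  have hdet : A k * v - B k * u ≠ 0 := by
    intro hdet
    obtain ⟨i, hi⟩ := exists_crossProduct_apply_ne_zero hF hg h0' hFg
    refine hi (congrFun (crossProduct_eq_zero_of_mul_eq_mul fun i j => ?_) i)
    rw [hAi i, hAi j, hBi i, hBi j]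
    linear_combination (C (w i) * (C (p j) * X 0 + C (q j) * X 1) -
      C (w j) * (C (p i) * X 0 + C (q i) * X 1)) * hdet
  have hno : ∀ s, ¬ (0 < ordAt s (A k) ∧ 0 < ordAt s (B k) ∧ 0 < ordAt s u ∧ 0 < ordAt s v) := by
    rintro s ⟨h1, h2, h3, h4⟩
    have d1 := dirForm_dvd_of_ordAt_pos (hA k) h1
    have d2 := dirForm_dvd_of_ordAt_pos (hB k) h2
    have d3 := dirForm_dvd_of_ordAt_pos hu h3
    have d4 := dirForm_dvd_of_ordAt_pos hv h4
    have hun : IsUnit (planeForm (dirForm s)) := by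
      refine hFc _ fun i => ?_
      rw [hF]
      refine dvd_add (Dvd.dvd.mul_right (map_dvd _ ?_) _) (map_dvd _ ?_)
      · rw [hAi]; exact dvd_add (d1.mul_left _) (d3.mul_left _)
      · rw [hBi]; exact dvd_add (d2.mul_left _) (d4.mul_left _)
    have := hun.map (aeval (fun i => (0 : ℂ) * (0 : Fin 3 → ℂ) i))
    have e1 : (![(0 : ℂ) * (0 : Fin 3 → ℂ) 0, 0 * (0 : Fin 3 → ℂ) 1] : Fin 2 → ℂ) =
        fun i => 0 * (0 : Fin 2 → ℂ) i := by ext i; fin_cases i <;> rfl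
    rw [aeval_planeForm, e1, aeval_mul_left_of_isHomogeneous (isHomogeneous_dirForm s), pow_one,
      zero_mul] at this
    exact not_isUnit_zero this
  let M : JonqMatrix := ⟨A k, B k, u, v, hA k, hB k, hu, hv, hdet, hno⟩
  refine ⟨M, Set.ext fun f => ?_⟩
  have hmem : ∀ α β δ : ℂ, M.member α β δ X = C α * F k +
      (C β * X 0 + C δ * X 1) * (planeForm u * X 2 + planeForm v) := by
    intro α β δ
    rw [JonqMatrix.member, JonqMatrix.rowForm_X, JonqMatrix.rowForm_X, hF]
    simp only [smul_eq_C_mul]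
    rfl
  have hFi : ∀ i, F i = M.member (w i) (p i) (q i) X := by
    intro i
    rw [hmem, hF, hF, hAi i, hBi i]
    have hX0 : planeForm (X 0) = X 0 := by simp [planeForm]
    have hX1 : planeForm (X 1) = X 1 := by simp [planeForm]
    have hC : ∀ z, planeForm (C z) = C z := fun z => by simp [planeForm, algebraMap_eq]
    simp only [map_add, map_mul, hX0, hX1, hC]
    ring
  constructor
  · intro hf
    rw [SetLike.mem_coe, Submodule.mem_span_range_iff_exists_fun] at hf
    obtain ⟨r, rfl⟩ := hf
    refine ⟨∑ i, r i * w i, ∑ i, r i * p i, ∑ i, r i * q i, ?_⟩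
    rw [hmem, Fin.sum_univ_three, hFi 0, hFi 1, hFi 2, hmem, hmem, hmem]
    simp only [Fin.sum_univ_three, C_add, C_mul, smul_eq_C_mul]
    ring
  · rintro ⟨α, β, δ, rfl⟩
    rw [SetLike.mem_coe, Submodule.mem_span_range_iff_exists_fun]
    refine ⟨fun i => α * (Pi.single k 1 : Fin 3 → ℂ) i - β * b i + δ * a i, ?_⟩
    have hsingle : ∑ i, C ((Pi.single k 1 : Fin 3 → ℂ) i) * F i = F k := by
      rw [Finset.sum_eq_single k (fun i _ hi => by simp [hi]) (by simp)]
      simp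
    have hX0 : planeForm (X 0) = X 0 := by simp [planeForm]
    have hX1 : planeForm (X 1) = X 1 := by simp [planeForm]
    have hC : ∀ z, planeForm (C z) = C z := fun z => by simp [planeForm, algebraMap_eq]
    have e1 := congrArg planeForm hau
    have e2 := congrArg planeForm hbu
    have e3 := congrArg planeForm hav
    have e4 := congrArg planeForm hbv
    simp only [Fin.sum_univ_three, map_add, map_mul, map_neg, hX0, hX1, hC] at e1 e2 e3 e4
    rw [hmem, ← hsingle]
    simp only [Fin.sum_univ_three, C_add, C_mul, C_sub, smul_eq_C_mul]
    rw [hF 0, hF 1, hF 2]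
    linear_combination C δ * (X 2 * e1 + e3) - C β * (X 2 * e2 + e4)

end Syzygy

/-! ### The net of a cubic Cremona map -/

theorem exists_eq_mul_X_of_mul {k h : MvPolynomial (Fin 3) ℂ} {t : Fin 3 → MvPolynomial (Fin 3) ℂ}
    (h0 : h ≠ 0) (ht : ∀ i, k * t i = h * X i) : ∃ h', h' ≠ 0 ∧ ∀ i, t i = h' * X i := by
  have hk : k ≠ 0 := by
    rintro rfl
    exact mul_ne_zero h0 (X_ne_zero 0) (by rw [← ht, zero_mul])
  have hcross : ∀ i, X 0 * t i = X i * t 0 := fun i => by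
    apply mul_left_cancel₀ hk
    linear_combination X 0 * ht i - X i * ht 0
  obtain ⟨h', hh⟩ : (X 0 : MvPolynomial (Fin 3) ℂ) ∣ t 0 :=
    (X_prime.dvd_or_dvd (Dvd.intro _ (hcross 1))).resolve_left (by rw [X_dvd_X]; simp)
  have key : ∀ i, t i = h' * X i := fun i => by
    apply mul_left_cancel₀ (X_ne_zero (R := ℂ) (0 : Fin 3))
    rw [hcross, hh]; ring
  refine ⟨h', ?_, key⟩
  rintro rfl
  have := ht 0
  rw [key, zero_mul, mul_zero] at this
  exact mul_ne_zero h0 (X_ne_zero 0) this.symm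

theorem aeval_aeval_eq {σ τ S : Type} [CommRing S] [Algebra ℂ S] (u : τ → S)
    (v : σ → MvPolynomial τ ℂ) (P : MvPolynomial σ ℂ) :
    aeval u (aeval v P) = aeval (fun i => aeval u (v i)) P := by
  rw [← AlgHom.comp_apply]
  congr 1
  apply MvPolynomial.algHom_ext
  intro i
  rw [AlgHom.comp_apply, aeval_X, aeval_X]

/-- In linear coordinates at its double point, a cubic Cremona map is given by a matrix of binary
forms. -/
theorem PlaneCremonaMap.exists_net_eq (φ : PlaneCremonaMap) (hφ : φ.degree = 3) :
    ∃ (p : Projectivization ℂ (Fin 3 → ℂ)) (ℓ : Fin 3 → MvPolynomial (Fin 3) ℂ) (M : JonqMatrix),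
      IsFrame p ℓ ∧ φ.net = M.netIn ℓ := by
  obtain ⟨e, g, h, h', hg, h0, h0', hgf, hfg⟩ := φ.birational
  have hf : ∀ i, (φ.form i).IsHomogeneous 3 := fun i => by
    have := φ.isHomogeneous i
    rwa [hφ] at this
  -- the double point
  obtain ⟨b, hb0, hb⟩ : ∃ b : Fin 3 → ℂ, b ≠ 0 ∧ ∀ i j, aeval b (pderiv j (φ.form i)) = 0 := by
    have hgne : ∃ i, g i ≠ 0 := by
      refine ⟨0, fun hg0 => mul_ne_zero h0' (X_ne_zero 0) ?_⟩
      rw [← hfg, hg0, map_zero]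
    obtain ⟨k, g₁, _, e₁, -, -, -, hk, hg₁, hgc⟩ := exists_eq_mul_noCommonFactor hg hgne
    obtain ⟨h₁, hh₁, key⟩ := exists_eq_mul_X_of_mul (k := k ^ 3)
      (t := fun i => aeval g₁ (φ.form i)) h0 fun i => by
        rw [← aeval_mul_left_of_isHomogeneous (hf i), ← hgf, ← _root_.funext hk]
    exact exists_double_point hf φ.noCommonFactor hg₁ hgc hh₁ key
  set p := Projectivization.mk ℂ b hb0 with hp
  obtain ⟨a, ha⟩ := Projectivization.exists_smul_eq_mk_rep ℂ b hb0
  have hrep : p.rep = fun i => (a : ℂ) * b i := by rw [hp, ← ha]; rfl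
  have hbp : ∀ i j, aeval p.rep (pderiv j (φ.form i)) = 0 := fun i j => by
    rw [hrep, aeval_mul_left_of_isHomogeneous (hf i).pderiv, hb, mul_zero]
  obtain ⟨ℓ, hℓ⟩ := exists_isFrame p
  obtain ⟨E, hE, hE'⟩ := hℓ.exists_inverse
  set s : Fin 3 → MvPolynomial (Fin 3) ℂ := fun i => ∑ k, C (E i k) * X k with hs
  have hℓs : ∀ i, aeval ℓ (s i) = X i := fun i => by
    rw [← hE i, hs, map_sum]
    exact Finset.sum_congr rfl fun k _ => by rw [map_mul, aeval_C, aeval_X]; rfl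
  have hℓs' : ∀ P, aeval ℓ (aeval s P) = P := fun P => by
    rw [aeval_aeval_eq, _root_.funext hℓs, aeval_X_left, AlgHom.id_apply]
  have hsℓ' : ∀ P, aeval s (aeval ℓ P) = P := fun P => by
    rw [aeval_aeval_eq, _root_.funext hE', aeval_X_left, AlgHom.id_apply]
  set F : Fin 3 → MvPolynomial (Fin 3) ℂ := fun i => aeval s (φ.form i) with hF
  have hFhom : ∀ i, (F i).IsHomogeneous 3 := fun i => by
    have := (hf i).aeval (n := 1) s fun i =>
      IsHomogeneous.sum _ _ _ fun k _ => isHomogeneous_C_mul_X _ _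
    rwa [one_mul] at this
  set w : Fin 3 → ℂ := fun j => aeval p.rep (ℓ j) with hw
  have hws : ∀ i, aeval w (s i) = p.rep i := fun i => by
    rw [← aeval_X (R := ℂ) p.rep i, ← hℓs i, aeval_aeval_eq]
  obtain ⟨w0, w1, w2⟩ := hℓ.aeval_rep
  have hFd : ∀ i j, aeval w (pderiv j (F i)) = 0 := fun i j => by
    rw [hF, pderiv_aeval_eq, map_sum]
    refine Finset.sum_eq_zero fun k _ => ?_
    rw [map_mul, aeval_aeval_eq, _root_.funext hws, hbp, zero_mul]
  choose A B hA hB hAB using fun i =>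
    exists_eq_planeForm_of_double_point (hFhom i) w0 w1 w2 (hFd i)
  obtain ⟨M, hM⟩ := exists_span_eq_netIn hAB hA hB (g := fun j => aeval g (ℓ j)) (h := h)
    (h' := aeval s h') (e := e)
    (fun q hq => by
      have := φ.noCommonFactor (aeval ℓ q) fun i => by
        rw [← hℓs' (φ.form i)]; exact map_dvd _ (hq i)
      rw [← hsℓ' q]
      exact this.map _)
    (fun j => by
      have := (hℓ.homog j).aeval g hg
      rwa [mul_one] at this)
    h0 (fun hz => h0' (by rw [← hℓs' h', hz, map_zero]))
    (fun i => by rw [← aeval_aeval_eq, hℓs', hgf])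
    (fun j => by
      rw [hF, ← aeval_aeval_eq, aeval_aeval_eq φ.form, _root_.funext hfg,
        aeval_mul_left_of_isHomogeneous (hℓ.homog j), pow_one, aeval_X_left, AlgHom.id_apply,
        map_mul, hE'])
  refine ⟨p, ℓ, M, hℓ, ?_⟩
  have hnet : φ.net = (aeval ℓ : MvPolynomial (Fin 3) ℂ →ₐ[ℂ] _) ''
      (Submodule.span ℂ (Set.range F) : Set (MvPolynomial (Fin 3) ℂ)) := by
    have := Submodule.map_coe (aeval ℓ : MvPolynomial (Fin 3) ℂ →ₐ[ℂ] _).toLinearMap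
      (Submodule.span ℂ (Set.range F))
    rw [Submodule.map_span, ← Set.range_comp] at this
    have hr : (aeval ℓ : MvPolynomial (Fin 3) ℂ →ₐ[ℂ] _).toLinearMap ∘ F = φ.form :=
      _root_.funext fun i => hℓs' _
    rw [hr] at this
    exact this
  rw [hnet, hM]
  ext f
  constructor
  · rintro ⟨_, ⟨α, β, δ, rfl⟩, rfl⟩
    exact ⟨α, β, δ, by rw [JonqMatrix.map_member]; simp only [aeval_X]⟩
  · rintro ⟨α, β, δ, rfl⟩
    exact ⟨_, ⟨α, β, δ, rfl⟩, by rw [JonqMatrix.map_member]; simp only [aeval_X]⟩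

/-- Up to isomorphism there are exactly 31 enriched weighted proximity graphs of cubic plane
Cremona maps, namely the (pairwise non-isomorphic) graphs of the table. -/
theorem theorem6 :
    (∀ φ : PlaneCremonaMap, φ.degree = 3 →
      ∃ n : Fin 31, φ.enrichedGraph.Isomorphic (tableGraph n)) ∧
    (∀ n : Fin 31, ∃ φ : PlaneCremonaMap, φ.degree = 3 ∧
      φ.enrichedGraph.Isomorphic (tableGraph n)) ∧
    (∀ m n : Fin 31, (tableGraph m).Isomorphic (tableGraph n) → m = n) := by
  refine ⟨fun φ hφ => ?_, exists_cremona_isomorphic_tableGraph,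
    fun m n h => eq_of_tableGraph_isomorphic h⟩
  obtain ⟨p, ℓ, M, hℓ, hnet⟩ := φ.exists_net_eq hφ
  exact PlaneCremonaMap.exists_isomorphic_tableGraph hℓ hnet
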